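/- Let $d\ge 1$, fix a non-zero window $g\in\mathcal S(\mathbb R^d)$, and for $1\le p,q\le\infty$, $s\in\mathbb R$ let $\mathcal M^{p,q}_s=\mathcal M^{p,q}_s(\mathbb R^d)$ be the closure, in the space of tempered distributions, of the Schwartz class $\mathcal S(\mathbb R^d)$ with respect to the norm $$\|f\|_{\mathcal M^{p,q}_s}=\Big(\int_{\mathbb R^d}\Big(\int_{\mathbb R^d}|V_gf(x,\xi)|^p\,dx\Big)^{q/p}(1+|\xi|^2)^{sq/2}\,d\xi\Big)^{1/q},\qquad V_gf(x,\xi)=\int_{\mathbb R^d} e^{-2\pi i\langle\xi, y\rangle}f(y)\overline{g(y-x)}\,dy,$$ with the usual modifications for $p=\infty$ or $q=\infty$ (for a tempered distribution $f$, the last integral is read as a distributional pairing). For $t\in\mathbb R$ let $K'(t)=\cos(t\sqrt{-\Delta})$ and $K(t)=\sin(t\sqrt{-\Delta})/\sqrt{-\Delta}$ be the Fourier multipliers on $\mathbb R^d$ with symbols $\cos(2\pi t|\xi|)$ and $\sin(2\pi t|\xi|)/(2\pi|\xi|)$ (equal to $t$ at $\xi=0$). Let $s\ge 0$, $1\le p\le\infty$,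 and let $F:\mathbb C\to\mathbb C$ be an entire real-analytic function, i.e. $F(z)=\sum_{j,k=0}^\infty c_{j,k}z^j\bar z^k$ with complex $c_{j,k}$ and (absolute) convergence for all $z\in\mathbb C$, with $F(0)=0$. Then for every $R>0$ there exists $T>0$ such that for every $(u_0,u_1)$ in the ball $B_R$ of center $0$ and radius $R$ in $\mathcal M^{p,1}_s\times\mathcal M^{p,1}_{s-1}$ there exists a unique $u\in C([0,T];\mathcal M^{p,1}_s)$ satisfying $$u(t)=K'(t)u_0+K(t)u_1+\int_0^tK(t-\tau)F(u(\tau))\,d\tau,\qquad t\in[0,T].$$ Furthermore, the map $(u_0,u_1)\mapsto u$ from $B_R$ to $C([0,T];\mathcal M^{p,1}_s)$ is Lipschitz continuous. -/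

import Mathlib

open MeasureTheory Set Filter Topology
open scoped SchwartzMap ENNReal NNReal ComplexConjugate

noncomputable section

namespace ModulationNLW

/-- The Euclidean space `ℝ^d`. -/
abbrev Eucl (d : ℕ) := EuclideanSpace ℝ (Fin d)

variable {d : ℕ}

/-- The Schwartz function `y ↦ e^{-2πi⟨y,ξ⟩} * conj (g (y - x))`, that is, the complex conjugate
`conj (M_ξ T_x g)` of the time-frequency shift of the window `g`. -/
def conjShift (g : 𝓢(Eucl d, ℂ)) (x ξ : Eucl d) : 𝓢(Eucl d, ℂ) :=
  SchwartzMap.smulLeftCLM ℂ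
    (fun y : Eucl d => Complex.exp (((-(2 * Real.pi * inner ℝ y ξ) : ℝ) : ℂ) * Complex.I))
    (SchwartzMap.compSubConstCLM ℂ x
      (SchwartzMap.postcompCLM (Complex.conjCLE : ℂ →L[ℝ] ℂ) g))

/-- The characters `y ↦ e^{-2πi⟨y,ξ⟩}` have temperate growth. -/
theorem hasTemperateGrowth_char (ξ : Eucl d) :
    Function.HasTemperateGrowth
      (fun y : Eucl d => Complex.exp (((-(2 * Real.pi * inner ℝ y ξ) : ℝ) : ℂ) * Complex.I)) := by
  have h1 : Function.HasTemperateGrowth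
      (fun r : ℝ => Complex.exp ((r : ℂ) * Complex.I)) := by
    refine ⟨(Complex.ofRealCLM.contDiff.mul contDiff_const).cexp, fun n => ⟨0, 1, fun x => ?_⟩⟩
    have key : ∀ n : ℕ, iteratedDeriv n (fun r : ℝ => Complex.exp ((r : ℂ) * Complex.I))
        = fun r : ℝ => Complex.I ^ n * Complex.exp ((r : ℂ) * Complex.I) := by
      intro n
      induction n with
      | zero => simp
      | succ n ih =>
        rw [iteratedDeriv_succ, ih]
        funext r
        have hd : HasDerivAt (fun r : ℝ => (r : ℂ) * Complex.I) (1 * Complex.I) r :=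
          (Complex.ofRealCLM.hasDerivAt (x := r)).mul_const Complex.I
        rw [(hd.cexp.const_mul (Complex.I ^ n)).deriv]
        ring
    rw [norm_iteratedFDeriv_eq_norm_iteratedDeriv, key]
    simp [Complex.norm_exp_ofReal_mul_I]
  have h2 : Function.HasTemperateGrowth
      (fun y : Eucl d => -(2 * Real.pi * inner ℝ y ξ)) := by fun_prop
  exact h1.comp h2

theorem conjShift_apply (g : 𝓢(Eucl d, ℂ)) (x ξ y : Eucl d) :
    conjShift g x ξ y
      = Complex.exp (((-(2 * Real.pi * inner ℝ y ξ) : ℝ) : ℂ) * Complex.I) * conj (g (y - x)) := by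
  rw [conjShift, SchwartzMap.smulLeftCLM_apply_apply (hasTemperateGrowth_char ξ)]
  simp

/-- The short-time Fourier transform
`V_g f (x, ξ) = ∫ e^{-2πi⟨ξ,y⟩} f(y) conj (g (y - x)) dy` of a tempered distribution `f`. -/
def stft (g : 𝓢(Eucl d, ℂ)) (f : 𝓢'(Eucl d, ℂ)) (x ξ : Eucl d) : ℂ :=
  f (conjShift g x ξ)

/-- The modulation norm
`‖f‖_{M^{p,q}_s} = ‖ ξ ↦ ⟨ξ⟩^s ‖V_g f(·, ξ)‖_{L^p} ‖_{L^q}` with values in `[0, ∞]`,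
with respect to the window `g`. -/
def modNorm (g : 𝓢(Eucl d, ℂ)) (p q : ℝ≥0∞) (s : ℝ) (f : 𝓢'(Eucl d, ℂ)) : ℝ≥0∞ :=
  eLpNorm
    (fun ξ : Eucl d =>
      eLpNorm (fun x : Eucl d => stft g f x ξ) p volume *
        ENNReal.ofReal ((1 + ‖ξ‖ ^ 2) ^ (s / 2)))
    q volume

/-- The modulation space `M^{p,q}_s(ℝ^d)`: the closure of the Schwartz class, inside the tempered
distributions, with respect to the modulation norm. -/
def modSpace (g : 𝓢(Eucl d, ℂ)) (p q : ℝ≥0∞) (s : ℝ) : Set (𝓢'(Eucl d, ℂ)) :=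
  {f | modNorm g p q s f < ∞ ∧
    ∀ ε : ℝ≥0∞, 0 < ε → ∃ φ : 𝓢(Eucl d, ℂ), modNorm g p q s (f - (φ : 𝓢'(Eucl d, ℂ))) < ε}

/-- `u ∈ C([0,T]; M^{p,q}_s)`; only the values of `u` on `[0,T]` matter. -/
def IsContinuousCurve (g : 𝓢(Eucl d, ℂ)) (p q : ℝ≥0∞) (s T : ℝ) (u : ℝ → 𝓢'(Eucl d, ℂ)) : Prop :=
  ∀ t ∈ Icc (0 : ℝ) T, u t ∈ modSpace g p q s ∧
    Tendsto (fun τ => modNorm g p q s (u τ - u t)) (𝓝[Icc (0 : ℝ) T] t) (𝓝 0)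

/-- `K'(t) = cos (t √(-Δ))`, the Fourier multiplier with symbol `cos (2πt|ξ|)`.
The symbol is a smooth function of `|ξ|²` and has temperate growth. -/
def cosProp (t : ℝ) : 𝓢'(Eucl d, ℂ) →L[ℂ] 𝓢'(Eucl d, ℂ) :=
  TemperedDistribution.fourierMultiplierCLM ℂ
    (fun ξ : Eucl d => ((Real.cos (2 * Real.pi * t * ‖ξ‖) : ℝ) : ℂ))

/-- `K(t) = sin (t √(-Δ)) / √(-Δ)`, the Fourier multiplier with symbol
`sin (2πt|ξ|) / (2π|ξ|)`, which takes the value `t` at `ξ = 0`. Here `Real.sinc x = sin x / x` for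
`x ≠ 0` and `Real.sinc 0 = 1`. The symbol is a smooth function of `|ξ|²` and has temperate growth. -/
def sinProp (t : ℝ) : 𝓢'(Eucl d, ℂ) →L[ℂ] 𝓢'(Eucl d, ℂ) :=
  TemperedDistribution.fourierMultiplierCLM ℂ
    (fun ξ : Eucl d => ((t * Real.sinc (2 * Real.pi * t * ‖ξ‖) : ℝ) : ℂ))

/-- Away from `ξ = 0` the symbol of `sinProp t` is `sin (2πt|ξ|) / (2π|ξ|)`. -/
theorem sinSymbol_eq (t : ℝ) (ξ : Eucl d) (hξ : ξ ≠ 0) :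
    t * Real.sinc (2 * Real.pi * t * ‖ξ‖)
      = Real.sin (2 * Real.pi * t * ‖ξ‖) / (2 * Real.pi * ‖ξ‖) := by
  have h : ‖ξ‖ ≠ 0 := norm_ne_zero_iff.mpr hξ
  have hpi := Real.pi_ne_zero
  by_cases ht : t = 0
  · simp [ht]
  · rw [Real.sinc_of_ne_zero (by positivity)]
    field_simp

open Classical in
/-- The composition `F(u)`: if the tempered distribution `u` is given by an essentially bounded
function `f` for which `F ∘ f` is again essentially bounded (and measurable), then `F(u)` is the
tempered distribution given by `F ∘ f`. The function `f` is determined by `u` up to null sets. -/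
def nonlin (F : ℂ → ℂ) (u : 𝓢'(Eucl d, ℂ)) : 𝓢'(Eucl d, ℂ) :=
  if h : ∃ f : Lp ℂ ∞ (volume : Measure (Eucl d)),
      Lp.toTemperedDistribution f = u ∧ MemLp (fun x => F (f x)) ∞ volume then
    Lp.toTemperedDistribution (h.choose_spec.2.toLp (fun x => F (h.choose x)))
  else 0

/-- The value of `nonlin` does not depend on the chosen representative. -/
theorem nonlin_eq (F : ℂ → ℂ) (f : Lp ℂ ∞ (volume : Measure (Eucl d)))
    (hf : MemLp (fun x => F (f x)) ∞ volume) :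
    nonlin F (Lp.toTemperedDistribution f) = Lp.toTemperedDistribution (hf.toLp _) := by
  have h : ∃ f' : Lp ℂ ∞ (volume : Measure (Eucl d)),
      Lp.toTemperedDistribution f' = Lp.toTemperedDistribution f ∧
        MemLp (fun x => F (f' x)) ∞ volume := ⟨f, rfl, hf⟩
  have hinj := LinearMap.ker_eq_bot.mp
    (Lp.ker_toTemperedDistributionCLM_eq_bot (F := ℂ) (μ := (volume : Measure (Eucl d)))
      (p := ∞))
  have hc : h.choose = f := hinj h.choose_spec.1
  rw [nonlin, dif_pos h]
  congr 1
  rw [MemLp.toLp_eq_toLp_iff, hc]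

/-- `u` solves, for `t ∈ [0,T]`, the integral equation
`u(t) = K'(t) u₀ + K(t) u₁ + ∫₀ᵗ K(t - τ) F(u(τ)) dτ`,
the integral being the integral of a function of `τ` with values in the tempered distributions:
it exists and is evaluated by testing with Schwartz functions. -/
def SolvesDuhamel (F : ℂ → ℂ) (T : ℝ) (u₀ u₁ : 𝓢'(Eucl d, ℂ)) (u : ℝ → 𝓢'(Eucl d, ℂ)) : Prop :=
  ∀ t ∈ Icc (0 : ℝ) T, ∀ φ : 𝓢(Eucl d, ℂ),
    IntervalIntegrable (fun τ => sinProp (t - τ) (nonlin F (u τ)) φ) volume 0 t ∧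
    u t φ = cosProp t u₀ φ + sinProp t u₁ φ
      + ∫ τ in (0 : ℝ)..t, sinProp (t - τ) (nonlin F (u τ)) φ

/-- `u ∈ C([0,T]; M^{p,1}_s)` is a solution of the integral equation with data `(u₀, u₁)`. -/
def IsSolution (g : 𝓢(Eucl d, ℂ)) (p : ℝ≥0∞) (s T : ℝ) (F : ℂ → ℂ)
    (u₀ u₁ : 𝓢'(Eucl d, ℂ)) (u : ℝ → 𝓢'(Eucl d, ℂ)) : Prop :=
  IsContinuousCurve g p 1 s T u ∧ SolvesDuhamel F T u₀ u₁ u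

/-- The closed ball of center `0` and radius `R` in `M^{p,1}_s × M^{p,1}_{s-1}`, with the maximum
norm on the product. -/
def dataBall (g : 𝓢(Eucl d, ℂ)) (p : ℝ≥0∞) (s R : ℝ) : Set (𝓢'(Eucl d, ℂ) × 𝓢'(Eucl d, ℂ)) :=
  {w | w.1 ∈ modSpace g p 1 s ∧ w.2 ∈ modSpace g p 1 (s - 1) ∧
    max (modNorm g p 1 s w.1) (modNorm g p 1 (s - 1) w.2) ≤ ENNReal.ofReal R}

/-- `F` is an entire real-analytic function on `ℂ`: `F(z) = ∑ c_{j,k} z^j conj(z)^k`, the (double,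
hence absolutely convergent) power series converging for all `z ∈ ℂ`. -/
def IsEntireRealAnalytic (F : ℂ → ℂ) : Prop :=
  ∃ c : ℕ × ℕ → ℂ, ∀ z : ℂ, HasSum (fun n : ℕ × ℕ => c n * z ^ n.1 * conj z ^ n.2) (F z)

end ModulationNLW

end

noncomputable section

namespace ModulationNLW

/-! ### Minkowski and Hölder inequalities for `[0, ∞]`-valued functions. -/

section MixedNorms

variable {α β : Type*} [MeasurableSpace α] [MeasurableSpace β]

/-! The solution is a fixed point of the Duhamel map in the Banach space `M^{p,1}_s`. Three
properties of this space for `s ≥ 0` make this work: its elements are bounded continuous functions,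
it is an algebra under pointwise multiplication, and the propagators `K'(t)` and `K(t)` act on it
with bounds uniform for `|t| ≤ 1`, `K(t)` gaining one derivative.

The norm estimates start from the inversion formula of the short-time Fourier transform,
`reproducing_formula`. It expresses `f ψ` as a phase-space integral of `V_g f` against the transform
of `ψ`. Taking for `ψ` a time-frequency shift, or the image of one under the transpose of an
operator, turns that operator into an integral operator on phase space. If its kernel decays off the
diagonal, Minkowski, Young and Peetre give boundedness (`modNorm_le_of_stft_le`). For the identity
this shows independence of the window. For a Fourier multiplier the kernel is the Fourier transform
of the symbol cut off at two frequencies (`norm_stft_multiplier`), and its decay follows from bounds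
on the derivatives of the symbol. The wave symbols are entire functions of `|ξ|²`, controlled on a
complex strip, so Cauchy's estimates supply all these derivatives at once. For a tempered
distribution the inversion formula needs an exchange of the distribution with an integral of
Schwartz functions. `apply_eq_integral` obtains it by extending the distribution to a Banach space
of bounded functions, where Bochner integration applies.

The transform of a product is a convolution in frequency (`stft_mulS`), and `q = 1` makes this a
convolution of integrable functions; hence the algebra property. The everywhere convergent series of
`F` then sums in the algebra to a locally Lipschitz map vanishing at `0`
(`exists_nonlin_lipschitz`).

With data in a ball, the free evolution is bounded by some `M`, and for a short time depending only
on `M` the Duhamel map contracts the ball of radius `M + 1` (`exists_duhamel_solution`). Gronwall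
(`norm_duhamel_sub_le`) gives uniqueness among all continuous solutions, whatever their size, and
Lipschitz dependence on the data. `solvesDuhamel_iff` translates between the equation tested on
Schwartz functions and the Banach-valued one. -/

theorem lt_essSup_iff_measure_ne_zero {μ : Measure α} {f : α → ℝ≥0∞} {c : ℝ≥0∞} :
    c < essSup f μ ↔ μ {x | c < f x} ≠ 0 := by
  constructor
  · intro h h0
    refine absurd h (not_lt.mpr (essSup_le_of_ae_le c ?_))
    rw [EventuallyLE, ae_iff]
    simpa using h0
  · intro h
    by_contra hc
    rw [not_lt] at hc
    refine h (measure_mono_null (fun x hx => ?_) (meas_essSup_lt (f := f) (μ := μ)))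
    exact lt_of_le_of_lt hc hx

theorem eLpNorm_ennreal_eq {p : ℝ≥0∞} (h0 : p ≠ 0) (ht : p ≠ ∞) (f : α → ℝ≥0∞) (μ : Measure α) :
    eLpNorm f p μ = (∫⁻ x, f x ^ p.toReal ∂μ) ^ (1 / p.toReal) := by
  rw [eLpNorm_eq_lintegral_rpow_enorm_toReal h0 ht]; rfl

theorem measurable_eLpNorm_section {μ : Measure β} [SFinite μ] (p : ℝ≥0∞) {f : α → β → ℝ≥0∞}
    (hf : Measurable (Function.uncurry f)) : Measurable fun a => eLpNorm (f a) p μ := by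
  by_cases h0 : p = 0
  · simp [h0]
  by_cases ht : p = ∞
  · simp only [ht, eLpNorm_exponent_top, eLpNormEssSup]
    refine measurable_of_Ioi fun c => ?_
    -- For `p = ∞` the superlevel sets of the essential supremum are described by the measure of a
    -- section being nonzero, which depends measurably on the parameter.
    have h : (fun a => essSup (fun x => ‖f a x‖ₑ) μ) ⁻¹' Ioi c
        = (fun a => μ (Prod.mk a ⁻¹' {z : α × β | c < Function.uncurry f z})) ⁻¹' {0}ᶜ := by
      ext a
      exact lt_essSup_iff_measure_ne_zero
    rw [h]
    exact measurable_measure_prodMk_left (measurableSet_lt measurable_const hf)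
      (measurableSet_singleton _).compl
  · simp only [eLpNorm_ennreal_eq h0 ht]
    exact (Measurable.lintegral_prod_right' (hf.pow_const _)).pow_const _

/-- Minkowski's integral inequality. -/
theorem eLpNorm_lintegral_le {μ : Measure α} {ν : Measure β} [SFinite μ] [SFinite ν]
    {p : ℝ≥0∞} (hp : 1 ≤ p) {f : α → β → ℝ≥0∞} (hf : Measurable (Function.uncurry f)) :
    eLpNorm (fun x => ∫⁻ y, f x y ∂ν) p μ ≤ ∫⁻ y, eLpNorm (fun x => f x y) p μ ∂ν := by
  set a : β → ℝ≥0∞ := fun y => eLpNorm (fun x => f x y) p μ with ha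
  have hf' : Measurable (Function.uncurry fun y x => f x y) := hf.comp measurable_swap
  have ham : Measurable a := measurable_eLpNorm_section p hf'
  have hfx : ∀ x, Measurable fun y => f x y := fun x => hf.comp measurable_prodMk_left
  have hfy : ∀ y, Measurable fun x => f x y := fun y => hf'.comp measurable_prodMk_left
  by_cases ht : p = ∞
  · subst ht
    have h1 : ∀ᵐ y ∂ν, ∀ᵐ x ∂μ, f x y ≤ a y := by
      refine ae_of_all _ fun y => ?_
      simp only [ha, eLpNorm_exponent_top, eLpNormEssSup]
      exact ENNReal.ae_le_essSup (fun x => f x y)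
    have h2 : ∀ᵐ x ∂μ, ∀ᵐ y ∂ν, f x y ≤ a y := by
      refine (Measure.ae_ae_comm ?_).mp h1
      exact measurableSet_le hf' (ham.comp measurable_fst)
    rw [eLpNorm_exponent_top, eLpNormEssSup]
    refine essSup_le_of_ae_le _ ?_
    filter_upwards [h2] with x hx
    exact lintegral_mono_ae hx
  have h0 : p ≠ 0 := (zero_lt_one.trans_le hp).ne'
  set r := p.toReal with hr
  have hr1 : 1 ≤ r := by
    rw [hr]; simpa using (ENNReal.toReal_le_toReal ENNReal.one_ne_top ht).mpr hp
  have hr0 : 0 < r := by linarith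
  have har : ∀ y, a y ^ r = ∫⁻ x, f x y ^ r ∂μ := by
    intro y
    simp only [ha, eLpNorm_ennreal_eq h0 ht, ← hr]
    rw [← ENNReal.rpow_mul, one_div_mul_cancel hr0.ne', ENNReal.rpow_one]
  by_cases hA : ∫⁻ y, a y ∂ν = ∞
  · rw [hA]; exact le_top
  have hfin : ∀ᵐ y ∂ν, a y ≠ ∞ := (ae_lt_top ham hA).mono fun y hy => hy.ne
  -- This factorisation is chosen so that Hölder in `y` produces `∫ f^r a^(1-r)`, whose `x`-integral
  -- is `a^r a^(1-r) = a`. Where `a y = 0` the slice vanishes almost everywhere, and `a y = ∞`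
  -- occurs only on a null set since `∫ a` is finite.
  have h1 : ∀ᵐ y ∂ν, ∀ᵐ x ∂μ,
      f x y ≤ (f x y ^ r * a y ^ (1 - r)) ^ (1 / r) * a y ^ (1 - 1 / r) := by
    filter_upwards [hfin] with y hy
    by_cases hy0 : a y = 0
    · have : ∫⁻ x, f x y ^ r ∂μ = 0 := by
        rw [← har, hy0, ENNReal.zero_rpow_of_pos hr0]
      rw [lintegral_eq_zero_iff ((hfy y).pow_const _)] at this
      filter_upwards [this] with x hx
      have : f x y = 0 := by simpa [hr0, not_lt.mpr hr0.le] using hx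
      simp [this]
    · refine ae_of_all _ fun x => le_of_eq ?_
      rw [ENNReal.mul_rpow_of_nonneg _ _ (by positivity), ← ENNReal.rpow_mul,
        mul_one_div_cancel hr0.ne', ENNReal.rpow_one, ← ENNReal.rpow_mul, mul_assoc,
        ← ENNReal.rpow_add _ _ hy0 hy]
      have : (1 - r) * (1 / r) + (1 - 1 / r) = 0 := by field_simp; ring
      rw [this]; simp
  have h2 : ∀ᵐ x ∂μ, ∀ᵐ y ∂ν,
      f x y ≤ (f x y ^ r * a y ^ (1 - r)) ^ (1 / r) * a y ^ (1 - 1 / r) := by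
    refine (Measure.ae_ae_comm ?_).mp h1
    have hm : Measurable fun z : β × α => a z.1 := ham.comp measurable_fst
    exact measurableSet_le hf' ((((hf'.pow_const _).mul (hm.pow_const _)).pow_const _).mul
      (hm.pow_const _))
  have hq : 0 ≤ 1 - 1 / r := by
    rw [sub_nonneg, div_le_one hr0]; exact hr1
  have h3 : ∀ᵐ x ∂μ, (∫⁻ y, f x y ∂ν) ^ r
      ≤ (∫⁻ y, f x y ^ r * a y ^ (1 - r) ∂ν) * (∫⁻ y, a y ∂ν) ^ (r - 1) := by
    filter_upwards [h2] with x hx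
    have h := (lintegral_mono_ae hx).trans (ENNReal.lintegral_mul_norm_pow_le
      (((hfx x).pow_const r).mul (ham.pow_const (1 - r))).aemeasurable ham.aemeasurable
      (by positivity : 0 ≤ 1 / r) hq (by ring))
    refine (ENNReal.rpow_le_rpow h hr0.le).trans (le_of_eq ?_)
    rw [ENNReal.mul_rpow_of_nonneg _ _ hr0.le, ← ENNReal.rpow_mul, ← ENNReal.rpow_mul,
      one_div_mul_cancel hr0.ne', ENNReal.rpow_one]
    congr 2
    field_simp
  rw [eLpNorm_ennreal_eq h0 ht, ← hr]
  have h4 : ∫⁻ x, (∫⁻ y, f x y ∂ν) ^ r ∂μ ≤ (∫⁻ y, a y ∂ν) ^ r := by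
    have hm : Measurable fun z : α × β => f z.1 z.2 ^ r * a z.2 ^ (1 - r) :=
      (hf.pow_const _).mul ((ham.comp measurable_snd).pow_const _)
    calc ∫⁻ x, (∫⁻ y, f x y ∂ν) ^ r ∂μ
        ≤ ∫⁻ x, (∫⁻ y, f x y ^ r * a y ^ (1 - r) ∂ν) * (∫⁻ y, a y ∂ν) ^ (r - 1) ∂μ :=
          lintegral_mono_ae h3
      _ = (∫⁻ x, ∫⁻ y, f x y ^ r * a y ^ (1 - r) ∂ν ∂μ) * (∫⁻ y, a y ∂ν) ^ (r - 1) :=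
          lintegral_mul_const _ hm.lintegral_prod_right'
      _ = (∫⁻ y, ∫⁻ x, f x y ^ r * a y ^ (1 - r) ∂μ ∂ν) * (∫⁻ y, a y ∂ν) ^ (r - 1) := by
          rw [lintegral_lintegral_swap hm.aemeasurable]
      _ = (∫⁻ y, a y ^ r * a y ^ (1 - r) ∂ν) * (∫⁻ y, a y ∂ν) ^ (r - 1) := by
          congr 1
          refine lintegral_congr fun y => ?_
          rw [lintegral_mul_const _ ((hfy y).pow_const _), har]
      _ ≤ (∫⁻ y, a y ∂ν) * (∫⁻ y, a y ∂ν) ^ (r - 1) := by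
          gcongr with y
          by_cases hy0 : a y = 0
          · simp [hy0, hr0]
          by_cases hyt : a y = ∞
          · rw [hyt]; exact le_top
          rw [← ENNReal.rpow_add _ _ hy0 hyt]
          simp
      _ = (∫⁻ y, a y ∂ν) ^ r := by
          nth_rw 1 [← ENNReal.rpow_one (∫⁻ y, a y ∂ν)]
          rw [← ENNReal.rpow_add_of_nonneg _ _ zero_le_one (by linarith)]
          congr 1; ring
  calc (∫⁻ x, (∫⁻ y, f x y ∂ν) ^ r ∂μ) ^ (1 / r) ≤ ((∫⁻ y, a y ∂ν) ^ r) ^ (1 / r) :=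
        ENNReal.rpow_le_rpow h4 (by positivity)
    _ = ∫⁻ y, a y ∂ν := by
        rw [← ENNReal.rpow_mul, mul_one_div_cancel hr0.ne', ENNReal.rpow_one]

theorem eLpNorm_const_mul_ennreal {μ : Measure α} (p : ℝ≥0∞) {f : α → ℝ≥0∞} (hf : Measurable f)
    (c : ℝ≥0∞) : eLpNorm (fun x => c * f x) p μ = c * eLpNorm f p μ := by
  by_cases h0 : p = 0
  · simp [h0]
  by_cases ht : p = ∞
  · subst ht
    simp only [eLpNorm_exponent_top, eLpNormEssSup, enorm_eq_self]
    rw [ENNReal.essSup_const_mul]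
  have hr0 : 0 < p.toReal := ENNReal.toReal_pos h0 ht
  simp only [eLpNorm_ennreal_eq h0 ht]
  simp_rw [ENNReal.mul_rpow_of_nonneg _ _ hr0.le]
  rw [lintegral_const_mul _ (hf.pow_const _), ENNReal.mul_rpow_of_nonneg _ _ (by positivity),
    ← ENNReal.rpow_mul, mul_one_div_cancel hr0.ne', ENNReal.rpow_one]

theorem eLpNorm_mul_le_mul_top {μ : Measure α} (p : ℝ≥0∞) {f : α → ℝ≥0∞} (hf : Measurable f)
    (h : α → ℝ≥0∞) :
    eLpNorm (fun x => f x * h x) p μ ≤ eLpNorm f p μ * eLpNorm h ∞ μ := by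
  rw [mul_comm, ← eLpNorm_const_mul_ennreal p hf]
  refine eLpNorm_mono_enorm_ae ?_
  filter_upwards [ENNReal.ae_le_essSup (μ := μ) h] with x hx
  simp only [enorm_eq_self, eLpNorm_exponent_top, eLpNormEssSup]
  rw [mul_comm]
  gcongr

/-- Hölder's inequality against a bounded integrable weight. -/
theorem lintegral_mul_le_eLpNorm {μ : Measure α} {p : ℝ≥0∞} (hp : 1 ≤ p)
    {f w : α → ℝ≥0∞} (hf : Measurable f) (hw : Measurable w) (hw1 : ∀ x, w x ≤ 1) :
    ∫⁻ x, f x * w x ∂μ ≤ (1 + ∫⁻ x, w x ∂μ) * eLpNorm f p μ := by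
  by_cases ht : p = ∞
  · subst ht
    calc ∫⁻ x, f x * w x ∂μ ≤ ∫⁻ x, eLpNorm f ∞ μ * w x ∂μ := by
          refine lintegral_mono_ae ?_
          have := ENNReal.ae_le_essSup (μ := μ) f
          filter_upwards [this] with x hx
          rw [eLpNorm_exponent_top]
          gcongr
          exact hx
      _ = (∫⁻ x, w x ∂μ) * eLpNorm f ∞ μ := by rw [lintegral_const_mul _ hw, mul_comm]
      _ ≤ _ := by gcongr; exact le_add_self
  have h0 : p ≠ 0 := (zero_lt_one.trans_le hp).ne'
  set r := p.toReal with hr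
  have hr1 : 1 ≤ r := by
    rw [hr]; simpa using (ENNReal.toReal_le_toReal ENNReal.one_ne_top ht).mpr hp
  have hr0 : 0 < r := by linarith
  have hq : 0 ≤ 1 - 1 / r := by
    rw [sub_nonneg, div_le_one hr0]; exact hr1
  -- Hölder with the weight split between the two factors. Since `w ≤ 1` it can be dropped from the
  -- first factor, and `1 + ∫ w` bounds `(∫ w)^(1 - 1/r)` for every `r ≥ 1`, so the constant does
  -- not depend on `p`.
  have h1 : ∀ x, f x * w x = (f x ^ r * w x) ^ (1 / r) * w x ^ (1 - 1 / r) := by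
    intro x
    rw [ENNReal.mul_rpow_of_nonneg _ _ (by positivity), ← ENNReal.rpow_mul,
      mul_one_div_cancel hr0.ne', ENNReal.rpow_one, mul_assoc,
      ← ENNReal.rpow_add_of_nonneg _ _ (by positivity) hq]
    simp
  simp_rw [h1]
  refine (ENNReal.lintegral_mul_norm_pow_le ((hf.pow_const r).mul hw).aemeasurable
    hw.aemeasurable (by positivity) hq (by ring)).trans ?_
  rw [mul_comm, eLpNorm_ennreal_eq h0 ht, ← hr]
  gcongr with x
  · calc (∫⁻ x, w x ∂μ) ^ (1 - 1 / r) ≤ (1 + ∫⁻ x, w x ∂μ) ^ (1 - 1 / r) := by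
          gcongr; exact le_add_self
      _ ≤ (1 + ∫⁻ x, w x ∂μ) ^ (1 : ℝ) := by
          refine ENNReal.rpow_le_rpow_of_exponent_le le_self_add ?_
          have : 0 < 1 / r := by positivity
          linarith
      _ = _ := ENNReal.rpow_one _
  · exact mul_le_of_le_one_right' (hw1 x)

end MixedNorms

/-! ### Convolution with an integrable kernel. -/

section Convolution

variable {E : Type*} [NormedAddCommGroup E] [MeasurableSpace E] [BorelSpace E]
  [SecondCountableTopology E] {μ : Measure E} [μ.IsAddHaarMeasure] [μ.IsNegInvariant]

/-- Young's inequality for convolution with an integrable kernel. -/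
theorem eLpNorm_lintegral_mul_sub_le [SFinite μ] {p : ℝ≥0∞} (hp : 1 ≤ p) {f w : E → ℝ≥0∞}
    (hf : Measurable f) (hw : Measurable w) :
    eLpNorm (fun x => ∫⁻ y, f y * w (x - y) ∂μ) p μ ≤ (∫⁻ x, w x ∂μ) * eLpNorm f p μ := by
  have h1 : ∀ x, ∫⁻ y, f y * w (x - y) ∂μ = ∫⁻ y, f (x - y) * w y ∂μ := by
    intro x
    rw [← lintegral_sub_left_eq_self (fun y => f y * w (x - y)) x]
    simp
  simp_rw [h1]
  refine (eLpNorm_lintegral_le hp (f := fun x y => f (x - y) * w y) ?_).trans ?_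
  · exact (hf.comp (measurable_fst.sub measurable_snd)).mul (hw.comp measurable_snd)
  rw [mul_comm, ← lintegral_const_mul _ hw]
  refine lintegral_mono fun y => ?_
  have hm : Measurable fun x => f (x - y) := hf.comp (measurable_id.sub_const y)
  have h2 : eLpNorm (fun x => f (x - y)) p μ = eLpNorm f p μ :=
    eLpNorm_comp_measurePreserving hf.aestronglyMeasurable (measurePreserving_sub_right μ y)
  rw [← h2, mul_comm, ← eLpNorm_const_mul_ennreal p hm]
  simp_rw [mul_comm]
  exact le_rfl

/-- The `L^p` to `L^∞` companion of Young's inequality; it is what allows the exponent in `x` to be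
raised to `∞`. -/
theorem lintegral_mul_sub_le_eLpNorm {p : ℝ≥0∞} (hp : 1 ≤ p) {f w : E → ℝ≥0∞}
    (hf : Measurable f) (hw : Measurable w) (hw1 : ∀ x, w x ≤ 1) (x : E) :
    ∫⁻ y, f y * w (x - y) ∂μ ≤ (1 + ∫⁻ x, w x ∂μ) * eLpNorm f p μ := by
  refine (lintegral_mul_le_eLpNorm hp hf (hw.comp (measurable_const.sub measurable_id))
    (fun y => hw1 _)).trans (le_of_eq ?_)
  congr 2
  exact lintegral_sub_left_eq_self (fun y => w y) x

end Convolution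

end ModulationNLW
end

noncomputable section

namespace ModulationNLW

open SchwartzMap LineDeriv

/-! ### Joint continuity of translation on the Schwartz space. -/

section Translation

variable {E F : Type*} [NormedAddCommGroup E] [NormedSpace ℝ E] [NormedAddCommGroup F]
  [NormedSpace ℝ F] [NormedSpace ℂ F]

theorem iteratedFDeriv_compSubConstCLM (f : 𝓢(E, F)) (a : E) (n : ℕ) (x : E) :
    iteratedFDeriv ℝ n (compSubConstCLM ℂ a f) x = iteratedFDeriv ℝ n f (x - a) := by
  have : (compSubConstCLM ℂ a f : E → F) = fun x => f (x - a) := by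
    ext x; exact compSubConstCLM_apply f a x
  rw [this, iteratedFDeriv_comp_sub]

variable (E F) in
/-- The supremum of finitely many of the Schwartz seminorms. -/
def schwartzSup (s : Finset (ℕ × ℕ)) : Seminorm ℂ 𝓢(E, F) :=
  s.sup (schwartzSeminormFamily ℂ E F)

theorem continuous_schwartzSup (s : Finset (ℕ × ℕ)) : Continuous (schwartzSup E F s) :=
  Seminorm.continuous_finsetSup fun i _ => (schwartz_withSeminorms ℂ E F).continuous_seminorm i

/-- The weight is moved to the shifted point by `‖x‖ ≤ (1 + ‖a‖)(1 + ‖x - a‖)`, so translation costs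
only a polynomial in the shift. -/
theorem norm_pow_mul_iteratedFDeriv_sub_le (f : 𝓢(E, F)) (a x : E) (k n : ℕ) :
    ‖x‖ ^ k * ‖iteratedFDeriv ℝ n f (x - a)‖
      ≤ (1 + ‖a‖) ^ k * (2 ^ k * schwartzSup E F (Finset.Iic (k, n)) f) := by
  have h1 : ‖x‖ ≤ (1 + ‖a‖) * (1 + ‖x - a‖) := by
    have : ‖x‖ ≤ ‖x - a‖ + ‖a‖ := by simpa using norm_add_le (x - a) a
    nlinarith [norm_nonneg a, norm_nonneg (x - a)]
  have h2 := one_add_le_sup_seminorm_apply (𝕜 := ℂ) (m := (k, n)) le_rfl le_rfl f (x - a)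
  calc ‖x‖ ^ k * ‖iteratedFDeriv ℝ n f (x - a)‖
      ≤ ((1 + ‖a‖) * (1 + ‖x - a‖)) ^ k * ‖iteratedFDeriv ℝ n f (x - a)‖ := by gcongr
    _ = (1 + ‖a‖) ^ k * ((1 + ‖x - a‖) ^ k * ‖iteratedFDeriv ℝ n f (x - a)‖) := by
        rw [mul_pow, mul_assoc]
    _ ≤ _ := mul_le_mul_of_nonneg_left h2 (by positivity)

theorem seminorm_compSubConstCLM_le (f : 𝓢(E, F)) (a : E) (k n : ℕ) :
    SchwartzMap.seminorm ℂ k n (compSubConstCLM ℂ a f)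
      ≤ (1 + ‖a‖) ^ k * (2 ^ k * schwartzSup E F (Finset.Iic (k, n)) f) := by
  refine SchwartzMap.seminorm_le_bound ℂ k n _ (by positivity) fun x => ?_
  rw [iteratedFDeriv_compSubConstCLM]
  exact norm_pow_mul_iteratedFDeriv_sub_le f a x k n

/-- Mean value inequality along the segment from `a` to `b`, at the price of one more derivative;
points of the segment have norm at most `‖a‖ + ‖b‖`. -/
theorem seminorm_compSubConstCLM_sub_le (f : 𝓢(E, F)) (a b : E) (k n : ℕ) :
    SchwartzMap.seminorm ℂ k n (compSubConstCLM ℂ a f - compSubConstCLM ℂ b f)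
      ≤ (1 + (‖a‖ + ‖b‖)) ^ k * (2 ^ k * schwartzSup E F (Finset.Iic (k, n + 1)) f) * ‖a - b‖ := by
  refine SchwartzMap.seminorm_le_bound ℂ k n _ (by positivity) fun x => ?_
  have hs : ∀ c : E, ContDiff ℝ n (compSubConstCLM ℂ c f) := fun c =>
    (compSubConstCLM ℂ c f).smooth n
  have h1 : iteratedFDeriv ℝ n (compSubConstCLM ℂ a f - compSubConstCLM ℂ b f : 𝓢(E, F)) x
      = iteratedFDeriv ℝ n f (x - a) - iteratedFDeriv ℝ n f (x - b) := by
    rw [← iteratedFDeriv_compSubConstCLM, ← iteratedFDeriv_compSubConstCLM]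
    have : ((compSubConstCLM ℂ a f - compSubConstCLM ℂ b f : 𝓢(E, F)) : E → F)
      = (compSubConstCLM ℂ a f : E → F) - (compSubConstCLM ℂ b f : E → F) := rfl
    rw [this, iteratedFDeriv_sub_apply (hs a).contDiffAt (hs b).contDiffAt]
  rw [h1]
  have hdiff : Differentiable ℝ (iteratedFDeriv ℝ n f) :=
    (f.smooth ⊤).differentiable_iteratedFDeriv (mod_cast ENat.natCast_lt_top n)
  have hf1 : ∀ z : E, HasFDerivAt (fun c : E => iteratedFDeriv ℝ n f (x - c))
      (-(fderiv ℝ (iteratedFDeriv ℝ n f) (x - z))) z := by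
    intro z
    have h := (hdiff (x - z)).hasFDerivAt.comp z ((hasFDerivAt_id z).const_sub x)
    have h2 : (fderiv ℝ (iteratedFDeriv ℝ n f) (x - z)).comp (-ContinuousLinearMap.id ℝ E)
        = -(fderiv ℝ (iteratedFDeriv ℝ n f) (x - z)) := by ext v; simp
    rw [h2] at h
    exact h
  set K := (1 + (‖a‖ + ‖b‖)) ^ k * (2 ^ k * schwartzSup E F (Finset.Iic (k, n + 1)) f) with hK
  have hz : ∀ z ∈ segment ℝ a b,
      ‖x‖ ^ k * ‖fderiv ℝ (iteratedFDeriv ℝ n f) (x - z)‖ ≤ K := by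
    intro z hz
    have hz' : ‖z‖ ≤ ‖a‖ + ‖b‖ := by
      obtain ⟨s, t, hs, ht, hst, rfl⟩ := hz
      refine (norm_add_le _ _).trans ?_
      rw [norm_smul, norm_smul, Real.norm_of_nonneg hs, Real.norm_of_nonneg ht]
      gcongr
      · exact mul_le_of_le_one_left (norm_nonneg _) (by linarith)
      · exact mul_le_of_le_one_left (norm_nonneg _) (by linarith)
    rw [norm_fderiv_iteratedFDeriv]
    refine (norm_pow_mul_iteratedFDeriv_sub_le f z x k (n + 1)).trans ?_
    rw [hK]
    gcongr
  by_cases hx : ‖x‖ ^ k = 0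
  · rw [hx, zero_mul]; positivity
  have hx' : 0 < ‖x‖ ^ k := lt_of_le_of_ne (by positivity) (Ne.symm hx)
  -- The weight `‖x‖ ^ k` is constant along the segment, so it is divided out of the bound and
  -- restored afterwards.
  have h := (convex_segment a b).norm_image_sub_le_of_norm_hasFDerivWithin_le
    (C := K / ‖x‖ ^ k) (fun z _ => (hf1 z).hasFDerivWithinAt)
    (fun z h => by rw [norm_neg, le_div_iff₀' hx']; exact hz z h)
    (right_mem_segment ℝ a b) (left_mem_segment ℝ a b)
  calc _ ≤ ‖x‖ ^ k * (K / ‖x‖ ^ k * ‖a - b‖) := by gcongr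
    _ = K * ‖a - b‖ := by field_simp

theorem tendsto_sup_seminorm_sub {ι : Type*} {l : Filter ι} {u : ι → 𝓢(E, F)} {v : 𝓢(E, F)}
    (h : Tendsto u l (𝓝 v)) (s : Finset (ℕ × ℕ)) :
    Tendsto (fun i => schwartzSup E F s (u i - v)) l (𝓝 0) := by
  have hc := continuous_schwartzSup (E := E) (F := F) s
  have h2 : Tendsto (fun i => u i - v) l (𝓝 0) := by
    simpa using h.sub_const v
  have h3 := (hc.tendsto 0).comp h2
  rw [map_zero] at h3
  exact h3

/-- The increment splits into a translate of the increment of the function, bounded locally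
uniformly in the shift, and the difference of two translates of a fixed function. -/
theorem continuous_compSubConstCLM_uncurry :
    Continuous fun z : E × 𝓢(E, F) => compSubConstCLM ℂ z.1 z.2 := by
  refine continuous_iff_continuousAt.mpr fun z₀ => ?_
  rw [ContinuousAt, (schwartz_withSeminorms ℂ E F).tendsto_nhds]
  rintro ⟨k, n⟩ ε hε
  have h1 : Tendsto (fun z : E × 𝓢(E, F) =>
      (1 + ‖z.1‖) ^ k * (2 ^ k * schwartzSup E F (Finset.Iic (k, n)) (z.2 - z₀.2))
      + (1 + (‖z.1‖ + ‖z₀.1‖)) ^ k * (2 ^ k * schwartzSup E F (Finset.Iic (k, n + 1)) z₀.2) * ‖z.1 - z₀.1‖) (𝓝 z₀)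
      (𝓝 ((1 + ‖z₀.1‖) ^ k * (2 ^ k * 0)
        + (1 + (‖z₀.1‖ + ‖z₀.1‖)) ^ k * (2 ^ k * schwartzSup E F (Finset.Iic (k, n + 1)) z₀.2) * ‖z₀.1 - z₀.1‖)) := by
    have hz1 : Tendsto (fun z : E × 𝓢(E, F) => z.1) (𝓝 z₀) (𝓝 z₀.1) := continuous_fst.tendsto z₀
    refine Tendsto.add (Tendsto.mul ((hz1.norm.const_add 1).pow k) (Tendsto.const_mul _ ?_)) ?_
    · exact tendsto_sup_seminorm_sub (continuous_snd.tendsto z₀) _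
    · exact Tendsto.mul (Tendsto.mul_const _ (((hz1.norm.add_const _).const_add 1).pow k))
        (hz1.sub_const _).norm
  simp only [mul_zero, sub_self, norm_zero, add_zero] at h1
  filter_upwards [h1.eventually_lt_const hε] with z hz
  refine lt_of_le_of_lt ?_ hz
  have : compSubConstCLM ℂ z.1 z.2 - compSubConstCLM ℂ z₀.1 z₀.2
      = compSubConstCLM ℂ z.1 (z.2 - z₀.2)
        + (compSubConstCLM ℂ z.1 z₀.2 - compSubConstCLM ℂ z₀.1 z₀.2) := by
    rw [map_sub]; abel
  rw [this]
  refine (map_add_le_add _ _ _).trans (add_le_add ?_ ?_)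
  · exact seminorm_compSubConstCLM_le _ _ _ _
  · exact seminorm_compSubConstCLM_sub_le _ _ _ _ _

end Translation

/-! ### Families of Schwartz functions of polynomial growth. -/

section PolyBounded

variable {Z E F G H : Type*} [NormedAddCommGroup Z] [NormedAddCommGroup E] [NormedSpace ℝ E]
  [NormedAddCommGroup F] [NormedSpace ℝ F] [NormedSpace ℂ F]
  [NormedAddCommGroup G] [NormedSpace ℝ G] [NormedAddCommGroup H] [NormedSpace ℝ H]
  [NormedSpace ℂ H]

/-- A family of Schwartz functions whose continuous seminorms grow at most polynomially. -/
def PolyBounded (Ψ : Z → 𝓢(E, F)) : Prop :=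
  ∀ q : Seminorm ℂ 𝓢(E, F), Continuous q → ∃ C : ℝ, ∃ N : ℕ, 0 ≤ C ∧
    ∀ z, q (Ψ z) ≤ C * (1 + ‖z‖) ^ N

theorem exists_bound_of_finset_sup {Ψ : Z → 𝓢(E, F)} (s : Finset (ℕ × ℕ))
    (h : ∀ k n : ℕ, ∃ C : ℝ, ∃ N : ℕ, 0 ≤ C ∧
      ∀ z, SchwartzMap.seminorm ℂ k n (Ψ z) ≤ C * (1 + ‖z‖) ^ N) :
    ∃ C : ℝ, ∃ N : ℕ, 0 ≤ C ∧
      ∀ z, (s.sup (schwartzSeminormFamily ℂ E F)) (Ψ z) ≤ C * (1 + ‖z‖) ^ N := by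
  induction s using Finset.induction_on with
  | empty => exact ⟨0, 0, le_rfl, fun z => by simp⟩
  | insert a s _ ih =>
    obtain ⟨C, N, hC, hs⟩ := ih
    obtain ⟨C', N', hC', ha⟩ := h a.1 a.2
    refine ⟨C + C', N + N', by positivity, fun z => ?_⟩
    have h1 : (1 : ℝ) ≤ 1 + ‖z‖ := by linarith [norm_nonneg z]
    rw [Finset.sup_insert]
    refine max_le ((ha z).trans ?_) ((hs z).trans ?_)
    · exact mul_le_mul (by linarith) (pow_le_pow_right₀ h1 (by omega)) (by positivity)
        (by positivity)
    · exact mul_le_mul (by linarith) (pow_le_pow_right₀ h1 (by omega)) (by positivity)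
        (by positivity)

/-- Every continuous seminorm is dominated by a finite supremum of the standard ones. Defining the
notion through all continuous seminorms makes it obviously stable under continuous linear maps such
as the Fourier transform. -/
theorem polyBounded_of_seminorm {Ψ : Z → 𝓢(E, F)}
    (h : ∀ k n : ℕ, ∃ C : ℝ, ∃ N : ℕ, 0 ≤ C ∧
      ∀ z, SchwartzMap.seminorm ℂ k n (Ψ z) ≤ C * (1 + ‖z‖) ^ N) : PolyBounded Ψ := by
  intro q hq
  obtain ⟨s, K, -, hK⟩ := Seminorm.bound_of_continuous (schwartz_withSeminorms ℂ E F) q hq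
  obtain ⟨C, N, hC, hs⟩ := exists_bound_of_finset_sup s h
  refine ⟨K * C, N, by positivity, fun z => (hK (Ψ z)).trans ?_⟩
  rw [mul_assoc]
  exact mul_le_mul_of_nonneg_left (hs z) K.2

theorem polyBounded_const (φ : 𝓢(E, F)) : PolyBounded fun _ : Z => φ :=
  fun q _ => ⟨q φ, 0, apply_nonneg q φ, fun z => by simp⟩

theorem PolyBounded.clm_comp {Ψ : Z → 𝓢(E, F)} (h : PolyBounded Ψ)
    (A : 𝓢(E, F) →L[ℂ] 𝓢(G, H)) : PolyBounded fun z => A (Ψ z) := fun q hq =>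
  h (q.comp A.toLinearMap) (hq.comp A.continuous)

theorem PolyBounded.compSubConst {Ψ : Z → 𝓢(E, F)} (h : PolyBounded Ψ) {a : Z → E}
    (ha : ∀ z, ‖a z‖ ≤ ‖z‖) : PolyBounded fun z => compSubConstCLM ℂ (a z) (Ψ z) := by
  refine polyBounded_of_seminorm fun k n => ?_
  obtain ⟨C, N, hC, hs⟩ := h (schwartzSup E F (Finset.Iic (k, n))) (continuous_schwartzSup _)
  refine ⟨2 ^ k * C, k + N, by positivity, fun z => ?_⟩
  refine (seminorm_compSubConstCLM_le _ _ _ _).trans ?_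
  calc _ ≤ (1 + ‖z‖) ^ k * (2 ^ k * (C * (1 + ‖z‖) ^ N)) := by
        gcongr
        · exact ha z
        · exact hs z
    _ = _ := by rw [pow_add]; ring

end PolyBounded

/-! ### Tempered distributions under the integral sign. -/

section Exchange

variable {Z E : Type*} [TopologicalSpace Z] [MeasurableSpace Z]
  [OpensMeasurableSpace Z] [NormedAddCommGroup E] [NormedSpace ℝ E] {ν : Measure Z}

/-- Differentiation under the integral sign. The supremum of a directional derivative is itself a
continuous seminorm, so the hypothesis on seminorms supplies the dominating function. -/
theorem lineDerivOp_eq_integral {Ψ : Z → 𝓢(E, ℂ)} (hc : Continuous Ψ)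
    (hi : ∀ q : Seminorm ℂ 𝓢(E, ℂ), Continuous q → Integrable (fun z => q (Ψ z)) ν)
    {ψ : 𝓢(E, ℂ)} (h : ∀ y, ψ y = ∫ z, Ψ z y ∂ν) (m y : E) :
    (∂_{m} ψ : 𝓢(E, ℂ)) y = ∫ z, (∂_{m} (Ψ z) : 𝓢(E, ℂ)) y ∂ν := by
  have hev : ∀ x : E, Continuous fun φ : 𝓢(E, ℂ) => φ x := fun x =>
    ((TemperedDistribution.delta x).continuous :
      Continuous fun φ : 𝓢(E, ℂ) => TemperedDistribution.delta x φ)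
  have hL : Continuous fun φ : 𝓢(E, ℂ) => (∂_{m} φ : 𝓢(E, ℂ)) :=
    (lineDerivOpCLM ℂ 𝓢(E, ℂ) m).continuous
  let q₀ : Seminorm ℂ 𝓢(E, ℂ) := SchwartzMap.seminorm ℂ 0 0
  have hq₀ : Continuous q₀ :=
    (schwartz_withSeminorms ℂ E ℂ).continuous_seminorm (0, 0)
  have hd : ∀ (φ : 𝓢(E, ℂ)) (t : ℝ),
      HasDerivAt (fun t : ℝ => φ (y + t • m)) ((∂_{m} φ : 𝓢(E, ℂ)) (y + t • m)) t := by
    intro φ t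
    rw [SchwartzMap.lineDerivOp_apply_eq_fderiv]
    have h1 : HasDerivAt (fun t : ℝ => y + t • m) m t := by
      simpa using ((hasDerivAt_id t).smul_const m).const_add y
    exact (φ.hasFDerivAt (y + t • m)).comp_hasDerivAt t h1
  have key := hasDerivAt_integral_of_dominated_loc_of_deriv_le (μ := ν) (𝕜 := ℝ) (x₀ := 0)
    (s := univ) (F := fun t z => Ψ z (y + t • m))
    (F' := fun t z => (∂_{m} (Ψ z) : 𝓢(E, ℂ)) (y + t • m))
    (bound := fun z => (q₀.comp (lineDerivOpCLM ℂ 𝓢(E, ℂ) m).toLinearMap) (Ψ z))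
    univ_mem
    (Eventually.of_forall fun t => ((hev _).comp hc).aestronglyMeasurable)
    ?_ (((hev _).comp (hL.comp hc)).aestronglyMeasurable) ?_ ?_ ?_
  · have h2 := key.2
    simp only [← h] at h2
    have h3 := (hd ψ 0).unique h2
    simpa using h3
  · refine (hi q₀ hq₀).mono' ((hev _).comp hc).aestronglyMeasurable ?_
    exact ae_of_all _ fun z => SchwartzMap.norm_le_seminorm ℂ _ _
  · exact ae_of_all _ fun z t _ => SchwartzMap.norm_le_seminorm ℂ _ _
  · exact hi _ (hq₀.comp (lineDerivOpCLM ℂ 𝓢(E, ℂ) m).continuous)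
  · exact ae_of_all _ fun z t _ => hd (Ψ z) t

theorem iteratedLineDerivOp_eq_integral {n : ℕ} (m : Fin n → E) {Ψ : Z → 𝓢(E, ℂ)}
    (hc : Continuous Ψ)
    (hi : ∀ q : Seminorm ℂ 𝓢(E, ℂ), Continuous q → Integrable (fun z => q (Ψ z)) ν)
    {ψ : 𝓢(E, ℂ)} (h : ∀ y, ψ y = ∫ z, Ψ z y ∂ν) (y : E) :
    (∂^{m} ψ : 𝓢(E, ℂ)) y = ∫ z, (∂^{m} (Ψ z) : 𝓢(E, ℂ)) y ∂ν := by
  induction n generalizing y with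
  | zero => simpa using h y
  | succ n ih =>
    simp only [iteratedLineDerivOp_succ_left]
    refine lineDerivOp_eq_integral (Ψ := fun z => ∂^{Fin.tail m} (Ψ z)) ?_ ?_
      (fun y => ih (Fin.tail m) y) (m 0) y
    · exact (iteratedLineDerivOpCLM ℂ 𝓢(E, ℂ) (Fin.tail m)).continuous.comp hc
    · intro q hq
      exact hi (q.comp (iteratedLineDerivOpCLM ℂ 𝓢(E, ℂ) (Fin.tail m)).toLinearMap)
        (hq.comp (iteratedLineDerivOpCLM ℂ 𝓢(E, ℂ) (Fin.tail m)).continuous)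

variable (E) in
/-- Index set of the normalised weighted derivatives: order of the weight and of the derivative,
base point, directions. It carries the discrete topology. -/
def DerivIndex : Type _ := (ℕ × ℕ) × E × (ℕ → E)

instance : TopologicalSpace (DerivIndex E) := ⊥

instance : DiscreteTopology (DerivIndex E) := ⟨rfl⟩

/-- The scaling factor of the normalised weighted derivatives. -/
def derivScale (y : DerivIndex E) : ℝ := ‖y.2.1‖ ^ y.1.1 / ∏ j : Fin y.1.2, ‖y.2.2 j‖

theorem norm_derivScale_mul_le (y : DerivIndex E) (φ : 𝓢(E, ℂ)) :
    ‖(derivScale y : ℂ) * (∂^{fun j : Fin y.1.2 => y.2.2 j} φ : 𝓢(E, ℂ)) y.2.1‖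
      ≤ SchwartzMap.seminorm ℂ y.1.1 y.1.2 φ := by
  rw [SchwartzMap.iteratedLineDerivOp_eq_iteratedFDeriv, norm_mul, Complex.norm_real, derivScale,
    Real.norm_of_nonneg (div_nonneg (by positivity) (Finset.prod_nonneg fun _ _ => norm_nonneg _))]
  have h := (iteratedFDeriv ℝ y.1.2 φ y.2.1).le_opNorm (fun j : Fin y.1.2 => y.2.2 j)
  by_cases h0 : ∏ j : Fin y.1.2, ‖y.2.2 j‖ = 0
  · rw [h0]; simp
  have h0' : 0 < ∏ j : Fin y.1.2, ‖y.2.2 j‖ :=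
    lt_of_le_of_ne (Finset.prod_nonneg fun _ _ => norm_nonneg _) (Ne.symm h0)
  refine le_trans ?_ (SchwartzMap.le_seminorm ℂ y.1.1 y.1.2 φ y.2.1)
  rw [div_mul_eq_mul_div, div_le_iff₀ h0', mul_assoc]
  gcongr

open Classical in
/-- The simultaneous embedding by finitely many families of weighted derivatives. -/
def weightedDerivs (s : Finset (ℕ × ℕ)) :
    𝓢(E, ℂ) →ₗ[ℂ] BoundedContinuousFunction (DerivIndex E) ℂ where
  toFun φ := BoundedContinuousFunction.ofNormedAddCommGroupDiscrete
    (fun y => if y.1 ∈ s then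
      (derivScale y : ℂ) * (∂^{fun j : Fin y.1.2 => y.2.2 j} φ : 𝓢(E, ℂ)) y.2.1 else 0)
    (schwartzSup E ℂ s φ) (fun y => by
      split_ifs with h
      · exact (norm_derivScale_mul_le y φ).trans
          (Seminorm.le_finset_sup_apply (p := schwartzSeminormFamily ℂ E ℂ) h)
      · simp)
  map_add' φ ψ := by
    ext y
    by_cases h : y.1 ∈ s <;> simp [h, iteratedLineDerivOp_add, mul_add]
  map_smul' c φ := by
    ext y
    by_cases h : y.1 ∈ s <;> simp [h, iteratedLineDerivOp_smul, mul_left_comm]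

theorem weightedDerivs_apply_of_mem {s : Finset (ℕ × ℕ)} (φ : 𝓢(E, ℂ)) (y : DerivIndex E)
    (h : y.1 ∈ s) : weightedDerivs s φ y
      = (derivScale y : ℂ) * (∂^{fun j : Fin y.1.2 => y.2.2 j} φ : 𝓢(E, ℂ)) y.2.1 :=
  if_pos h

theorem weightedDerivs_apply_of_notMem {s : Finset (ℕ × ℕ)} (φ : 𝓢(E, ℂ)) (y : DerivIndex E)
    (h : y.1 ∉ s) : weightedDerivs s φ y = 0 :=
  if_neg h

theorem norm_weightedDerivs_le (s : Finset (ℕ × ℕ)) (φ : 𝓢(E, ℂ)) :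
    ‖weightedDerivs s φ‖ ≤ schwartzSup E ℂ s φ := by
  refine (BoundedContinuousFunction.norm_le (apply_nonneg _ _)).mpr fun y => ?_
  by_cases h : y.1 ∈ s
  · rw [weightedDerivs_apply_of_mem φ y h]
    exact (norm_derivScale_mul_le y φ).trans
      (Seminorm.le_finset_sup_apply (p := schwartzSeminormFamily ℂ E ℂ) h)
  · rw [weightedDerivs_apply_of_notMem φ y h, norm_zero]
    exact apply_nonneg _ _

/-- The index runs over all base points and all directions, so the supremum recovers the full
multilinear operator norm of each derivative. Together with the reverse bound, the embedding is
isometric for `schwartzSup`. -/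
theorem schwartzSup_le_norm_weightedDerivs (s : Finset (ℕ × ℕ)) (φ : 𝓢(E, ℂ)) :
    schwartzSup E ℂ s φ ≤ ‖weightedDerivs s φ‖ := by
  refine Seminorm.finset_sup_apply_le (norm_nonneg _) fun i hi => ?_
  refine SchwartzMap.seminorm_le_bound ℂ i.1 i.2 _ (norm_nonneg _) fun x => ?_
  by_cases hx : ‖x‖ ^ i.1 = 0
  · rw [hx, zero_mul]; exact norm_nonneg _
  have hx' : 0 < ‖x‖ ^ i.1 := lt_of_le_of_ne (by positivity) (Ne.symm hx)
  rw [← le_div_iff₀' hx']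
  refine ContinuousMultilinearMap.opNorm_le_bound (by positivity) fun v => ?_
  -- A zero direction is set aside because the normalisation divides by the product of the norms;
  -- the multilinear map vanishes there anyway.
  by_cases h0 : ∃ j, ‖v j‖ = 0
  · obtain ⟨j, hj⟩ := h0
    rw [ContinuousMultilinearMap.map_coord_zero _ j (norm_eq_zero.mp hj), norm_zero]
    exact mul_nonneg (by positivity) (Finset.prod_nonneg fun _ _ => norm_nonneg _)
  push Not at h0
  have hp : 0 < ∏ j, ‖v j‖ := Finset.prod_pos fun j _ =>
    lt_of_le_of_ne (norm_nonneg _) (Ne.symm (h0 j))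
  let y : DerivIndex E := (i, x, fun j => if h : j < i.2 then v ⟨j, h⟩ else 0)
  have hy : (fun j : Fin y.1.2 => y.2.2 j) = v := by
    funext j
    exact dif_pos j.2
  have h := (weightedDerivs s φ).norm_coe_le_norm y
  rw [weightedDerivs_apply_of_mem φ y hi, norm_mul, hy,
    SchwartzMap.iteratedLineDerivOp_eq_iteratedFDeriv, Complex.norm_real] at h
  have hs : derivScale y = ‖x‖ ^ i.1 / ∏ j, ‖v j‖ := by
    rw [← hy]; rfl
  rw [hs, Real.norm_of_nonneg (by positivity), div_mul_eq_mul_div, div_le_iff₀ hp] at h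
  rw [div_mul_eq_mul_div, le_div_iff₀' hx']
  exact h

/-- Continuity bounds the distribution by finitely many seminorms, that is, by the norm of the
embedded function. It therefore factors through the range of the embedding, and Hahn–Banach extends
it to the whole Banach space of bounded functions, where integrals commute with functionals. -/
theorem exists_clm_comp_weightedDerivs (f : 𝓢'(E, ℂ)) :
    ∃ (s : Finset (ℕ × ℕ)) (L : BoundedContinuousFunction (DerivIndex E) ℂ →L[ℂ] ℂ),
      ∀ φ, L (weightedDerivs s φ) = f φ := by
  let q : Seminorm ℂ 𝓢(E, ℂ) := (normSeminorm ℂ ℂ).comp f.toLinearMap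
  have hq : Continuous q := continuous_norm.comp f.continuous
  obtain ⟨s, K, -, hK⟩ := Seminorm.bound_of_continuous (schwartz_withSeminorms ℂ E ℂ) q hq
  let ι := weightedDerivs (E := E) s
  have hb : ∀ φ, ‖f φ‖ ≤ K * ‖ι φ‖ := fun φ => (hK φ).trans
    (mul_le_mul_of_nonneg_left (schwartzSup_le_norm_weightedDerivs s φ) K.2)
  have hker : LinearMap.ker ι ≤ LinearMap.ker f.toLinearMap := by
    intro φ hφ
    rw [LinearMap.mem_ker] at hφ ⊢
    have := hb φ
    rw [hφ, norm_zero, mul_zero] at this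
    exact norm_le_zero_iff.mp this
  let L₀ : LinearMap.range ι →ₗ[ℂ] ℂ :=
    ((LinearMap.ker ι).liftQ f.toLinearMap hker) ∘ₗ ι.quotKerEquivRange.symm.toLinearMap
  have hL₀ : ∀ φ, L₀ ⟨ι φ, LinearMap.mem_range_self ι φ⟩ = f φ := by
    intro φ
    have : ι.quotKerEquivRange.symm ⟨ι φ, LinearMap.mem_range_self ι φ⟩
        = (LinearMap.ker ι).mkQ φ := LinearMap.quotKerEquivRange_symm_apply_image ι φ _
    simp only [L₀, LinearMap.comp_apply, LinearEquiv.coe_coe, this]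
    rfl
  let L₁ : LinearMap.range ι →L[ℂ] ℂ := L₀.mkContinuous K (by
    rintro ⟨_, φ, rfl⟩
    rw [hL₀]
    exact hb φ)
  obtain ⟨L, hL, -⟩ := exists_extension_norm_eq (LinearMap.range ι) L₁
  refine ⟨s, L, fun φ => ?_⟩
  rw [← hL₀]
  exact hL ⟨ι φ, LinearMap.mem_range_self ι φ⟩

/-- A tempered distribution commutes with integrals of families of Schwartz functions. -/
theorem apply_eq_integral [SecondCountableTopology Z] (f : 𝓢'(E, ℂ)) {Ψ : Z → 𝓢(E, ℂ)} (hc : Continuous Ψ)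
    (hi : ∀ q : Seminorm ℂ 𝓢(E, ℂ), Continuous q → Integrable (fun z => q (Ψ z)) ν)
    {ψ : 𝓢(E, ℂ)} (h : ∀ y, ψ y = ∫ z, Ψ z y ∂ν) :
    f ψ = ∫ z, f (Ψ z) ∂ν := by
  obtain ⟨s, L, hL⟩ := exists_clm_comp_weightedDerivs f
  have hle : (normSeminorm ℂ (BoundedContinuousFunction (DerivIndex E) ℂ)).comp (weightedDerivs s)
      ≤ (1 : ℝ≥0) • s.sup (schwartzSeminormFamily ℂ E ℂ) := fun φ => by
    rw [one_smul]; exact norm_weightedDerivs_le s φ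
  have hcont : Continuous (weightedDerivs (E := E) s) :=
    (schwartz_withSeminorms ℂ E ℂ).continuous_normedSpace_rng _ (weightedDerivs s) ⟨s, 1, hle⟩
  have hint : Integrable (fun z => weightedDerivs s (Ψ z)) ν :=
    (hi _ (continuous_schwartzSup s)).mono' (hcont.comp hc).aestronglyMeasurable
      (ae_of_all _ fun z => norm_weightedDerivs_le s _)
  -- Checked coordinate by coordinate: evaluations pass through the Bochner integral, and what
  -- remains is differentiation under the integral sign.
  have hψ : weightedDerivs s ψ = ∫ z, weightedDerivs s (Ψ z) ∂ν := by
    ext y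
    have h1 := (BoundedContinuousFunction.evalCLM ℂ y : _ →L[ℂ] ℂ).integral_comp_comm hint
    simp only [BoundedContinuousFunction.evalCLM_apply] at h1
    rw [← h1]
    by_cases hy : y.1 ∈ s
    · simp only [weightedDerivs_apply_of_mem _ y hy]
      rw [integral_const_mul, iteratedLineDerivOp_eq_integral _ hc hi h]
    · simp [weightedDerivs_apply_of_notMem _ y hy]
  rw [← hL, hψ, ← L.integral_comp_comm hint]
  simp [hL]

end Exchange

end ModulationNLW
end

noncomputable section

namespace ModulationNLW

open SchwartzMap FourierTransform

variable {d : ℕ}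

/-! ### Japanese brackets and rapid decay. -/

section Weight

/-- The square `1 + ‖x‖²` of the Japanese bracket. -/
def jap (x : Eucl d) : ℝ := 1 + ‖x‖ ^ 2

theorem one_le_jap (x : Eucl d) : 1 ≤ jap x := by
  simp only [jap]; linarith [sq_nonneg ‖x‖]

theorem jap_pos (x : Eucl d) : 0 < jap x := zero_lt_one.trans_le (one_le_jap x)

@[simp]
theorem jap_neg (x : Eucl d) : jap (-x) = jap x := by simp [jap]

@[fun_prop]
theorem continuous_jap : Continuous (jap : Eucl d → ℝ) := by unfold jap; fun_prop

@[fun_prop]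
theorem continuous_jap_rpow (r : ℝ) : Continuous fun x : Eucl d => jap x ^ r :=
  continuous_jap.rpow_const fun x => Or.inl (jap_pos x).ne'

theorem jap_le_mul (a b : Eucl d) : jap a ≤ 2 * (jap b * jap (a - b)) := by
  have h : ‖a‖ ≤ ‖b‖ + ‖a - b‖ := by simpa using norm_add_le b (a - b)
  simp only [jap]
  have h2 : ‖a‖ ^ 2 ≤ (‖b‖ + ‖a - b‖) ^ 2 := by gcongr
  nlinarith [sq_nonneg (‖b‖ - ‖a - b‖), mul_nonneg (sq_nonneg ‖b‖) (sq_nonneg ‖a - b‖)]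

/-- Peetre's inequality. -/
theorem jap_rpow_le (r : ℝ) (a b : Eucl d) :
    jap a ^ r ≤ 2 ^ |r| * (jap b ^ r * jap (a - b) ^ |r|) := by
  rcases le_total 0 r with hr | hr
  · rw [abs_of_nonneg hr]
    refine (Real.rpow_le_rpow (jap_pos a).le (jap_le_mul a b) hr).trans (le_of_eq ?_)
    rw [Real.mul_rpow (by norm_num) (mul_pos (jap_pos _) (jap_pos _)).le,
      Real.mul_rpow (jap_pos _).le (jap_pos _).le]
  · have h := Real.rpow_le_rpow (jap_pos b).le (jap_le_mul b a) (neg_nonneg.mpr hr)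
    rw [Real.mul_rpow (by norm_num) (mul_pos (jap_pos _) (jap_pos _)).le,
      Real.mul_rpow (jap_pos _).le (jap_pos _).le, ← jap_neg (b - a), neg_sub] at h
    rw [abs_of_nonpos hr]
    have ha : jap a ^ (-r) * jap a ^ r = 1 := by
      rw [← Real.rpow_add (jap_pos a)]; simp
    have hb : jap b ^ (-r) * jap b ^ r = 1 := by
      rw [← Real.rpow_add (jap_pos b)]; simp
    calc jap a ^ r = (jap b ^ (-r) * jap b ^ r) * jap a ^ r := by rw [hb, one_mul]
      _ ≤ (2 ^ (-r) * (jap a ^ (-r) * jap (a - b) ^ (-r)) * jap b ^ r) * jap a ^ r := by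
          have := (jap_pos a).le
          have := (jap_pos b).le
          gcongr
      _ = (2 ^ (-r) * (jap b ^ r * jap (a - b) ^ (-r))) * (jap a ^ (-r) * jap a ^ r) := by ring
      _ = _ := by rw [ha, mul_one]

theorem jap_rpow_neg_le_one {r : ℝ} (hr : 0 ≤ r) (x : Eucl d) : jap x ^ (-r) ≤ 1 :=
  Real.rpow_le_one_of_one_le_of_nonpos (one_le_jap x) (by linarith)

theorem jap_rpow_mono {r r' : ℝ} (h : r ≤ r') (x : Eucl d) : jap x ^ r ≤ jap x ^ r' :=
  Real.rpow_le_rpow_of_exponent_le (one_le_jap x) h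

/-- Since `jap` is the square of the bracket, `d < 2 * r` would already suffice. -/
theorem integrable_jap_rpow {r : ℝ} (hr : (d : ℝ) < r) :
    Integrable (fun x : Eucl d => jap x ^ (-r)) := by
  have h : ((Module.finrank ℝ (Eucl d) : ℕ) : ℝ) < 2 * r := by
    rw [finrank_euclideanSpace_fin]
    have : (0 : ℝ) ≤ d := by positivity
    linarith
  have := integrable_rpow_neg_one_add_norm_sq (E := Eucl d) (μ := volume) h
  simpa [jap, neg_div] using this

/-- Separates the two variables of phase space, so that polynomial growth in the pair can be
absorbed by decay in each variable. -/
theorem one_add_norm_prod_le (z : Eucl d × Eucl d) : 1 + ‖z‖ ≤ 2 * (jap z.1 * jap z.2) := by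
  have h1 : ∀ t : ℝ, t ≤ 1 + t ^ 2 := fun t => by nlinarith [sq_nonneg (t - 1), sq_nonneg t]
  have ha := one_le_jap z.1
  have hb := one_le_jap z.2
  have hz : ‖z‖ ≤ jap z.1 * jap z.2 := by
    rw [Prod.norm_def]
    refine max_le ((h1 _).trans ?_) ((h1 _).trans ?_)
    · exact le_mul_of_one_le_right (jap_pos z.1).le hb
    · exact le_mul_of_one_le_left (jap_pos z.2).le ha
  nlinarith

theorem schwartz_decay (φ : 𝓢(Eucl d, ℂ)) (M : ℝ) :
    ∃ C, 0 ≤ C ∧ ∀ x, ‖φ x‖ ≤ C * jap x ^ (-M) := by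
  obtain ⟨k, hk⟩ := exists_nat_ge M
  refine ⟨2 ^ (2 * k) * ((Finset.Iic (2 * k, 0)).sup fun m =>
    SchwartzMap.seminorm ℂ m.1 m.2) φ, by positivity, fun x => ?_⟩
  have h := SchwartzMap.one_add_le_sup_seminorm_apply (𝕜 := ℂ) (m := (2 * k, 0)) le_rfl le_rfl φ x
  simp only [norm_iteratedFDeriv_zero] at h
  have h2 : jap x ^ M ≤ (1 + ‖x‖) ^ (2 * k) := by
    calc jap x ^ M ≤ jap x ^ (k : ℝ) := jap_rpow_mono hk x
      _ = jap x ^ k := Real.rpow_natCast _ _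
      _ ≤ ((1 + ‖x‖) ^ 2) ^ k := by
          have : jap x ≤ (1 + ‖x‖) ^ 2 := by simp only [jap]; nlinarith [norm_nonneg x]
          have := (jap_pos x).le
          gcongr
      _ = _ := by rw [pow_mul]
  rw [Real.rpow_neg (jap_pos x).le, ← div_eq_mul_inv, le_div_iff₀ (Real.rpow_pos_of_pos (jap_pos x) _),
    mul_comm]
  refine le_trans ?_ h
  gcongr

/-- By Peetre's inequality `⟨z⟩⟨z - y⟩` dominates `⟨y⟩` up to a constant, so decay of both factors
becomes decay in `y`. The first factor carries an extra power `d + 1` for integrability in `z`. -/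
theorem exists_integral_norm_mul_sub_le (a b : 𝓢(Eucl d, ℂ)) {M : ℝ} (hM : 0 ≤ M) :
    ∃ C, 0 ≤ C ∧ ∀ y, ∫ z, ‖a z‖ * ‖b (z - y)‖ ≤ C * jap y ^ (-M) := by
  obtain ⟨Ca, hCa, ha⟩ := schwartz_decay a (M + (d + 1))
  obtain ⟨Cb, hCb, hb⟩ := schwartz_decay b M
  have hint : Integrable fun z : Eucl d => jap z ^ (-((d : ℝ) + 1)) :=
    integrable_jap_rpow (by linarith)
  refine ⟨Ca * Cb * 2 ^ M * ∫ z : Eucl d, jap z ^ (-((d : ℝ) + 1)), ?_, fun y => ?_⟩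
  · have : 0 ≤ ∫ z : Eucl d, jap z ^ (-((d : ℝ) + 1)) :=
      integral_nonneg fun z => Real.rpow_nonneg (jap_pos z).le _
    positivity
  have hpt : ∀ z, ‖a z‖ * ‖b (z - y)‖
      ≤ Ca * Cb * 2 ^ M * jap y ^ (-M) * jap z ^ (-((d : ℝ) + 1)) := by
    intro z
    have h1 := jap_rpow_le M y z
    rw [abs_of_nonneg hM, ← jap_neg (y - z), neg_sub] at h1
    have hz : jap z ^ (-M) * jap (z - y) ^ (-M) ≤ 2 ^ M * jap y ^ (-M) := by
      have p1 := Real.rpow_pos_of_pos (jap_pos y) M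
      have p2 := Real.rpow_pos_of_pos (jap_pos z) M
      have p3 := Real.rpow_pos_of_pos (jap_pos (z - y)) M
      rw [Real.rpow_neg (jap_pos _).le, Real.rpow_neg (jap_pos _).le, Real.rpow_neg (jap_pos _).le,
        ← mul_inv, ← div_eq_mul_inv, inv_eq_one_div, div_le_div_iff₀ (by positivity) p1]
      linarith
    calc ‖a z‖ * ‖b (z - y)‖ ≤ (Ca * jap z ^ (-(M + (d + 1)))) * (Cb * jap (z - y) ^ (-M)) := by
          exact mul_le_mul (ha z) (hb _) (norm_nonneg _) ((norm_nonneg _).trans (ha z))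
      _ = Ca * Cb * (jap z ^ (-M) * jap (z - y) ^ (-M)) * jap z ^ (-((d : ℝ) + 1)) := by
          rw [neg_add, Real.rpow_add (jap_pos z)]; ring
      _ ≤ Ca * Cb * (2 ^ M * jap y ^ (-M)) * jap z ^ (-((d : ℝ) + 1)) := by
          have := Real.rpow_nonneg (jap_pos z).le (-((d : ℝ) + 1))
          gcongr
      _ = _ := by ring
  calc ∫ z, ‖a z‖ * ‖b (z - y)‖
      ≤ ∫ z, Ca * Cb * 2 ^ M * jap y ^ (-M) * jap z ^ (-((d : ℝ) + 1)) := by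
        refine integral_mono_of_nonneg (ae_of_all _ fun z => by positivity)
          (hint.const_mul _) (ae_of_all _ hpt)
    _ = _ := by rw [integral_const_mul]; ring

end Weight

/-! ### Time-frequency shifts and the decay of the short-time Fourier transform. -/

section Window

/-- The complex conjugate of a Schwartz function. -/
def conjS (g : 𝓢(Eucl d, ℂ)) : 𝓢(Eucl d, ℂ) :=
  SchwartzMap.postcompCLM (Complex.conjCLE : ℂ →L[ℝ] ℂ) g

@[simp]
theorem conjS_apply (g : 𝓢(Eucl d, ℂ)) (x : Eucl d) : conjS g x = conj (g x) := by
  simp [conjS]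

@[simp]
theorem conjS_conjS (g : 𝓢(Eucl d, ℂ)) : conjS (conjS g) = g := by
  ext x; simp

/-- The character `y ↦ e^{-2πi⟨y,ξ⟩}`. -/
def chr (y ξ : Eucl d) : ℂ := Complex.exp (((-(2 * Real.pi * inner ℝ y ξ) : ℝ) : ℂ) * Complex.I)

@[simp]
theorem norm_chr (y ξ : Eucl d) : ‖chr y ξ‖ = 1 := Complex.norm_exp_ofReal_mul_I _

theorem chr_add_left (y y' ξ : Eucl d) : chr (y + y') ξ = chr y ξ * chr y' ξ := by
  simp only [chr, ← Complex.exp_add, inner_add_left]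
  congr 1; push_cast; ring

theorem chr_add_right (y ξ ξ' : Eucl d) : chr y (ξ + ξ') = chr y ξ * chr y ξ' := by
  simp only [chr, ← Complex.exp_add, inner_add_right]
  congr 1; push_cast; ring

theorem chr_comm (y ξ : Eucl d) : chr y ξ = chr ξ y := by
  simp only [chr, real_inner_comm]

theorem conj_chr (y ξ : Eucl d) : conj (chr y ξ) = chr y (-ξ) := by
  simp only [chr, ← Complex.exp_conj, map_mul, Complex.conj_ofReal, Complex.conj_I, inner_neg_right]
  congr 1; push_cast; ring

theorem fourier_eq_chr (f : Eucl d → ℂ) (ξ : Eucl d) : 𝓕 f ξ = ∫ y, chr y ξ * f y := by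
  rw [Real.fourier_eq']
  refine integral_congr_ae (ae_of_all _ fun y => ?_)
  simp only [chr, smul_eq_mul]
  congr 4; ring

theorem fourierInv_eq_chr (f : Eucl d → ℂ) (ξ : Eucl d) : 𝓕⁻ f ξ = ∫ y, chr y (-ξ) * f y := by
  rw [Real.fourierInv_eq']
  refine integral_congr_ae (ae_of_all _ fun y => ?_)
  simp only [chr, smul_eq_mul, inner_neg_right]
  congr 4; ring

theorem conjShift_apply' (g : 𝓢(Eucl d, ℂ)) (x ξ y : Eucl d) :
    conjShift g x ξ y = chr y ξ * conj (g (y - x)) := conjShift_apply g x ξ y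

/-- A modulation is a translation conjugated by the Fourier transform. Hence continuity and
polynomial growth of time-frequency shifts follow from the same properties of translations. -/
theorem conjShift_eq_fourier (g : 𝓢(Eucl d, ℂ)) (x ξ : Eucl d) :
    conjShift g x ξ
      = 𝓕 (compSubConstCLM ℂ ξ (𝓕⁻ (compSubConstCLM ℂ x (conjS g)) : 𝓢(Eucl d, ℂ))) := by
  ext y
  rw [conjShift_apply', SchwartzMap.fourier_coe, fourier_eq_chr]
  have h1 : ∫ v, chr v y * compSubConstCLM ℂ ξ
        (𝓕⁻ (compSubConstCLM ℂ x (conjS g)) : 𝓢(Eucl d, ℂ)) v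
      = ∫ v, chr (v + ξ) y * (𝓕⁻ (compSubConstCLM ℂ x (conjS g)) : 𝓢(Eucl d, ℂ)) v := by
    rw [← integral_sub_right_eq_self (fun v => chr (v + ξ) y * _) ξ]
    refine integral_congr_ae (ae_of_all _ fun v => ?_)
    simp
  rw [h1]
  simp_rw [chr_add_left, mul_right_comm _ (chr ξ y)]
  rw [integral_mul_const, ← fourier_eq_chr, ← SchwartzMap.fourier_coe,
    FourierTransform.fourier_fourierInv_eq, chr_comm ξ y, mul_comm]
  simp

theorem continuous_conjShift (g : 𝓢(Eucl d, ℂ)) :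
    Continuous fun z : Eucl d × Eucl d => conjShift g z.1 z.2 := by
  simp_rw [conjShift_eq_fourier]
  have h1 : Continuous fun z : Eucl d × Eucl d => compSubConstCLM ℂ z.1 (conjS g) :=
    continuous_compSubConstCLM_uncurry.comp (continuous_fst.prodMk continuous_const)
  have h2 := (fourierInvCLM ℂ 𝓢(Eucl d, ℂ)).continuous.comp h1
  have h3 := continuous_compSubConstCLM_uncurry.comp (continuous_snd.prodMk h2)
  exact (fourierCLM ℂ 𝓢(Eucl d, ℂ)).continuous.comp h3

theorem polyBounded_conjShift (g : 𝓢(Eucl d, ℂ)) :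
    PolyBounded fun z : Eucl d × Eucl d => conjShift g z.1 z.2 := by
  simp_rw [conjShift_eq_fourier]
  have h1 : PolyBounded fun z : Eucl d × Eucl d => compSubConstCLM ℂ z.1 (conjS g) :=
    (polyBounded_const (conjS g)).compSubConst norm_fst_le
  have h2 := h1.clm_comp (fourierInvCLM ℂ 𝓢(Eucl d, ℂ))
  have h3 := h2.compSubConst (a := fun z => z.2) norm_snd_le
  exact h3.clm_comp (fourierCLM ℂ 𝓢(Eucl d, ℂ))

theorem continuous_stft (g : 𝓢(Eucl d, ℂ)) (f : 𝓢'(Eucl d, ℂ)) :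
    Continuous fun z : Eucl d × Eucl d => stft g f z.1 z.2 :=
  f.continuous.comp (continuous_conjShift g)

theorem stft_coe (g φ : 𝓢(Eucl d, ℂ)) (x ξ : Eucl d) :
    stft g (φ : 𝓢'(Eucl d, ℂ)) x ξ = ∫ y, chr y ξ * (φ y * conj (g (y - x))) := by
  rw [stft, SchwartzMap.coe_apply]
  refine integral_congr_ae (ae_of_all _ fun y => ?_)
  simp only [conjShift_apply', smul_eq_mul]
  ring

/-- The product of two Schwartz functions. -/
def mulS (φ ψ : 𝓢(Eucl d, ℂ)) : 𝓢(Eucl d, ℂ) := SchwartzMap.pairing (ContinuousLinearMap.mul ℂ ℂ) φ ψ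

@[simp]
theorem mulS_apply (φ ψ : 𝓢(Eucl d, ℂ)) (x : Eucl d) : mulS φ ψ x = φ x * ψ x := by
  simp [mulS]

theorem stft_coe_eq_fourier (g φ : 𝓢(Eucl d, ℂ)) (x ξ : Eucl d) :
    stft g (φ : 𝓢'(Eucl d, ℂ)) x ξ
      = (𝓕 (mulS φ (compSubConstCLM ℂ x (conjS g))) : 𝓢(Eucl d, ℂ)) ξ := by
  rw [stft_coe, SchwartzMap.fourier_coe, fourier_eq_chr]
  simp

/-- Decay in `x` is seen in the time integral and decay in `ξ` in the integral after Fourier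
transform. The geometric mean of the two bounds decays in both variables, which is why each is taken
with exponent `2 * M`. -/
theorem exists_norm_stft_le (g φ : 𝓢(Eucl d, ℂ)) {M : ℝ} (hM : 0 ≤ M) :
    ∃ C, 0 ≤ C ∧ ∀ x ξ,
      ‖stft g (φ : 𝓢'(Eucl d, ℂ)) x ξ‖ ≤ C * (jap x ^ (-M) * jap ξ ^ (-M)) := by
  obtain ⟨C₁, hC₁, h₁⟩ := exists_integral_norm_mul_sub_le φ g (M := 2 * M) (by linarith)
  obtain ⟨C₂, hC₂, h₂⟩ := exists_integral_norm_mul_sub_le (𝓕 φ) (𝓕⁻ (conjS g))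
    (M := 2 * M) (by linarith)
  refine ⟨√(C₁ * C₂), Real.sqrt_nonneg _, fun x ξ => ?_⟩
  have hx : ‖stft g (φ : 𝓢'(Eucl d, ℂ)) x ξ‖ ≤ C₁ * jap x ^ (-(2 * M)) := by
    rw [stft_coe]
    refine (norm_integral_le_integral_norm _).trans (le_trans (le_of_eq ?_) (h₁ x))
    simp
  have hξ : ‖stft g (φ : 𝓢'(Eucl d, ℂ)) x ξ‖ ≤ C₂ * jap ξ ^ (-(2 * M)) := by
    rw [stft, SchwartzMap.coe_apply, conjShift_eq_fourier]
    simp only [smul_eq_mul]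
    rw [SchwartzMap.integral_fourier_mul_eq]
    refine (norm_integral_le_integral_norm _).trans (le_trans (le_of_eq ?_) (h₂ ξ))
    refine integral_congr_ae (ae_of_all _ fun y => ?_)
    -- Translation of the window changes its inverse transform only by a unimodular factor, so the
    -- frequency bound is uniform in `x`.
    have h3 : ∀ v, ‖(𝓕⁻ (compSubConstCLM ℂ x (conjS g)) : 𝓢(Eucl d, ℂ)) v‖
        = ‖(𝓕⁻ (conjS g) : 𝓢(Eucl d, ℂ)) v‖ := by
      intro v
      rw [SchwartzMap.fourierInv_coe, SchwartzMap.fourierInv_coe, fourierInv_eq_chr,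
        fourierInv_eq_chr]
      have : ∫ y, chr y (-v) * compSubConstCLM ℂ x (conjS g) y
          = ∫ y, chr (y + x) (-v) * conjS g y := by
        rw [← integral_sub_right_eq_self (fun y => chr (y + x) (-v) * _) x]
        refine integral_congr_ae (ae_of_all _ fun v => ?_)
        simp
      rw [this]
      simp_rw [chr_add_left, mul_right_comm _ (chr x _)]
      rw [integral_mul_const, norm_mul, norm_chr, mul_one]
    simp only [compSubConstCLM_apply, norm_mul, h3]
    rw [mul_comm]
  have hsq : ‖stft g (φ : 𝓢'(Eucl d, ℂ)) x ξ‖ ^ 2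
      ≤ C₁ * C₂ * (jap x ^ (-M) * jap ξ ^ (-M)) ^ 2 := by
    have e : ∀ y : Eucl d, jap y ^ (-(2 * M)) = (jap y ^ (-M)) ^ 2 := fun y => by
      rw [← Real.rpow_natCast, ← Real.rpow_mul (jap_pos y).le]; congr 1; push_cast; ring
    rw [e] at hx hξ
    rw [sq]
    refine (mul_le_mul hx hξ (norm_nonneg _) (by positivity)).trans (le_of_eq (by ring))
  have hnn : 0 ≤ jap x ^ (-M) * jap ξ ^ (-M) :=
    mul_nonneg (Real.rpow_nonneg (jap_pos x).le _) (Real.rpow_nonneg (jap_pos ξ).le _)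
  have := Real.sqrt_le_sqrt hsq
  rwa [Real.sqrt_sq (norm_nonneg _), Real.sqrt_mul (by positivity), Real.sqrt_sq hnn] at this

end Window

end ModulationNLW
end

noncomputable section

namespace ModulationNLW

open SchwartzMap FourierTransform

variable {d : ℕ}

/-! ### Inversion formula, change of window, and products. -/

section Reproducing

/-- The squared `L²` norm of a window. -/
def windowNorm (g : 𝓢(Eucl d, ℂ)) : ℝ := ∫ x, ‖g x‖ ^ 2

theorem windowNorm_pos {g : 𝓢(Eucl d, ℂ)} (hg : g ≠ 0) : 0 < windowNorm g := by
  have hc : Continuous fun x => ‖g x‖ ^ 2 := by fun_prop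
  have hi : Integrable fun x => ‖g x‖ ^ 2 := by
    have h : Integrable fun x => ‖mulS g (conjS g) x‖ :=
      ((mulS g (conjS g)).integrable (μ := volume)).norm
    simpa [sq] using h
  obtain ⟨x, hx⟩ : ∃ x, g x ≠ 0 := by
    by_contra! h
    exact hg (by ext x; simpa using h x)
  exact integral_pos_of_integrable_nonneg_nonzero (x := x) hc hi (fun x => by positivity)
    (by positivity)

theorem enorm_le_of_ofReal_mul_eq {c : ℝ} (hc : 0 < c) {a b : ℂ} (h : (c : ℂ) * a = b) :
    ‖a‖ₑ = ENNReal.ofReal c⁻¹ * ‖b‖ₑ := by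
  rw [← h, enorm_mul, ← ofReal_norm (c : ℂ), Complex.norm_real, Real.norm_of_nonneg hc.le,
    ← mul_assoc, ← ENNReal.ofReal_mul (by positivity), inv_mul_cancel₀ hc.ne', ENNReal.ofReal_one,
    one_mul]

/-- The integrand of the inversion formula of the short-time Fourier transform. -/
def reproducingFamily (g ψ : 𝓢(Eucl d, ℂ)) (z : Eucl d × Eucl d) : 𝓢(Eucl d, ℂ) :=
  stft (conjS g) (ψ : 𝓢'(Eucl d, ℂ)) z.1 (-z.2) • conjShift g z.1 z.2

theorem continuous_stft_neg (g : 𝓢(Eucl d, ℂ)) (f : 𝓢'(Eucl d, ℂ)) :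
    Continuous fun z : Eucl d × Eucl d => stft g f z.1 (-z.2) := by
  have hn : Continuous fun z : Eucl d × Eucl d => (z.1, -z.2) :=
    continuous_fst.prodMk continuous_snd.neg
  have h := (continuous_stft g f).comp hn
  exact h

theorem continuous_reproducingFamily (g ψ : 𝓢(Eucl d, ℂ)) :
    Continuous (reproducingFamily g ψ) := by
  exact (continuous_stft_neg (conjS g) (ψ : 𝓢'(Eucl d, ℂ))).smul (continuous_conjShift g)

/-- The seminorms of the shifted windows grow polynomially with some degree `N`, while the
coefficients decay at any rate. The rate `N + (d + 1)` absorbs the growth and leaves an integrable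
weight. -/
theorem integrable_seminorm_reproducingFamily (g ψ : 𝓢(Eucl d, ℂ))
    (q : Seminorm ℂ 𝓢(Eucl d, ℂ)) (hq : Continuous q) :
    Integrable (fun z => q (reproducingFamily g ψ z)) := by
  obtain ⟨C, N, hC, h1⟩ := polyBounded_conjShift g q hq
  obtain ⟨C', hC', h2⟩ := exists_norm_stft_le (conjS g) ψ (M := N + (d + 1)) (by positivity)
  have hi : Integrable fun z : Eucl d × Eucl d =>
      jap z.1 ^ (-((d : ℝ) + 1)) * jap z.2 ^ (-((d : ℝ) + 1)) :=
    (integrable_jap_rpow (by linarith)).mul_prod (integrable_jap_rpow (by linarith))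
  refine (hi.const_mul (C' * C * 2 ^ N)).mono'
    (hq.comp (continuous_reproducingFamily g ψ)).aestronglyMeasurable (ae_of_all _ fun z => ?_)
  rw [Real.norm_of_nonneg (apply_nonneg _ _), reproducingFamily, map_smul_eq_mul]
  have h3 : (1 + ‖z‖) ^ N ≤ 2 ^ N * (jap z.1 ^ (N : ℝ) * jap z.2 ^ (N : ℝ)) := by
    refine (pow_le_pow_left₀ (by positivity) (one_add_norm_prod_le z) N).trans (le_of_eq ?_)
    rw [mul_pow, mul_pow, Real.rpow_natCast, Real.rpow_natCast]
  have h4 := h2 z.1 (-z.2)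
  rw [jap_neg] at h4
  have e : ∀ x : Eucl d, jap x ^ (-((N : ℝ) + (d + 1))) * jap x ^ (N : ℝ)
      = jap x ^ (-((d : ℝ) + 1)) := fun x => by
    rw [← Real.rpow_add (jap_pos x)]; congr 1; ring
  calc _ ≤ (C' * (jap z.1 ^ (-((N : ℝ) + (d + 1))) * jap z.2 ^ (-((N : ℝ) + (d + 1)))))
        * (C * (2 ^ N * (jap z.1 ^ (N : ℝ) * jap z.2 ^ (N : ℝ)))) := by
        refine mul_le_mul h4 ((h1 z).trans ?_) (apply_nonneg _ _) ((norm_nonneg _).trans h4)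
        gcongr
    _ = C' * C * 2 ^ N * ((jap z.1 ^ (-((N : ℝ) + (d + 1))) * jap z.1 ^ (N : ℝ))
        * (jap z.2 ^ (-((N : ℝ) + (d + 1))) * jap z.2 ^ (N : ℝ))) := by ring
    _ = _ := by rw [e, e]

/-- For fixed `y` the transform is the Fourier transform of `ψ` times the shifted conjugate window,
so this is Fourier inversion in the frequency variable. -/
theorem integral_stft_mul_chr (g ψ : 𝓢(Eucl d, ℂ)) (y w : Eucl d) :
    ∫ η, stft g (ψ : 𝓢'(Eucl d, ℂ)) y (-η) * chr w η = ψ w * conj (g (w - y)) := by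
  rw [← integral_neg_eq_self]
  simp_rw [neg_neg, stft_coe_eq_fourier, mul_comm _ (chr w _)]
  have h : ∀ η, chr w (-η) = chr η (-w) := fun η => by
    rw [← conj_chr, chr_comm, conj_chr]
  simp_rw [h]
  rw [← fourierInv_eq_chr, ← SchwartzMap.fourierInv_coe, FourierTransform.fourierInv_fourier_eq]
  simp

/-- Integrating in frequency first leaves `‖g (w - y)‖² ψ w`, and the integral over `y` is the
squared norm of the window. -/
theorem integral_reproducingFamily (g ψ : 𝓢(Eucl d, ℂ)) (w : Eucl d) :
    ∫ z, reproducingFamily g ψ z w = windowNorm g * ψ w := by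
  have hi : Integrable fun z => reproducingFamily g ψ z w := by
    have hev : Continuous fun φ : 𝓢(Eucl d, ℂ) => φ w :=
      ((TemperedDistribution.delta w).continuous :
        Continuous fun φ : 𝓢(Eucl d, ℂ) => TemperedDistribution.delta w φ)
    refine (integrable_seminorm_reproducingFamily g ψ _
      ((schwartz_withSeminorms ℂ (Eucl d) ℂ).continuous_seminorm (0, 0))).mono'
      (hev.comp (continuous_reproducingFamily g ψ)).aestronglyMeasurable
      (ae_of_all _ fun z => SchwartzMap.norm_le_seminorm ℂ _ _)
  rw [Measure.volume_eq_prod] at hi ⊢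
  rw [integral_prod _ hi]
  have h1 : ∀ y, ∫ η, reproducingFamily g ψ (y, η) w
      = ((‖g (w - y)‖ ^ 2 : ℝ) : ℂ) * ψ w := by
    intro y
    have : ∀ η, reproducingFamily g ψ (y, η) w
        = (stft (conjS g) (ψ : 𝓢'(Eucl d, ℂ)) y (-η) * chr w η) * conj (g (w - y)) := by
      intro η
      simp only [reproducingFamily, _root_.smul_apply, conjShift_apply', smul_eq_mul]
      ring
    simp_rw [this]
    rw [integral_mul_const, integral_stft_mul_chr]
    simp only [conjS_apply, RCLike.conj_conj]
    rw [mul_assoc, Complex.mul_conj, Complex.normSq_eq_norm_sq, mul_comm]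
  simp_rw [h1]
  rw [integral_mul_const, integral_complex_ofReal]
  congr 2
  exact integral_sub_left_eq_self (fun y => ‖g y‖ ^ 2) volume w

/-- The reproducing formula of time-frequency analysis for tempered distributions. -/
theorem reproducing_formula (g : 𝓢(Eucl d, ℂ)) (f : 𝓢'(Eucl d, ℂ)) (ψ : 𝓢(Eucl d, ℂ)) :
    (windowNorm g : ℂ) * f ψ
      = ∫ z : Eucl d × Eucl d,
        stft (conjS g) (ψ : 𝓢'(Eucl d, ℂ)) z.1 (-z.2) * stft g f z.1 z.2 := by
  have h := apply_eq_integral f (ν := volume) (continuous_reproducingFamily g ψ)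
    (integrable_seminorm_reproducingFamily g ψ) (ψ := (windowNorm g : ℂ) • ψ)
    (fun w => by rw [integral_reproducingFamily]; simp)
  rw [map_smul, smul_eq_mul] at h
  rw [h]
  refine integral_congr_ae (ae_of_all _ fun z => ?_)
  simp [reproducingFamily, stft]

theorem measurable_enorm_stft (g : 𝓢(Eucl d, ℂ)) (f : 𝓢'(Eucl d, ℂ)) :
    Measurable fun z : Eucl d × Eucl d => ‖stft g f z.1 z.2‖ₑ :=
  (continuous_stft g f).measurable.enorm

theorem enorm_apply_le {g : 𝓢(Eucl d, ℂ)} (hg : g ≠ 0) (f : 𝓢'(Eucl d, ℂ)) (ψ : 𝓢(Eucl d, ℂ)) :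
    ‖f ψ‖ₑ ≤ ENNReal.ofReal (windowNorm g)⁻¹ * ∫⁻ η, ∫⁻ y,
      ‖stft g f y η‖ₑ * ‖stft (conjS g) (ψ : 𝓢'(Eucl d, ℂ)) y (-η)‖ₑ := by
  rw [enorm_le_of_ofReal_mul_eq (windowNorm_pos hg) (reproducing_formula g f ψ)]
  refine mul_le_mul_right ?_ _
  refine (enorm_integral_le_lintegral_enorm _).trans (le_of_eq ?_)
  have hm : Measurable fun z : Eucl d × Eucl d =>
      ‖stft g f z.1 z.2‖ₑ * ‖stft (conjS g) (ψ : 𝓢'(Eucl d, ℂ)) z.1 (-z.2)‖ₑ :=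
    (measurable_enorm_stft g f).mul (continuous_stft_neg (conjS g) _).measurable.enorm
  rw [Measure.volume_eq_prod]
  simp_rw [enorm_mul, mul_comm ‖stft (conjS g) _ _ _‖ₑ]
  exact lintegral_prod_symm _ hm.aemeasurable

/-- Unlike the bound on pairings, this controls point values with a kernel independent of frequency;
it is the source of the embedding into bounded functions. -/
theorem enorm_schwartz_apply_le {g : 𝓢(Eucl d, ℂ)} (hg : g ≠ 0) (φ : 𝓢(Eucl d, ℂ)) (w : Eucl d) :
    ‖φ w‖ₑ ≤ ENNReal.ofReal (windowNorm g)⁻¹ * ∫⁻ η, ∫⁻ y,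
      ‖stft g (φ : 𝓢'(Eucl d, ℂ)) y η‖ₑ * ‖g (w - y)‖ₑ := by
  have hw : windowNorm (conjS g) = windowNorm g := by simp [windowNorm]
  rw [enorm_le_of_ofReal_mul_eq (windowNorm_pos hg)
    (hw ▸ (integral_reproducingFamily (conjS g) φ w).symm)]
  refine mul_le_mul_right ?_ _
  refine (enorm_integral_le_lintegral_enorm _).trans (le_of_eq ?_)
  have hm : Measurable fun z : Eucl d × Eucl d =>
      ‖stft g (φ : 𝓢'(Eucl d, ℂ)) z.1 (-z.2)‖ₑ * ‖g (w - z.1)‖ₑ :=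
    (continuous_stft_neg g _).measurable.enorm.mul
      ((g.continuous.comp (continuous_const.sub continuous_fst)).measurable.enorm)
  have he : ∀ z : Eucl d × Eucl d, ‖reproducingFamily (conjS g) φ z w‖ₑ
      = ‖stft g (φ : 𝓢'(Eucl d, ℂ)) z.1 (-z.2)‖ₑ * ‖g (w - z.1)‖ₑ := by
    intro z
    rw [reproducingFamily, _root_.smul_apply, conjShift_apply', smul_eq_mul, enorm_mul,
      enorm_mul, conjS_conjS]
    congr 1
    rw [← ofReal_norm, norm_chr]
    simp
  simp_rw [he]
  rw [Measure.volume_eq_prod, lintegral_prod_symm _ hm.aemeasurable]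
  exact lintegral_neg_eq_self (fun η => ∫⁻ y,
      ‖stft g (φ : 𝓢'(Eucl d, ℂ)) y η‖ₑ * ‖g (w - y)‖ₑ)

/-- Covariance: up to phases, two time-frequency shifts combine into the shift by the difference.
The kernel for changing windows is thus of convolution type. -/
theorem norm_stft_conjShift (g γ : 𝓢(Eucl d, ℂ)) (x ξ y η : Eucl d) :
    ‖stft (conjS g) (conjShift γ x ξ : 𝓢'(Eucl d, ℂ)) y (-η)‖
      = ‖stft γ (g : 𝓢'(Eucl d, ℂ)) (x - y) (ξ - η)‖ := by
  rw [stft_coe, stft_coe]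
  have h : ∫ v, chr v (-η) * (conjShift γ x ξ v * conj (conjS g (v - y)))
      = ∫ v, chr (v + y) (ξ - η) * (g v * conj (γ (v - (x - y)))) := by
    rw [← integral_sub_right_eq_self (fun v => chr (v + y) (ξ - η) * _) y]
    refine integral_congr_ae (ae_of_all _ fun v => ?_)
    simp only [conjShift_apply', conjS_apply, RCLike.conj_conj, sub_add_cancel, sub_sub_sub_cancel_right,
      sub_eq_add_neg ξ, chr_add_right]
    ring
  rw [h]
  simp_rw [chr_add_left, mul_right_comm _ (chr y _)]
  rw [integral_mul_const, norm_mul, norm_chr, mul_one]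

/-- The short-time Fourier transform of a product is a convolution in frequency. -/
theorem stft_mulS (g γ φ ψ : 𝓢(Eucl d, ℂ)) (x ξ : Eucl d) :
    stft (mulS g γ) (mulS φ ψ : 𝓢'(Eucl d, ℂ)) x ξ
      = ∫ η, stft g (φ : 𝓢'(Eucl d, ℂ)) x η * stft γ (ψ : 𝓢'(Eucl d, ℂ)) x (ξ - η) := by
  set b := mulS ψ (compSubConstCLM ℂ x (conjS γ)) with hb
  -- The second factor, modulated by `ξ`, has as inverse Fourier transform exactly its transform at
  -- `ξ - η`. The convolution then collapses by moving the Fourier transform from one factor to the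
  -- other.
  set k : 𝓢(Eucl d, ℂ) := SchwartzMap.smulLeftCLM ℂ (fun y => chr y ξ) b with hk
  have hkv : ∀ y, k y = chr y ξ * b y := fun y => by
    rw [hk, SchwartzMap.smulLeftCLM_apply_apply (g := fun y => chr y ξ)
      (hasTemperateGrowth_char ξ)]; rfl
  have h1 : ∀ η, stft γ (ψ : 𝓢'(Eucl d, ℂ)) x (ξ - η) = (𝓕⁻ k : 𝓢(Eucl d, ℂ)) η := by
    intro η
    rw [stft_coe_eq_fourier, ← hb, SchwartzMap.fourier_coe, SchwartzMap.fourierInv_coe,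
      fourier_eq_chr, fourierInv_eq_chr]
    refine integral_congr_ae (ae_of_all _ fun y => ?_)
    simp only [hkv, sub_eq_add_neg, chr_add_right]
    ring
  simp_rw [h1, stft_coe_eq_fourier g φ]
  rw [SchwartzMap.integral_fourier_mul_eq, FourierTransform.fourier_fourierInv_eq, stft_coe]
  refine integral_congr_ae (ae_of_all _ fun y => ?_)
  simp only [hkv, hb, mulS_apply, compSubConstCLM_apply, conjS_apply, map_mul]
  ring

end Reproducing

end ModulationNLW
end

noncomputable section

namespace ModulationNLW

open SchwartzMap FourierTransform

variable {d : ℕ}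

/-! ### Modulation norms: kernel estimate, embeddings, algebra property. -/

section ModNorm

/-- The power `⟨x⟩^{2r}` of the Japanese bracket with values in `[0, ∞]`. -/
def ejap (r : ℝ) (x : Eucl d) : ℝ≥0∞ := ENNReal.ofReal (jap x ^ r)

@[fun_prop]
theorem measurable_ejap (r : ℝ) : Measurable (ejap r : Eucl d → ℝ≥0∞) :=
  (continuous_jap_rpow r).measurable.ennreal_ofReal

theorem ejap_neg (r : ℝ) (x : Eucl d) : ejap r (-x) = ejap r x := by simp [ejap]

theorem ejap_add (r r' : ℝ) (x : Eucl d) : ejap (r + r') x = ejap r x * ejap r' x := by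
  rw [ejap, ejap, ejap, ← ENNReal.ofReal_mul (Real.rpow_nonneg (jap_pos x).le _),
    Real.rpow_add (jap_pos x)]

theorem ejap_mono {r r' : ℝ} (h : r ≤ r') (x : Eucl d) : ejap r x ≤ ejap r' x :=
  ENNReal.ofReal_le_ofReal (jap_rpow_mono h x)

theorem ejap_le_one {r : ℝ} (hr : r ≤ 0) (x : Eucl d) : ejap r x ≤ 1 := by
  rw [ejap, ← ENNReal.ofReal_one]
  refine ENNReal.ofReal_le_ofReal ?_
  simpa using jap_rpow_neg_le_one (neg_nonneg.mpr hr) x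

theorem one_le_ejap {r : ℝ} (hr : 0 ≤ r) (x : Eucl d) : 1 ≤ ejap r x := by
  rw [ejap, ← ENNReal.ofReal_one]
  exact ENNReal.ofReal_le_ofReal (Real.one_le_rpow (one_le_jap x) hr)

theorem ejap_le (r : ℝ) (a b : Eucl d) :
    ejap r a ≤ ENNReal.ofReal (2 ^ |r|) * (ejap r b * ejap |r| (a - b)) := by
  rw [ejap, ejap, ejap, ← ENNReal.ofReal_mul (Real.rpow_nonneg (jap_pos b).le _),
    ← ENNReal.ofReal_mul (by positivity)]
  exact ENNReal.ofReal_le_ofReal (jap_rpow_le r a b)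

variable (d) in
/-- The integral of the integrable weight `⟨x⟩^{-2(d+1)}`. -/
def japInt : ℝ≥0∞ := ∫⁻ x : Eucl d, ejap (-((d : ℝ) + 1)) x

theorem japInt_lt_top : japInt d < ∞ :=
  (integrable_jap_rpow (d := d) (r := (d : ℝ) + 1) (by linarith)).lintegral_lt_top

/-- The inner norm `‖V_g f(·, ξ)‖_{L^p}` of the modulation norm. -/
def freqNorm (g : 𝓢(Eucl d, ℂ)) (p : ℝ≥0∞) (f : 𝓢'(Eucl d, ℂ)) (ξ : Eucl d) : ℝ≥0∞ :=
  eLpNorm (fun x => ‖stft g f x ξ‖ₑ) p volume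

theorem measurable_freqNorm (g : 𝓢(Eucl d, ℂ)) (p : ℝ≥0∞) (f : 𝓢'(Eucl d, ℂ)) :
    Measurable (freqNorm g p f) := by
  have h := (measurable_enorm_stft g f).fun_comp measurable_swap
  exact measurable_eLpNorm_section p (f := fun ξ x => ‖stft g f x ξ‖ₑ) h

theorem measurable_enorm_stft_comp {α : Type*} [MeasurableSpace α] (g : 𝓢(Eucl d, ℂ))
    (f : 𝓢'(Eucl d, ℂ)) {a b : α → Eucl d} (ha : Measurable a) (hb : Measurable b) :
    Measurable fun z => ‖stft g f (a z) (b z)‖ₑ := by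
  have h := (measurable_enorm_stft g f).comp (ha.prodMk hb)
  exact h

theorem measurable_enorm_stft_left (g : 𝓢(Eucl d, ℂ)) (f : 𝓢'(Eucl d, ℂ)) (ξ : Eucl d) :
    Measurable fun x => ‖stft g f x ξ‖ₑ :=
  measurable_enorm_stft_comp g f measurable_id measurable_const

theorem modNorm_eq_lintegral (g : 𝓢(Eucl d, ℂ)) (p : ℝ≥0∞) (s : ℝ) (f : 𝓢'(Eucl d, ℂ)) :
    modNorm g p 1 s f = ∫⁻ ξ, freqNorm g p f ξ * ejap (s / 2) ξ := by
  rw [modNorm, eLpNorm_one_eq_lintegral_enorm]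
  refine lintegral_congr fun ξ => ?_
  rw [enorm_eq_self, freqNorm, eLpNorm_enorm]
  rfl

theorem modNorm_add_le (g : 𝓢(Eucl d, ℂ)) {p : ℝ≥0∞} (hp : 1 ≤ p) (s : ℝ)
    (f h : 𝓢'(Eucl d, ℂ)) : modNorm g p 1 s (f + h) ≤ modNorm g p 1 s f + modNorm g p 1 s h := by
  simp only [modNorm_eq_lintegral]
  rw [← lintegral_add_left ((measurable_freqNorm g p f).fun_mul (measurable_ejap _))]
  refine lintegral_mono fun ξ => ?_
  rw [← add_mul]
  refine mul_le_mul_left ?_ _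
  simp only [freqNorm, eLpNorm_enorm]
  have hc : ∀ f, AEStronglyMeasurable (fun x => stft g f x ξ) volume := fun f =>
    ((continuous_stft g f).comp (continuous_id.prodMk continuous_const)).aestronglyMeasurable
  exact eLpNorm_add_le (hc f) (hc h) hp

theorem modNorm_smul (g : 𝓢(Eucl d, ℂ)) (p : ℝ≥0∞) (s : ℝ) (c : ℂ)
    (f : 𝓢'(Eucl d, ℂ)) : modNorm g p 1 s (c • f) = ‖c‖ₑ * modNorm g p 1 s f := by
  simp only [modNorm_eq_lintegral]
  rw [← lintegral_const_mul _ ((measurable_freqNorm g p f).fun_mul (measurable_ejap _))]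
  refine lintegral_congr fun ξ => ?_
  rw [← mul_assoc]
  congr 1
  rw [freqNorm, freqNorm, ← eLpNorm_const_mul_ennreal p (measurable_enorm_stft_left g f ξ)]
  congr 1
  funext x
  exact enorm_smul c _

theorem modNorm_zero (g : 𝓢(Eucl d, ℂ)) (p : ℝ≥0∞) (s : ℝ) :
    modNorm g p 1 s (0 : 𝓢'(Eucl d, ℂ)) = 0 := by
  have h := modNorm_smul g p s 0 (0 : 𝓢'(Eucl d, ℂ))
  have h0 : (0 : ℂ) • (0 : 𝓢'(Eucl d, ℂ)) = 0 := by
    ext φ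
    exact zero_smul ℂ (0 : ℂ)
  rw [h0] at h
  simpa using h

theorem modNorm_neg (g : 𝓢(Eucl d, ℂ)) (p : ℝ≥0∞) (s : ℝ) (f : 𝓢'(Eucl d, ℂ)) :
    modNorm g p 1 s (-f) = modNorm g p 1 s f := by
  have h := modNorm_smul g p s (-1) f
  have h0 : (-1 : ℂ) • f = -f := neg_one_smul ℂ f
  rw [h0] at h
  simpa using h

theorem modNorm_sub_comm (g : 𝓢(Eucl d, ℂ)) (p : ℝ≥0∞) (s : ℝ) (f h : 𝓢'(Eucl d, ℂ)) :
    modNorm g p 1 s (f - h) = modNorm g p 1 s (h - f) := by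
  rw [← modNorm_neg, neg_sub]

theorem modNorm_mono_weight (g : 𝓢(Eucl d, ℂ)) (p : ℝ≥0∞) {s s' : ℝ} (h : s ≤ s')
    (f : 𝓢'(Eucl d, ℂ)) : modNorm g p 1 s f ≤ modNorm g p 1 s' f := by
  simp only [modNorm_eq_lintegral]
  exact lintegral_mono fun ξ => mul_le_mul_right (ejap_mono (by linarith) ξ) _

/-- Lower semicontinuity of the modulation norm under weak convergence. -/
theorem modNorm_le_liminf (g : 𝓢(Eucl d, ℂ)) (p : ℝ≥0∞) (s : ℝ) {f : ℕ → 𝓢'(Eucl d, ℂ)}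
    {f₀ : 𝓢'(Eucl d, ℂ)} (h : ∀ ψ, Tendsto (fun n => f n ψ) atTop (𝓝 (f₀ ψ))) :
    modNorm g p 1 s f₀ ≤ liminf (fun n => modNorm g p 1 s (f n)) atTop := by
  simp only [modNorm_eq_lintegral]
  refine le_trans (lintegral_mono fun ξ => ?_) (lintegral_liminf_le fun n =>
    (measurable_freqNorm g p (f n)).fun_mul (measurable_ejap _))
  have h1 : freqNorm g p f₀ ξ ≤ liminf (fun n => freqNorm g p (f n) ξ) atTop := by
    simp only [freqNorm, eLpNorm_enorm]
    refine Lp.eLpNorm_lim_le_liminf_eLpNorm (fun n => ?_) _ (ae_of_all _ fun x => h _)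
    exact ((continuous_stft g (f n)).comp
      (continuous_id.prodMk continuous_const)).aestronglyMeasurable
  refine (mul_le_mul_left h1 _).trans ?_
  have hmul : ∀ c : ℝ≥0∞, Monotone fun a : ℝ≥0∞ => a * c := fun c a b hab => mul_le_mul_left hab c
  have hc : ContinuousAt (fun a : ℝ≥0∞ => a * ejap (s / 2) ξ)
      (liminf (fun n => freqNorm g p (f n) ξ) atTop) :=
    (ENNReal.continuous_mul_const ENNReal.ofReal_ne_top).continuousAt
  exact le_of_eq ((hmul _).map_liminf_of_continuousAt _ hc)

theorem modNorm_le_of_tendsto (g : 𝓢(Eucl d, ℂ)) (p : ℝ≥0∞) (s : ℝ) {f : ℕ → 𝓢'(Eucl d, ℂ)}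
    {f₀ : 𝓢'(Eucl d, ℂ)} (h : ∀ ψ, Tendsto (fun n => f n ψ) atTop (𝓝 (f₀ ψ))) {B : ℝ≥0∞}
    (hB : ∀ᶠ n in atTop, modNorm g p 1 s (f n) ≤ B) : modNorm g p 1 s f₀ ≤ B := by
  refine (modNorm_le_liminf g p s h).trans ?_
  exact (liminf_le_liminf hB).trans (le_of_eq (by simp))

/-- An operator whose kernel on the time-frequency side is dominated by
`⟨η⟩^a ⟨x - y⟩^{-2(d+1)} ⟨ξ - η⟩^{-|s|-2(d+1)}` loses at most `a` derivatives. -/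
theorem modNorm_le_of_stft_le {g γ : 𝓢(Eucl d, ℂ)} {p p₂ : ℝ≥0∞} (hp : 1 ≤ p)
    (hp₂ : p₂ = p ∨ p₂ = ∞) (s a : ℝ) {f f' : 𝓢'(Eucl d, ℂ)} {C : ℝ≥0∞}
    (h : ∀ x ξ, ‖stft γ f' x ξ‖ₑ ≤ C * ∫⁻ η, ejap (a / 2) η * ejap (-(|s / 2| + (d + 1))) (ξ - η)
      * ∫⁻ y, ‖stft g f y η‖ₑ * ejap (-((d : ℝ) + 1)) (x - y)) :
    modNorm γ p₂ 1 s f'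
      ≤ C * ((1 + japInt d) * (ENNReal.ofReal (2 ^ |s / 2|) * japInt d))
        * modNorm g p 1 (s + a) f := by
  have hp₂1 : 1 ≤ p₂ := by rcases hp₂ with rfl | rfl <;> simp [hp]
  set w : Eucl d → ℝ≥0∞ := ejap (-((d : ℝ) + 1)) with hw
  have hwm : Measurable w := measurable_ejap _
  have hw1 : ∀ x, w x ≤ 1 := fun x => ejap_le_one (by
    have : (0 : ℝ) ≤ d := by positivity
    linarith) x
  set G : Eucl d → Eucl d → ℝ≥0∞ := fun x η => ∫⁻ y, ‖stft g f y η‖ₑ * w (x - y) with hG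
  have hGm : Measurable (Function.uncurry G) := by
    have hm : Measurable fun z : (Eucl d × Eucl d) × Eucl d =>
        ‖stft g f z.2 z.1.2‖ₑ * w (z.1.1 - z.2) :=
      (measurable_enorm_stft_comp g f measurable_snd
        (measurable_snd.fun_comp measurable_fst)).fun_mul
        (hwm.comp ((measurable_fst.fun_comp measurable_fst).sub measurable_snd))
    exact hm.lintegral_prod_right'
  -- Young's inequality when `p₂ = p`, Hölder's when `p₂ = ∞`; the constant `1 + japInt d` serves
  -- both cases.
  have hGn : ∀ η, eLpNorm (fun x => G x η) p₂ volume ≤ (1 + japInt d) * freqNorm g p f η := by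
    intro η
    rcases hp₂ with rfl | rfl
    · refine (eLpNorm_lintegral_mul_sub_le hp (measurable_enorm_stft_left g f η) hwm).trans ?_
      exact mul_le_mul_left le_add_self _
    · rw [eLpNorm_exponent_top]
      refine essSup_le_of_ae_le _ (ae_of_all _ fun x => ?_)
      exact lintegral_mul_sub_le_eLpNorm hp (measurable_enorm_stft_left g f η) hwm hw1 x
  set K : Eucl d → Eucl d → ℝ≥0∞ := fun ξ η =>
    ejap (a / 2) η * ejap (-(|s / 2| + (d + 1))) (ξ - η) with hK
  have hKm : Measurable (Function.uncurry K) :=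
    ((measurable_ejap _).fun_comp measurable_snd).fun_mul
      ((measurable_ejap _).fun_comp (measurable_fst.sub measurable_snd))
  have hfn : ∀ ξ, freqNorm γ p₂ f' ξ
      ≤ C * ((1 + japInt d) * ∫⁻ η, K ξ η * freqNorm g p f η) := by
    intro ξ
    have hm1 : Measurable (Function.uncurry fun x η => K ξ η * G x η) :=
      (hKm.fun_comp (measurable_const.prodMk measurable_snd)).mul hGm
    calc freqNorm γ p₂ f' ξ
        ≤ eLpNorm (fun x => C * ∫⁻ η, K ξ η * G x η) p₂ volume :=
          eLpNorm_mono_enorm fun x => by rw [enorm_eq_self, enorm_eq_self]; exact h x ξ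
      _ = C * eLpNorm (fun x => ∫⁻ η, K ξ η * G x η) p₂ volume :=
          eLpNorm_const_mul_ennreal _ hm1.lintegral_prod_right' _
      _ ≤ C * ∫⁻ η, eLpNorm (fun x => K ξ η * G x η) p₂ volume :=
          mul_le_mul_right (eLpNorm_lintegral_le hp₂1 hm1) _
      _ ≤ C * ∫⁻ η, (1 + japInt d) * (K ξ η * freqNorm g p f η) := by
          refine mul_le_mul_right (lintegral_mono fun η => ?_) _
          have hGl : Measurable fun x => G x η := hGm.of_uncurry_right
          rw [eLpNorm_const_mul_ennreal _ hGl, mul_left_comm]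
          exact mul_le_mul_right (hGn η) _
      _ = _ := by
          rw [lintegral_const_mul]
          exact (hKm.fun_comp (measurable_const.prodMk measurable_id)).fun_mul (measurable_freqNorm g p f)
  -- Peetre moves the weight from `ξ` to `η` at the cost of `⟨ξ - η⟩^|s|`. The kernel's exponent
  -- contains `|s / 2|` to pay for this and still leaves an integrable power.
  have hKint : ∀ η, ∫⁻ ξ, K ξ η * ejap (s / 2) ξ
      ≤ ENNReal.ofReal (2 ^ |s / 2|) * japInt d * ejap ((s + a) / 2) η := by
    intro η
    calc ∫⁻ ξ, K ξ η * ejap (s / 2) ξ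
        ≤ ∫⁻ ξ, (ejap ((s + a) / 2) η * ENNReal.ofReal (2 ^ |s / 2|)) * w (ξ - η) := by
          refine lintegral_mono fun ξ => ?_
          calc K ξ η * ejap (s / 2) ξ
              ≤ K ξ η * (ENNReal.ofReal (2 ^ |s / 2|)
                * (ejap (s / 2) η * ejap |s / 2| (ξ - η))) :=
                mul_le_mul_right (ejap_le _ _ _) _
            _ = (ejap (s / 2) η * ejap (a / 2) η) * ENNReal.ofReal (2 ^ |s / 2|)
                * (ejap |s / 2| (ξ - η) * ejap (-(|s / 2| + (d + 1))) (ξ - η)) := by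
                simp only [hK]; ring
            _ = _ := by
                rw [← ejap_add, ← ejap_add, hw]
                congr 3 <;> ring_nf
      _ = _ := by
          have hwη : Measurable fun ξ => w (ξ - η) := hwm.comp (measurable_id.sub_const η)
          rw [lintegral_const_mul _ hwη, lintegral_sub_right_eq_self]
          simp only [japInt]
          ring
  have hm2 : Measurable fun z : Eucl d × Eucl d =>
      K z.1 z.2 * freqNorm g p f z.2 * ejap (s / 2) z.1 :=
    (hKm.fun_mul ((measurable_freqNorm g p f).fun_comp measurable_snd)).fun_mul
      ((measurable_ejap _).fun_comp measurable_fst)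
  have hm3 : ∀ ξ, Measurable fun η => K ξ η * freqNorm g p f η := fun ξ =>
    (hKm.fun_comp (measurable_const.prodMk measurable_id)).fun_mul (measurable_freqNorm g p f)
  rw [modNorm_eq_lintegral, modNorm_eq_lintegral]
  calc ∫⁻ ξ, freqNorm γ p₂ f' ξ * ejap (s / 2) ξ
      ≤ ∫⁻ ξ, (C * (1 + japInt d)) *
          ∫⁻ η, K ξ η * freqNorm g p f η * ejap (s / 2) ξ := by
        refine lintegral_mono fun ξ => ?_
        rw [lintegral_mul_const _ (hm3 ξ), ← mul_assoc, mul_assoc C]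
        exact mul_le_mul_left (hfn ξ) _
    _ = C * (1 + japInt d) *
          ∫⁻ ξ, ∫⁻ η, K ξ η * freqNorm g p f η * ejap (s / 2) ξ :=
        lintegral_const_mul _ hm2.lintegral_prod_right'
    _ = C * (1 + japInt d) *
          ∫⁻ η, ∫⁻ ξ, K ξ η * freqNorm g p f η * ejap (s / 2) ξ := by
        rw [lintegral_lintegral_swap hm2.aemeasurable]
    _ ≤ C * (1 + japInt d) * ∫⁻ η, (ENNReal.ofReal (2 ^ |s / 2|) * japInt d)
          * (freqNorm g p f η * ejap ((s + a) / 2) η) := by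
        refine mul_le_mul_right (lintegral_mono fun η => ?_) _
        calc ∫⁻ ξ, K ξ η * freqNorm g p f η * ejap (s / 2) ξ
            = ∫⁻ ξ, freqNorm g p f η * (K ξ η * ejap (s / 2) ξ) :=
              lintegral_congr fun ξ => by ring
          _ = freqNorm g p f η * ∫⁻ ξ, K ξ η * ejap (s / 2) ξ :=
              lintegral_const_mul _ ((hKm.fun_comp (measurable_id.prodMk measurable_const)).fun_mul
                (measurable_ejap _))
          _ ≤ freqNorm g p f η
              * (ENNReal.ofReal (2 ^ |s / 2|) * japInt d * ejap ((s + a) / 2) η) :=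
              mul_le_mul_right (hKint η) _
          _ = _ := by ring
    _ = _ := by
        rw [lintegral_const_mul _ ((measurable_freqNorm g p f).fun_mul (measurable_ejap _))]
        ring

theorem kernelConst_lt_top (s : ℝ) :
    (1 + japInt d) * (ENNReal.ofReal (2 ^ |s / 2|) * japInt d) < ∞ :=
  ENNReal.mul_lt_top (ENNReal.add_lt_top.mpr ⟨ENNReal.one_lt_top, japInt_lt_top⟩)
    (ENNReal.mul_lt_top ENNReal.ofReal_lt_top japInt_lt_top)

/-- Modulation norms with respect to different windows are equivalent, and the modulation norm is
essentially decreasing in `p`. -/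
theorem exists_modNorm_window_le {g : 𝓢(Eucl d, ℂ)} (hg : g ≠ 0) (γ : 𝓢(Eucl d, ℂ)) {p p₂ : ℝ≥0∞}
    (hp : 1 ≤ p) (hp₂ : p₂ = p ∨ p₂ = ∞) (s : ℝ) :
    ∃ C : ℝ≥0∞, C < ∞ ∧ ∀ f : 𝓢'(Eucl d, ℂ),
      modNorm γ p₂ 1 s f ≤ C * modNorm g p 1 s f := by
  have hd : (0 : ℝ) ≤ d := by positivity
  obtain ⟨C, hC, h⟩ := exists_norm_stft_le γ g (M := |s / 2| + (d + 1)) (by positivity)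
  refine ⟨ENNReal.ofReal (windowNorm g)⁻¹ * ENNReal.ofReal C
    * ((1 + japInt d) * (ENNReal.ofReal (2 ^ |s / 2|) * japInt d)), ?_, fun f => ?_⟩
  · exact ENNReal.mul_lt_top (ENNReal.mul_lt_top ENNReal.ofReal_lt_top ENNReal.ofReal_lt_top)
      (kernelConst_lt_top s)
  -- The identity operator, viewed with input window `g` and output window `γ`; by covariance its
  -- kernel is the transform of one window with respect to the other.
  have key := modNorm_le_of_stft_le (g := g) (γ := γ) hp hp₂ s 0 (f := f) (f' := f)
    (C := ENNReal.ofReal (windowNorm g)⁻¹ * ENNReal.ofReal C) ?_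
  · rwa [add_zero] at key
  intro x ξ
  refine (enorm_apply_le hg f (conjShift γ x ξ)).trans ?_
  rw [mul_assoc]
  refine mul_le_mul_right ?_ _
  rw [← lintegral_const_mul' _ _ ENNReal.ofReal_ne_top]
  refine lintegral_mono fun η => ?_
  rw [← mul_assoc, ← lintegral_const_mul]
  swap
  · exact (measurable_enorm_stft_left g f η).fun_mul
      ((measurable_ejap _).fun_comp (measurable_const.sub measurable_id))
  refine lintegral_mono fun y => ?_
  have h1 : ‖stft (conjS g) (conjShift γ x ξ : 𝓢'(Eucl d, ℂ)) y (-η)‖ₑ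
      ≤ ENNReal.ofReal C * (ejap (-((d : ℝ) + 1)) (x - y)
        * ejap (-(|s / 2| + (d + 1))) (ξ - η)) := by
    rw [← ofReal_norm, norm_stft_conjShift, ejap, ejap,
      ← ENNReal.ofReal_mul (Real.rpow_nonneg (jap_pos _).le _), ← ENNReal.ofReal_mul hC]
    refine ENNReal.ofReal_le_ofReal ((h _ _).trans ?_)
    refine mul_le_mul_of_nonneg_left (mul_le_mul_of_nonneg_right (jap_rpow_mono ?_ _)
      (Real.rpow_nonneg (jap_pos (ξ - η)).le _)) hC
    have := abs_nonneg (s / 2)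
    linarith
  calc _ ≤ ‖stft g f y η‖ₑ * (ENNReal.ofReal C * (ejap (-((d : ℝ) + 1)) (x - y)
        * ejap (-(|s / 2| + (d + 1))) (ξ - η))) := mul_le_mul_right h1 _
    _ = _ := by
        have : ejap (0 / 2) η = 1 := by simp [ejap]
        rw [this]
        ring

/-- The modulation norm controls every pairing with a Schwartz function. -/
theorem exists_enorm_apply_le_modNorm {g : 𝓢(Eucl d, ℂ)} (hg : g ≠ 0) {p : ℝ≥0∞} (hp : 1 ≤ p)
    (s : ℝ) (ψ : 𝓢(Eucl d, ℂ)) :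
    ∃ C : ℝ≥0∞, C < ∞ ∧ ∀ f : 𝓢'(Eucl d, ℂ), ‖f ψ‖ₑ ≤ C * modNorm g p 1 s f := by
  have hd : (0 : ℝ) ≤ d := by positivity
  obtain ⟨C, hC, h⟩ := exists_norm_stft_le (conjS g) ψ (M := |s / 2| + (d + 1)) (by positivity)
  refine ⟨ENNReal.ofReal (windowNorm g)⁻¹ * (ENNReal.ofReal C * (1 + japInt d)), ?_, fun f => ?_⟩
  · exact ENNReal.mul_lt_top ENNReal.ofReal_lt_top (ENNReal.mul_lt_top ENNReal.ofReal_lt_top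
      (ENNReal.add_lt_top.mpr ⟨ENNReal.one_lt_top, japInt_lt_top⟩))
  refine (enorm_apply_le hg f ψ).trans ?_
  rw [mul_assoc]
  refine mul_le_mul_right ?_ _
  rw [modNorm_eq_lintegral, ← lintegral_const_mul _
    ((measurable_freqNorm g p f).fun_mul (measurable_ejap _))]
  refine lintegral_mono fun η => ?_
  have h1 : ∀ y, ‖stft (conjS g) (ψ : 𝓢'(Eucl d, ℂ)) y (-η)‖ₑ
      ≤ (ENNReal.ofReal C * ejap (s / 2) η) * ejap (-((d : ℝ) + 1)) y := by
    intro y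
    rw [← ofReal_norm, ejap, ejap, ← ENNReal.ofReal_mul hC, ← ENNReal.ofReal_mul
      (mul_nonneg hC (Real.rpow_nonneg (jap_pos _).le _))]
    refine ENNReal.ofReal_le_ofReal ((h _ _).trans ?_)
    rw [jap_neg, mul_comm (jap y ^ _), ← mul_assoc]
    have h0 := Real.rpow_nonneg (jap_pos η).le (s / 2)
    have h0' := Real.rpow_nonneg (jap_pos y).le (-(|s / 2| + (d + 1)))
    refine mul_le_mul (mul_le_mul_of_nonneg_left ?_ hC) ?_ h0' (mul_nonneg hC h0)
    · refine jap_rpow_mono ?_ _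
      have := neg_abs_le (s / 2)
      linarith
    · refine jap_rpow_mono ?_ _
      have := abs_nonneg (s / 2)
      linarith
  calc ∫⁻ y, ‖stft g f y η‖ₑ * ‖stft (conjS g) (ψ : 𝓢'(Eucl d, ℂ)) y (-η)‖ₑ
      ≤ ∫⁻ y, (ENNReal.ofReal C * ejap (s / 2) η)
          * (‖stft g f y η‖ₑ * ejap (-((d : ℝ) + 1)) y) := by
        refine lintegral_mono fun y => ?_
        rw [mul_left_comm]
        exact mul_le_mul_right (h1 y) _
    _ = (ENNReal.ofReal C * ejap (s / 2) η)
          * ∫⁻ y, ‖stft g f y η‖ₑ * ejap (-((d : ℝ) + 1)) y :=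
        lintegral_const_mul _ ((measurable_enorm_stft_left g f η).fun_mul (measurable_ejap _))
    _ ≤ (ENNReal.ofReal C * ejap (s / 2) η) * ((1 + japInt d) * freqNorm g p f η) := by
        refine mul_le_mul_right ?_ _
        exact lintegral_mul_le_eLpNorm hp (measurable_enorm_stft_left g f η) (measurable_ejap _)
          (ejap_le_one (by linarith))
    _ = _ := by ring

/-- The embedding into bounded functions. With `q = 1` the frequency integral in the inversion
formula converges absolutely, and for `s ≥ 0` the missing weight is at least `1`. -/
theorem exists_enorm_schwartz_apply_le_modNorm {g : 𝓢(Eucl d, ℂ)} (hg : g ≠ 0) {p : ℝ≥0∞}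
    (hp : 1 ≤ p) {s : ℝ} (hs : 0 ≤ s) :
    ∃ C : ℝ≥0∞, C < ∞ ∧ ∀ (φ : 𝓢(Eucl d, ℂ)) (w : Eucl d),
      ‖φ w‖ₑ ≤ C * modNorm g p 1 s (φ : 𝓢'(Eucl d, ℂ)) := by
  have hd : (0 : ℝ) ≤ d := by positivity
  obtain ⟨C, hC, h⟩ := schwartz_decay g (d + 1)
  refine ⟨ENNReal.ofReal (windowNorm g)⁻¹ * (ENNReal.ofReal C * (1 + japInt d)), ?_,
    fun φ w => ?_⟩
  · exact ENNReal.mul_lt_top ENNReal.ofReal_lt_top (ENNReal.mul_lt_top ENNReal.ofReal_lt_top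
      (ENNReal.add_lt_top.mpr ⟨ENNReal.one_lt_top, japInt_lt_top⟩))
  refine (enorm_schwartz_apply_le hg φ w).trans ?_
  rw [mul_assoc]
  refine mul_le_mul_right ?_ _
  rw [modNorm_eq_lintegral, ← lintegral_const_mul _
    ((measurable_freqNorm g p _).fun_mul (measurable_ejap _))]
  refine lintegral_mono fun η => ?_
  calc ∫⁻ y, ‖stft g (φ : 𝓢'(Eucl d, ℂ)) y η‖ₑ * ‖g (w - y)‖ₑ
      ≤ ∫⁻ y, ENNReal.ofReal C
          * (‖stft g (φ : 𝓢'(Eucl d, ℂ)) y η‖ₑ * ejap (-((d : ℝ) + 1)) (w - y)) := by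
        refine lintegral_mono fun y => ?_
        rw [mul_left_comm]
        refine mul_le_mul_right ?_ _
        rw [← ofReal_norm, ejap, ← ENNReal.ofReal_mul hC]
        exact ENNReal.ofReal_le_ofReal (h _)
    _ = ENNReal.ofReal C
          * ∫⁻ y, ‖stft g (φ : 𝓢'(Eucl d, ℂ)) y η‖ₑ * ejap (-((d : ℝ) + 1)) (w - y) :=
        lintegral_const_mul _ ((measurable_enorm_stft_left g _ η).fun_mul
          ((measurable_ejap _).fun_comp (measurable_const.sub measurable_id)))
    _ ≤ ENNReal.ofReal C * ((1 + japInt d) * freqNorm g p (φ : 𝓢'(Eucl d, ℂ)) η) := by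
        refine mul_le_mul_right ?_ _
        exact lintegral_mul_sub_le_eLpNorm hp (measurable_enorm_stft_left g _ η)
          (measurable_ejap _) (ejap_le_one (by linarith)) w
    _ ≤ ENNReal.ofReal C * ((1 + japInt d) * freqNorm g p (φ : 𝓢'(Eucl d, ℂ)) η)
          * ejap (s / 2) η := le_mul_of_one_le_right' (one_le_ejap (by linarith) η)
    _ = _ := by ring

theorem eLpNorm_ejap_lt_top {p : ℝ≥0∞} (hp : 1 ≤ p) :
    eLpNorm (ejap (-((d : ℝ) + 1)) : Eucl d → ℝ≥0∞) p volume < ∞ := by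
  have hd : (0 : ℝ) ≤ d := by positivity
  have h1 : ∀ x : Eucl d, ejap (-((d : ℝ) + 1)) x ≤ 1 := ejap_le_one (by linarith)
  by_cases ht : p = ∞
  · subst ht
    rw [eLpNorm_exponent_top]
    exact (essSup_le_of_ae_le 1 (ae_of_all _ h1)).trans_lt ENNReal.one_lt_top
  have h0 : p ≠ 0 := (zero_lt_one.trans_le hp).ne'
  have hr1 : 1 ≤ p.toReal := by
    simpa using (ENNReal.toReal_le_toReal ENNReal.one_ne_top ht).mpr hp
  rw [eLpNorm_ennreal_eq h0 ht]
  refine ENNReal.rpow_lt_top_of_nonneg (by positivity) (ne_of_lt ?_)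
  refine lt_of_le_of_lt (lintegral_mono fun x => ?_) (japInt_lt_top (d := d))
  nth_rw 2 [← ENNReal.rpow_one (ejap _ x)]
  exact ENNReal.rpow_le_rpow_of_exponent_ge (h1 x) hr1

theorem modNorm_schwartz_lt_top (g : 𝓢(Eucl d, ℂ)) {p : ℝ≥0∞} (hp : 1 ≤ p) (s : ℝ)
    (φ : 𝓢(Eucl d, ℂ)) : modNorm g p 1 s (φ : 𝓢'(Eucl d, ℂ)) < ∞ := by
  have hd : (0 : ℝ) ≤ d := by positivity
  obtain ⟨C, hC, h⟩ := exists_norm_stft_le g φ (M := |s / 2| + (d + 1)) (by positivity)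
  set A := eLpNorm (ejap (-((d : ℝ) + 1)) : Eucl d → ℝ≥0∞) p volume with hA
  have hfn : ∀ ξ, freqNorm g p (φ : 𝓢'(Eucl d, ℂ)) ξ
      ≤ ENNReal.ofReal C * ejap (-(|s / 2| + (d + 1))) ξ * A := by
    intro ξ
    rw [hA, ← eLpNorm_const_mul_ennreal p (measurable_ejap _)]
    refine eLpNorm_mono_enorm fun x => ?_
    rw [enorm_eq_self, enorm_eq_self, ← ofReal_norm, ejap, ejap, ← ENNReal.ofReal_mul hC,
      ← ENNReal.ofReal_mul (mul_nonneg hC (Real.rpow_nonneg (jap_pos _).le _))]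
    refine ENNReal.ofReal_le_ofReal ((h _ _).trans ?_)
    rw [mul_comm (jap x ^ _), ← mul_assoc]
    have h0 := Real.rpow_nonneg (jap_pos ξ).le (-(|s / 2| + ((d : ℝ) + 1)))
    refine mul_le_mul_of_nonneg_left (jap_rpow_mono ?_ _) (mul_nonneg hC h0)
    have := abs_nonneg (s / 2)
    linarith
  rw [modNorm_eq_lintegral]
  calc ∫⁻ ξ, freqNorm g p (φ : 𝓢'(Eucl d, ℂ)) ξ * ejap (s / 2) ξ
      ≤ ∫⁻ ξ, (ENNReal.ofReal C * A) * ejap (-((d : ℝ) + 1)) ξ := by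
        refine lintegral_mono fun ξ => ?_
        refine (mul_le_mul_left (hfn ξ) _).trans ?_
        rw [mul_right_comm _ _ A, mul_assoc, ← ejap_add]
        refine mul_le_mul_right (ejap_mono ?_ ξ) _
        have := le_abs_self (s / 2)
        linarith
    _ = (ENNReal.ofReal C * A) * japInt d := lintegral_const_mul _ (measurable_ejap _)
    _ < ∞ := ENNReal.mul_lt_top (ENNReal.mul_lt_top ENNReal.ofReal_lt_top
        (eLpNorm_ejap_lt_top hp)) japInt_lt_top

/-- The transform of the product is a frequency convolution. Hölder `L^p · L^∞` in `x` and Fubini in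
`ξ` give a product of integrals; for `s ≥ 0` the weight is submultiplicative up to a constant. The
window of the product is `g²`. -/
theorem modNorm_mulS_le (g : 𝓢(Eucl d, ℂ)) {p : ℝ≥0∞} (hp : 1 ≤ p) {s : ℝ} (hs : 0 ≤ s)
    (φ ψ : 𝓢(Eucl d, ℂ)) :
    modNorm (mulS g g) p 1 s (mulS φ ψ : 𝓢'(Eucl d, ℂ))
      ≤ ENNReal.ofReal (2 ^ |s / 2|) * (modNorm g p 1 s (φ : 𝓢'(Eucl d, ℂ))
        * modNorm g ∞ 1 s (ψ : 𝓢'(Eucl d, ℂ))) := by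
  set a := freqNorm g p (φ : 𝓢'(Eucl d, ℂ)) with ha
  set b := freqNorm g ∞ (ψ : 𝓢'(Eucl d, ℂ)) with hb
  have ham : Measurable a := measurable_freqNorm _ _ _
  have hbm : Measurable b := measurable_freqNorm _ _ _
  have h1 : ∀ ξ, freqNorm (mulS g g) p (mulS φ ψ : 𝓢'(Eucl d, ℂ)) ξ
      ≤ ∫⁻ η, a η * b (ξ - η) := by
    intro ξ
    have hm : Measurable (Function.uncurry fun x η => ‖stft g (φ : 𝓢'(Eucl d, ℂ)) x η‖ₑ
        * ‖stft g (ψ : 𝓢'(Eucl d, ℂ)) x (ξ - η)‖ₑ) :=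
      (measurable_enorm_stft_comp g _ measurable_fst measurable_snd).fun_mul
        (measurable_enorm_stft_comp g _ measurable_fst (measurable_const.sub measurable_snd))
    calc freqNorm (mulS g g) p (mulS φ ψ : 𝓢'(Eucl d, ℂ)) ξ
        ≤ eLpNorm (fun x => ∫⁻ η, ‖stft g (φ : 𝓢'(Eucl d, ℂ)) x η‖ₑ
          * ‖stft g (ψ : 𝓢'(Eucl d, ℂ)) x (ξ - η)‖ₑ) p volume := by
          refine eLpNorm_mono_enorm fun x => ?_
          rw [enorm_eq_self, enorm_eq_self, stft_mulS]
          refine (enorm_integral_le_lintegral_enorm _).trans (le_of_eq ?_)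
          simp_rw [enorm_mul]
      _ ≤ ∫⁻ η, eLpNorm (fun x => ‖stft g (φ : 𝓢'(Eucl d, ℂ)) x η‖ₑ
          * ‖stft g (ψ : 𝓢'(Eucl d, ℂ)) x (ξ - η)‖ₑ) p volume := eLpNorm_lintegral_le hp hm
      _ ≤ _ := lintegral_mono fun η =>
          eLpNorm_mul_le_mul_top p (measurable_enorm_stft_left g _ η) _
  have hs2 : |s / 2| = s / 2 := abs_of_nonneg (by linarith)
  simp only [modNorm_eq_lintegral]
  have hm : Measurable fun z : Eucl d × Eucl d =>
      (a z.2 * ejap (s / 2) z.2) * (b (z.1 - z.2) * ejap (s / 2) (z.1 - z.2)) :=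
    ((ham.fun_mul (measurable_ejap _)).fun_comp measurable_snd).fun_mul
      ((hbm.fun_mul (measurable_ejap _)).fun_comp (measurable_fst.sub measurable_snd))
  calc ∫⁻ ξ, freqNorm (mulS g g) p (mulS φ ψ : 𝓢'(Eucl d, ℂ)) ξ * ejap (s / 2) ξ
      ≤ ∫⁻ ξ, ENNReal.ofReal (2 ^ |s / 2|) * ∫⁻ η, (a η * ejap (s / 2) η)
          * (b (ξ - η) * ejap (s / 2) (ξ - η)) := by
        refine lintegral_mono fun ξ => ?_
        refine (mul_le_mul_left (h1 ξ) _).trans ?_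
        have hr : ejap (s / 2) ξ ≠ ∞ := ENNReal.ofReal_ne_top
        rw [← lintegral_mul_const' _ _ hr, ← lintegral_const_mul' _ _ ENNReal.ofReal_ne_top]
        refine lintegral_mono fun η => ?_
        refine (mul_le_mul_right (ejap_le (s / 2) ξ η) _).trans (le_of_eq ?_)
        rw [hs2]
        ring
    _ = ENNReal.ofReal (2 ^ |s / 2|) * ∫⁻ ξ, ∫⁻ η, (a η * ejap (s / 2) η)
          * (b (ξ - η) * ejap (s / 2) (ξ - η)) :=
        lintegral_const_mul _ hm.lintegral_prod_right'
    _ = ENNReal.ofReal (2 ^ |s / 2|) * ∫⁻ η, ∫⁻ ξ, (a η * ejap (s / 2) η)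
          * (b (ξ - η) * ejap (s / 2) (ξ - η)) := by
        rw [lintegral_lintegral_swap hm.aemeasurable]
    _ = ENNReal.ofReal (2 ^ |s / 2|) * ∫⁻ η, (a η * ejap (s / 2) η)
          * ∫⁻ ξ, b ξ * ejap (s / 2) ξ := by
        congr 1
        refine lintegral_congr fun η => ?_
        have hbη : Measurable fun ξ => b (ξ - η) * ejap (s / 2) (ξ - η) :=
          (hbm.fun_mul (measurable_ejap _)).comp (measurable_id.sub_const η)
        rw [lintegral_const_mul _ hbη, lintegral_sub_right_eq_self (fun ξ => b ξ * ejap (s / 2) ξ)]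
    _ = _ := by rw [lintegral_mul_const _ (ham.fun_mul (measurable_ejap _))]

/-- The modulation spaces `M^{p,1}_s`, `s ≥ 0`, are algebras. -/
theorem exists_modNorm_mulS_le {g : 𝓢(Eucl d, ℂ)} (hg : g ≠ 0) {p : ℝ≥0∞} (hp : 1 ≤ p) {s : ℝ}
    (hs : 0 ≤ s) : ∃ C : ℝ≥0∞, C < ∞ ∧ ∀ φ ψ : 𝓢(Eucl d, ℂ),
      modNorm g p 1 s (mulS φ ψ : 𝓢'(Eucl d, ℂ))
        ≤ C * (modNorm g p 1 s (φ : 𝓢'(Eucl d, ℂ)) * modNorm g p 1 s (ψ : 𝓢'(Eucl d, ℂ))) := by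
  -- The product estimate produces the window `g²`, which must be nonzero in order to change back to
  -- `g`.
  have hgg : mulS g g ≠ 0 := by
    intro h
    refine hg ?_
    ext x
    have := DFunLike.congr_fun h x
    simpa using this
  obtain ⟨C₁, hC₁, h₁⟩ := exists_modNorm_window_le hgg g hp (Or.inl rfl) s
  -- Same window here: only the exponent of the second factor is changed, from `p` to `∞`.
  obtain ⟨C₂, hC₂, h₂⟩ := exists_modNorm_window_le hg g hp (Or.inr rfl) s
  refine ⟨C₁ * ENNReal.ofReal (2 ^ |s / 2|) * C₂, ENNReal.mul_lt_top
    (ENNReal.mul_lt_top hC₁ ENNReal.ofReal_lt_top) hC₂, fun φ ψ => ?_⟩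
  calc _ ≤ C₁ * modNorm (mulS g g) p 1 s (mulS φ ψ : 𝓢'(Eucl d, ℂ)) := h₁ _
    _ ≤ C₁ * (ENNReal.ofReal (2 ^ |s / 2|) * (modNorm g p 1 s (φ : 𝓢'(Eucl d, ℂ))
        * (C₂ * modNorm g p 1 s (ψ : 𝓢'(Eucl d, ℂ))))) :=
        mul_le_mul_right ((modNorm_mulS_le g hp hs φ ψ).trans
          (mul_le_mul_right (mul_le_mul_right (h₂ _) _) _)) _
    _ = _ := by ring

end ModNorm

end ModulationNLW
end

noncomputable section

namespace ModulationNLW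

open SchwartzMap FourierTransform

variable {d : ℕ}

/-! ### Symbols that are entire functions of `|ξ|²`. -/

section Symbols

/-- An even entire function is an entire function of the square of the variable. -/
theorem exists_entire_comp_sq {f : ℂ → ℂ} (hf : Differentiable ℂ f) (heven : ∀ z, f (-z) = f z) :
    ∃ h : ℂ → ℂ, Differentiable ℂ h ∧ ∀ z, h (z ^ 2) = f z := by
  have heq : ∀ z w : ℂ, z ^ 2 = w ^ 2 → f z = f w := by
    intro z w hzw
    rcases sq_eq_sq_iff_eq_or_eq_neg.mp hzw with rfl | rfl
    · rfl
    · exact heven w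
  have hroot : ∀ w : ℂ, (w ^ ((2 : ℂ)⁻¹)) ^ 2 = w := fun w => by simp
  set h : ℂ → ℂ := fun w => f (w ^ ((2 : ℂ)⁻¹)) with hh
  -- The principal square root is not holomorphic across the negative axis. By evenness the branch
  -- `i √(-w)` defines the same function and is holomorphic there.
  have hh' : h = fun w => f (Complex.I * (-w) ^ ((2 : ℂ)⁻¹)) := by
    funext w
    refine heq _ _ ?_
    rw [hroot, mul_pow, hroot, Complex.I_sq]
    ring
  have hne : ∀ w : ℂ, w ≠ 0 → DifferentiableAt ℂ h w := by
    intro w hw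
    by_cases hs : w ∈ Complex.slitPlane
    · exact (hf _).comp w (differentiableAt_id.cpow_const hs)
    · have hs' : -w ∈ Complex.slitPlane := by
        rw [Complex.mem_slitPlane_iff] at hs ⊢
        push Not at hs
        rcases hs.1.lt_or_eq with h0 | h0
        · left; simpa using h0
        · exact absurd (Complex.ext h0 hs.2) hw
      rw [hh']
      have h1 : DifferentiableAt ℂ (fun w : ℂ => Complex.I * (-w) ^ ((2 : ℂ)⁻¹)) w :=
        (differentiableAt_id.neg.cpow_const hs').const_mul _
      exact (hf _).comp w h1
  -- Away from `0` the function is holomorphic, so continuity at `0` makes the singularity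
  -- removable.
  have hcont : ContinuousAt h 0 := by
    have h1 : ContinuousAt (fun w : ℂ => w ^ ((2 : ℂ)⁻¹)) 0 := by
      refine Complex.continuousAt_cpow_const_of_re_pos (Or.inl le_rfl) ?_
      norm_num
    exact (hf.continuous.continuousAt).comp h1
  refine ⟨h, fun w => ?_, fun z => heq _ _ (hroot _)⟩
  by_cases hw : w = 0
  · have h2 : DifferentiableOn ℂ h univ :=
      (Complex.differentiableOn_compl_singleton_and_continuousAt_iff (c := (0 : ℂ)) univ_mem).mp
        ⟨fun w hw => (hne w hw.2).differentiableWithinAt, hcont⟩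
    exact h2.differentiableAt univ_mem
  · exact hne w hw

/-- If `|Im z| > |Im w|`, comparing real parts forces `|Re z| > |Re w|` too, against the equality
`Re z · Im z = Re w · Im w` of imaginary parts. This keeps complexified lines inside the strip where
the symbol is controlled. -/
theorem abs_im_le_of_sq_eq {z w : ℂ} {c : ℝ} (hc : 0 ≤ c) (h : z ^ 2 = c + w ^ 2) :
    |z.im| ≤ |w.im| := by
  by_contra! hlt
  have h1 := congrArg Complex.re h
  have h2 := congrArg Complex.im h
  simp [sq] at h1 h2
  have h3 : w.im ^ 2 < z.im ^ 2 := sq_lt_sq.mpr hlt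
  have h4 : w.re ^ 2 < z.re ^ 2 := by nlinarith
  have h5 : z.re * z.im = w.re * w.im := by linarith
  have h6 : z.re ^ 2 * z.im ^ 2 = w.re ^ 2 * w.im ^ 2 := by
    rw [← mul_pow, h5, mul_pow]
  nlinarith [sq_nonneg w.re, sq_nonneg w.im]

/-- `h(|ξ|²)` is a symbol of order `a`, with a bound in a complex strip. -/
structure IsSymbol (h : ℂ → ℂ) (a B : ℝ) : Prop where
  differentiable : Differentiable ℂ h
  bound : ∀ z : ℂ, |z.im| ≤ 2 → ‖h (z ^ 2)‖ ≤ B * (1 + ‖z‖ ^ 2) ^ (a / 2)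

theorem IsSymbol.nonneg {h : ℂ → ℂ} {a B : ℝ} (hs : IsSymbol h a B) : 0 ≤ B := by
  simpa using (norm_nonneg _).trans (hs.bound 0 (by simp))

theorem iteratedDeriv_comp_ofReal {f : ℂ → ℂ} (hf : Differentiable ℂ f) (k : ℕ) :
    iteratedDeriv k (fun t : ℝ => f t) = fun t : ℝ => iteratedDeriv k f t := by
  induction k with
  | zero => simp
  | succ k ih =>
    rw [iteratedDeriv_succ, ih]
    funext t
    have h1 : DifferentiableAt ℂ (iteratedDeriv k f) t :=
      (hf.contDiff (n := (k + 1 : ℕ))).differentiable_iteratedDeriv k (by exact_mod_cast Nat.lt_succ_self k) _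
    rw [h1.hasDerivAt.comp_ofReal.deriv, iteratedDeriv_succ]

theorem contDiff_comp_ofReal {f : ℂ → ℂ} (hf : Differentiable ℂ f) {n : WithTop ℕ∞} :
    ContDiff ℝ n (fun t : ℝ => f t) :=
  ((hf.contDiff (n := n)).restrict_scalars ℝ).comp Complex.ofRealCLM.contDiff

/-- Cauchy's estimate on the unit circle. -/
theorem norm_iteratedDeriv_comp_ofReal_le {f : ℂ → ℂ} (hf : Differentiable ℂ f) (k : ℕ) (t : ℝ)
    {A : ℝ} (hA : ∀ w : ℂ, ‖w - t‖ ≤ 1 → ‖f w‖ ≤ A) :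
    ‖iteratedDeriv k (fun t : ℝ => f t) t‖ ≤ k.factorial * A := by
  rw [iteratedDeriv_comp_ofReal hf]
  have := Complex.norm_iteratedDeriv_le_of_forall_mem_sphere_norm_le (f := f) (c := (t : ℂ)) k
    zero_lt_one hf.diffContOnCl (fun z hz => hA z (mem_sphere_iff_norm.mp hz).le)
  simpa using this

/-- Cauchy's estimates on unit discs around points `t ≥ 0`: square roots of points of such a disc
stay in the strip `|Im z| ≤ 2`, where the symbol grows polynomially. -/
theorem IsSymbol.hasTemperateGrowth {h : ℂ → ℂ} {a B : ℝ} (hs : IsSymbol h a B) :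
    Function.HasTemperateGrowth fun ξ : Eucl d => h ((‖ξ‖ ^ 2 : ℝ) : ℂ) := by
  have hB := hs.nonneg
  obtain ⟨m, hm⟩ := exists_nat_ge |a / 2|
  have hbd : ∀ (n : ℕ) (t : ℝ), 0 ≤ t →
      ‖iteratedDeriv n (fun t : ℝ => h t) t‖ ≤ n.factorial * (B * (2 + t) ^ m) := by
    intro n t ht
    refine norm_iteratedDeriv_comp_ofReal_le hs.differentiable n t fun w hw => ?_
    obtain ⟨z, rfl⟩ : ∃ z : ℂ, z ^ 2 = w := IsAlgClosed.exists_pow_nat_eq w two_pos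
    have hz : |z.im| ≤ 2 := by
      have h1 := (Complex.abs_re_le_norm _).trans hw
      have h2 := (Complex.abs_im_le_norm _).trans hw
      simp [sq] at h1 h2
      rw [abs_le] at h1 h2
      rw [← abs_two, ← sq_le_sq]
      by_contra! hlt
      have h3 : 3 ≤ z.re ^ 2 := by nlinarith
      have h4 : (z.re * z.im) ^ 2 ≤ 1 := by
        rw [← abs_le] at h2
        have : |z.re * z.im| ≤ 1 := by
          rw [abs_le] at h2 ⊢
          constructor <;> linarith
        nlinarith [sq_abs (z.re * z.im), abs_nonneg (z.re * z.im)]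
      nlinarith
    refine (hs.bound z hz).trans ?_
    have hn : ‖z‖ ^ 2 ≤ 1 + t := by
      have := norm_le_norm_add_norm_sub' (z ^ 2) (t : ℂ)
      rw [norm_pow, Complex.norm_real, Real.norm_of_nonneg ht] at this
      linarith
    refine mul_le_mul_of_nonneg_left ?_ hB
    have h1 : 1 ≤ 1 + ‖z‖ ^ 2 := by nlinarith [sq_nonneg ‖z‖]
    calc (1 + ‖z‖ ^ 2) ^ (a / 2) ≤ (1 + ‖z‖ ^ 2) ^ (m : ℝ) :=
          Real.rpow_le_rpow_of_exponent_le h1 ((le_abs_self _).trans hm)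
      _ = (1 + ‖z‖ ^ 2) ^ m := Real.rpow_natCast _ _
      _ ≤ (2 + t) ^ m := by
          refine pow_le_pow_left₀ (by positivity) ?_ m
          linarith
  have hcd : ContDiff ℝ (⊤ : ℕ∞) (fun t : ℝ => h t) := contDiff_comp_ofReal hs.differentiable
  have hsq : Function.HasTemperateGrowth fun ξ : Eucl d => ‖ξ‖ ^ 2 := by fun_prop
  -- Growth of `h` is needed only on the half line `[0, ∞)`, the range of `|ξ|²`. Negative arguments
  -- correspond to imaginary frequencies, where the strip bound says nothing.
  refine Function.HasTemperateGrowth.comp' (g := fun t : ℝ => h t) (t := Ici 0) ?_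
    (uniqueDiffOn_Ici 0) hcd.contDiffOn (fun N => ⟨m, N.factorial * (B * 2 ^ m), by positivity,
      fun n hn t ht => ?_⟩) hsq
  · rintro _ ⟨ξ, rfl⟩
    exact sq_nonneg ‖ξ‖
  · rw [norm_iteratedFDerivWithin_eq_norm_iteratedDerivWithin,
      iteratedDerivWithin_eq_iteratedDeriv (uniqueDiffOn_Ici 0)
        ((contDiff_comp_ofReal hs.differentiable).contDiffAt) ht]
    refine (hbd n t ht).trans ?_
    have ht0 : (0 : ℝ) ≤ t := ht
    have h2 : (2 + t) ^ m ≤ 2 ^ m * (1 + ‖t‖) ^ m := by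
      rw [← mul_pow, Real.norm_of_nonneg ht0]
      exact pow_le_pow_left₀ (by linarith) (by linarith) m
    calc (n.factorial : ℝ) * (B * (2 + t) ^ m)
        ≤ N.factorial * (B * (2 ^ m * (1 + ‖t‖) ^ m)) := by
          refine mul_le_mul (by exact_mod_cast Nat.factorial_le hn)
            (mul_le_mul_of_nonneg_left h2 hB) (by positivity) (by positivity)
      _ = _ := by ring

/-- With `b = ⟨ζ, e⟩` one has `‖ζ + te‖² = (‖ζ‖² - b²) + (b + t)²`, which extends to complex `t`.
For `|t| ≤ 1` its square roots lie in the strip and have brackets comparable to that of `ζ`, so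
Cauchy's estimate bounds every derivative by the symbol's own size, without loss of order. -/
theorem IsSymbol.norm_iteratedDeriv_line_le {h : ℂ → ℂ} {a B : ℝ} (hs : IsSymbol h a B)
    (ζ : Eucl d) {e : Eucl d} (he : ‖e‖ = 1) (k : ℕ) :
    ‖iteratedDeriv k (fun t : ℝ => h ((‖ζ + t • e‖ ^ 2 : ℝ) : ℂ)) 0‖
      ≤ k.factorial * (B * (10 ^ |a / 2| * jap ζ ^ (a / 2))) := by
  have hB := hs.nonneg
  set b : ℝ := inner ℝ ζ e with hb
  have hbζ : b ^ 2 ≤ ‖ζ‖ ^ 2 := by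
    rw [sq_le_sq, abs_of_nonneg (norm_nonneg ζ)]
    simpa [he] using abs_real_inner_le_norm ζ e
  set f : ℂ → ℂ := fun w => h (((‖ζ‖ ^ 2 - b ^ 2 : ℝ) : ℂ) + (b + w) ^ 2) with hf
  have hfd : Differentiable ℂ f := by
    refine hs.differentiable.comp ?_
    fun_prop
  have hline : (fun t : ℝ => h ((‖ζ + t • e‖ ^ 2 : ℝ) : ℂ)) = fun t : ℝ => f t := by
    funext t
    rw [hf]
    congr 1
    rw [norm_add_sq_real, norm_smul, he, real_inner_smul_right, ← hb, mul_one, Real.norm_eq_abs,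
      sq_abs]
    push_cast
    ring
  rw [hline]
  refine norm_iteratedDeriv_comp_ofReal_le hfd k 0 fun w hw => ?_
  rw [Complex.ofReal_zero, sub_zero] at hw
  obtain ⟨z, hz⟩ : ∃ z : ℂ, z ^ 2 = ((‖ζ‖ ^ 2 - b ^ 2 : ℝ) : ℂ) + (b + w) ^ 2 :=
    IsAlgClosed.exists_pow_nat_eq _ two_pos
  have him : |z.im| ≤ 2 := by
    refine (abs_im_le_of_sq_eq (by linarith) hz).trans ?_
    have := (Complex.abs_im_le_norm w).trans hw
    simp only [Complex.add_im, Complex.ofReal_im, zero_add]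
    linarith
  have hval : z ^ 2 = ((‖ζ‖ ^ 2 : ℝ) : ℂ) + (2 * b * w + w ^ 2) := by
    rw [hz]; push_cast; ring
  have hbn : |b| ≤ ‖ζ‖ := by rwa [sq_le_sq, abs_of_nonneg (norm_nonneg ζ)] at hbζ
  have hrest : ‖2 * (b : ℂ) * w + w ^ 2‖ ≤ 2 * ‖ζ‖ + 1 := by
    refine (norm_add_le _ _).trans ?_
    rw [norm_mul, norm_mul, norm_pow, Complex.norm_real, Real.norm_eq_abs, Complex.norm_two]
    have h1 : |b| * ‖w‖ ≤ ‖ζ‖ * 1 := mul_le_mul hbn hw (norm_nonneg _) (norm_nonneg _)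
    have h2 : ‖w‖ ^ 2 ≤ 1 := pow_le_one₀ (norm_nonneg _) hw
    nlinarith
  have hzn : ‖z‖ ^ 2 = ‖z ^ 2‖ := (norm_pow _ _).symm
  have hup : ‖z‖ ^ 2 ≤ ‖ζ‖ ^ 2 + (2 * ‖ζ‖ + 1) := by
    rw [hzn, hval]
    refine (norm_add_le _ _).trans (add_le_add (le_of_eq ?_) hrest)
    rw [Complex.norm_real, Real.norm_of_nonneg (sq_nonneg _)]
  have hlo : ‖ζ‖ ^ 2 - (2 * ‖ζ‖ + 1) ≤ ‖z‖ ^ 2 := by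
    rw [hzn, hval]
    have := norm_sub_le_norm_add ((‖ζ‖ ^ 2 : ℝ) : ℂ) (2 * (b : ℂ) * w + w ^ 2)
    rw [Complex.norm_real, Real.norm_of_nonneg (sq_nonneg _)] at this
    linarith
  have hj : jap ζ = 1 + ‖ζ‖ ^ 2 := rfl
  have hz0 := sq_nonneg ‖z‖
  have hup' : 1 + ‖z‖ ^ 2 ≤ 10 * jap ζ := by rw [hj]; nlinarith [sq_nonneg (‖ζ‖ - 1)]
  -- For `‖ζ‖ ≤ 3` the factor `10` alone suffices; beyond that the quadratic term in `hlo` dominates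
  -- the linear one.
  have hlo' : jap ζ ≤ 10 * (1 + ‖z‖ ^ 2) := by
    rw [hj]
    rcases le_total ‖ζ‖ 3 with h3 | h3 <;> nlinarith [norm_nonneg ζ, sq_nonneg (‖ζ‖ - 3)]
  have hfw : f w = h (z ^ 2) := by rw [hf, hz]
  rw [hfw]
  refine (hs.bound z him).trans (mul_le_mul_of_nonneg_left ?_ hB)
  have hzp : 0 < 1 + ‖z‖ ^ 2 := by positivity
  rcases le_total 0 (a / 2) with ha | ha
  · rw [abs_of_nonneg ha, ← Real.mul_rpow (by norm_num) (jap_pos ζ).le]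
    exact Real.rpow_le_rpow hzp.le hup' ha
  · rw [abs_of_nonpos ha]
    have h1 : (10 * (1 + ‖z‖ ^ 2)) ^ (a / 2) ≤ jap ζ ^ (a / 2) :=
      Real.rpow_le_rpow_of_nonpos (jap_pos ζ) hlo' ha
    calc (1 + ‖z‖ ^ 2) ^ (a / 2)
        = 10 ^ (-(a / 2)) * (10 * (1 + ‖z‖ ^ 2)) ^ (a / 2) := by
          rw [Real.mul_rpow (by norm_num) hzp.le, ← mul_assoc, ← Real.rpow_add (by norm_num)]
          simp
      _ ≤ _ := mul_le_mul_of_nonneg_left h1 (by positivity)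

end Symbols

end ModulationNLW
end

noncomputable section

namespace ModulationNLW

open SchwartzMap FourierTransform

variable {d : ℕ}

/-! ### The phase-space kernel of a Fourier multiplier. -/

section Multipliers

open LineDeriv

theorem norm_iteratedDeriv_mul_le {f f' : ℝ → ℂ} (hf : ContDiff ℝ (⊤ : ℕ∞) f) (hf' : ContDiff ℝ (⊤ : ℕ∞) f')
    {N : ℕ} {t A A' : ℝ} (h : ∀ k ≤ N, ‖iteratedDeriv k f t‖ ≤ A)
    (h' : ∀ k ≤ N, ‖iteratedDeriv k f' t‖ ≤ A') {k : ℕ} (hk : k ≤ N) :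
    ‖iteratedDeriv k (fun t => f t * f' t) t‖ ≤ 2 ^ N * (A * A') := by
  have hA : 0 ≤ A := (norm_nonneg _).trans (h 0 (Nat.zero_le _))
  have hA' : 0 ≤ A' := (norm_nonneg _).trans (h' 0 (Nat.zero_le _))
  rw [← norm_iteratedFDeriv_eq_norm_iteratedDeriv]
  refine (norm_iteratedFDeriv_mul_le hf hf' t (n := k) (by exact_mod_cast le_top)).trans ?_
  calc _ ≤ ∑ i ∈ Finset.range (k + 1), (k.choose i : ℝ) * (A * A') := by
        refine Finset.sum_le_sum fun i hi => ?_
        rw [norm_iteratedFDeriv_eq_norm_iteratedDeriv, norm_iteratedFDeriv_eq_norm_iteratedDeriv,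
          mul_assoc]
        have hik : i ≤ k := Nat.lt_succ_iff.mp (Finset.mem_range.mp hi)
        exact mul_le_mul_of_nonneg_left (mul_le_mul (h i (hik.trans hk))
          (h' _ ((Nat.sub_le _ _).trans hk)) (norm_nonneg _) hA) (Nat.cast_nonneg _)
    _ = 2 ^ k * (A * A') := by
        rw [← Finset.sum_mul]
        congr 1
        exact_mod_cast Nat.sum_range_choose k
    _ ≤ _ := mul_le_mul_of_nonneg_right (pow_le_pow_right₀ (by norm_num) hk) (mul_nonneg hA hA')

theorem contDiff_line (φ : 𝓢(Eucl d, ℂ)) (ζ e : Eucl d) :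
    ContDiff ℝ (⊤ : ℕ∞) fun t : ℝ => φ (ζ + t • e) :=
  (φ.smooth ⊤).comp (contDiff_const.add (contDiff_id.smul contDiff_const))

theorem iteratedDeriv_line (φ : 𝓢(Eucl d, ℂ)) (ζ e : Eucl d) (k : ℕ) :
    iteratedDeriv k (fun t : ℝ => φ (ζ + t • e))
      = fun t : ℝ => ((lineDerivOp e)^[k] φ : 𝓢(Eucl d, ℂ)) (ζ + t • e) := by
  induction k with
  | zero => simp
  | succ k ih =>
    rw [iteratedDeriv_succ, ih]
    funext t
    rw [Function.iterate_succ_apply', lineDerivOp_apply_eq_fderiv]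
    set χ : 𝓢(Eucl d, ℂ) := (lineDerivOp e)^[k] φ
    have h1 : HasDerivAt (fun t : ℝ => ζ + t • e) e t := by
      simpa using ((hasDerivAt_id t).smul_const e).const_add ζ
    exact (χ.differentiableAt.hasFDerivAt.comp_hasDerivAt t h1).deriv

theorem exists_norm_iteratedDeriv_line_le (φ : 𝓢(Eucl d, ℂ)) (M : ℝ) (N : ℕ) :
    ∃ C, 0 ≤ C ∧ ∀ (j : Fin d) (k : ℕ), k ≤ N → ∀ ζ : Eucl d,
      ‖iteratedDeriv k (fun t : ℝ => φ (ζ + t • EuclideanSpace.single j (1 : ℝ))) 0‖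
        ≤ C * jap ζ ^ (-M) := by
  choose c hc h using fun (j : Fin d) (k : ℕ) =>
    schwartz_decay ((lineDerivOp (EuclideanSpace.single j (1 : ℝ)))^[k] φ : 𝓢(Eucl d, ℂ)) M
  refine ⟨∑ j, ∑ k ∈ Finset.range (N + 1), c j k,
    Finset.sum_nonneg fun j _ => Finset.sum_nonneg fun k _ => hc j k, fun j k hk ζ => ?_⟩
  rw [iteratedDeriv_line]
  simp only [zero_smul, add_zero]
  refine (h j k ζ).trans (mul_le_mul_of_nonneg_right ?_ (Real.rpow_nonneg (jap_pos ζ).le _))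
  calc c j k ≤ ∑ k ∈ Finset.range (N + 1), c j k :=
        Finset.single_le_sum (fun k _ => hc j k) (Finset.mem_range.mpr (Nat.lt_succ_of_le hk))
    _ ≤ _ := Finset.single_le_sum
        (f := fun j => ∑ k ∈ Finset.range (N + 1), c j k)
        (fun j _ => Finset.sum_nonneg fun k _ => hc j k) (Finset.mem_univ j)

theorem norm_fourier_le_integral (φ : 𝓢(Eucl d, ℂ)) (w : Eucl d) :
    ‖(𝓕 φ : 𝓢(Eucl d, ℂ)) w‖ ≤ ∫ ζ, ‖φ ζ‖ := by
  rw [SchwartzMap.fourier_coe, fourier_eq_chr]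
  refine (norm_integral_le_integral_norm _).trans (le_of_eq ?_)
  simp

theorem fourier_iterate_lineDerivOp (φ : 𝓢(Eucl d, ℂ)) (e w : Eucl d) (N : ℕ) :
    (𝓕 ((lineDerivOp e)^[N] φ : 𝓢(Eucl d, ℂ)) : 𝓢(Eucl d, ℂ)) w
      = (2 * Real.pi * Complex.I * inner ℝ w e) ^ N * (𝓕 φ : 𝓢(Eucl d, ℂ)) w := by
  induction N with
  | zero => simp
  | succ N ih =>
    have ht : Function.HasTemperateGrowth fun w : Eucl d => inner ℝ w e := by fun_prop
    rw [Function.iterate_succ_apply', SchwartzMap.fourier_lineDerivOp_eq, smul_apply,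
      SchwartzMap.smulLeftCLM_apply_apply ht, ih, pow_succ]
    simp only [smul_eq_mul, Complex.real_smul]
    ring

theorem norm_inner_pow_mul_norm_fourier_le (φ : 𝓢(Eucl d, ℂ)) (e w : Eucl d) (N : ℕ) :
    |inner ℝ w e| ^ N * ‖(𝓕 φ : 𝓢(Eucl d, ℂ)) w‖
      ≤ ∫ ζ, ‖iteratedDeriv N (fun t : ℝ => φ (ζ + t • e)) 0‖ := by
  have h := norm_fourier_le_integral ((lineDerivOp e)^[N] φ : 𝓢(Eucl d, ℂ)) w
  rw [fourier_iterate_lineDerivOp, norm_mul, norm_pow] at h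
  simp_rw [iteratedDeriv_line, zero_smul, add_zero]
  refine le_trans (mul_le_mul_of_nonneg_right (pow_le_pow_left₀ (abs_nonneg _) ?_ N)
    (norm_nonneg _)) h
  simp only [norm_mul, Complex.norm_I, Complex.norm_real, Real.norm_eq_abs, Complex.norm_two,
    mul_one, abs_of_pos Real.pi_pos]
  have := Real.pi_gt_three
  nlinarith [abs_nonneg (inner ℝ w e : ℝ)]

/-- A Schwartz function with integrable pure derivatives of order `2(d+1)` has a Fourier transform
decaying like `⟨w⟩^{-2(d+1)}`. -/
theorem norm_fourier_le_of_integral_le (φ : 𝓢(Eucl d, ℂ)) {Q : ℝ} (hQ₀ : ∫ ζ, ‖φ ζ‖ ≤ Q)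
    (hQ : ∀ j : Fin d, ∫ ζ, ‖iteratedDeriv (2 * (d + 1))
      (fun t : ℝ => φ (ζ + t • EuclideanSpace.single j (1 : ℝ))) 0‖ ≤ Q) (w : Eucl d) :
    ‖(𝓕 φ : 𝓢(Eucl d, ℂ)) w‖ ≤ (1 + d) ^ (d + 1) * Q * jap w ^ (-((d : ℝ) + 1)) := by
  have hw0 : ‖(𝓕 φ : 𝓢(Eucl d, ℂ)) w‖ ≤ Q := (norm_fourier_le_integral φ w).trans hQ₀
  have hexp : jap w ^ (-((d : ℝ) + 1)) = (jap w ^ (d + 1))⁻¹ := by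
    rw [Real.rpow_neg (jap_pos w).le]
    congr 1
    exact_mod_cast Real.rpow_natCast (jap w) (d + 1)
  rw [hexp, ← div_eq_mul_inv, le_div_iff₀ (pow_pos (jap_pos w) _)]
  have hsum : jap w = 1 + ∑ i, |w i| ^ 2 := by
    rw [jap, EuclideanSpace.norm_sq_eq]
    simp
  have hn : 0 ≤ ‖(𝓕 φ : 𝓢(Eucl d, ℂ)) w‖ := norm_nonneg _
  -- If all coordinates are at most `1` the bracket is bounded and the `L¹` bound suffices.
  -- Otherwise the largest coordinate controls it, and derivatives in that one direction are enough.
  by_cases hall : ∀ i, |w i| ≤ 1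
  · have h1 : jap w ≤ 1 + d := by
      rw [hsum]
      have : ∑ i, |w i| ^ 2 ≤ ∑ _i : Fin d, (1 : ℝ) :=
        Finset.sum_le_sum fun i _ => pow_le_one₀ (abs_nonneg _) (hall i)
      simpa using this
    rw [mul_comm]
    exact mul_le_mul (pow_le_pow_left₀ (jap_pos w).le h1 _) hw0 hn (by positivity)
  · push Not at hall
    obtain ⟨i₀, hi₀⟩ := hall
    have : Nonempty (Fin d) := ⟨i₀⟩
    obtain ⟨j, hj⟩ := Finite.exists_max fun i => |w i|
    have hj1 : 1 ≤ |w j| := hi₀.le.trans (hj i₀)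
    have h1 : jap w ≤ (1 + d) * |w j| ^ 2 := by
      rw [hsum]
      have : ∑ i, |w i| ^ 2 ≤ ∑ _i : Fin d, |w j| ^ 2 :=
        Finset.sum_le_sum fun i _ => pow_le_pow_left₀ (abs_nonneg _) (hj i) 2
      simp at this
      have h2 : 1 ≤ |w j| ^ 2 := one_le_pow₀ hj1
      simp only [sq_abs] at h2
      simp only [sq_abs]
      linarith
    have h2 := (norm_inner_pow_mul_norm_fourier_le φ (EuclideanSpace.single j (1 : ℝ)) w
      (2 * (d + 1))).trans (hQ j)
    rw [EuclideanSpace.inner_single_right] at h2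
    simp only [conj_trivial, one_mul] at h2
    calc ‖(𝓕 φ : 𝓢(Eucl d, ℂ)) w‖ * jap w ^ (d + 1)
        ≤ ‖(𝓕 φ : 𝓢(Eucl d, ℂ)) w‖ * ((1 + d) * |w j| ^ 2) ^ (d + 1) :=
          mul_le_mul_of_nonneg_left (pow_le_pow_left₀ (jap_pos w).le h1 _) hn
      _ = (1 + d) ^ (d + 1) * (|w j| ^ (2 * (d + 1)) * ‖(𝓕 φ : 𝓢(Eucl d, ℂ)) w‖) := by
          rw [mul_pow, ← pow_mul]; ring
      _ ≤ _ := mul_le_mul_of_nonneg_left h2 (by positivity)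

/-- The symbol cut off to the frequencies `ξ` and `η` by the Fourier transform of the window. -/
def cutSymbol (g : 𝓢(Eucl d, ℂ)) (σ : Eucl d → ℂ) (ξ η : Eucl d) : 𝓢(Eucl d, ℂ) :=
  smulLeftCLM ℂ σ (mulS (compSubConstCLM ℂ ξ (𝓕⁻ (conjS g) : 𝓢(Eucl d, ℂ)))
    (compSubConstCLM ℂ η (𝓕 g : 𝓢(Eucl d, ℂ))))

theorem cutSymbol_apply (g : 𝓢(Eucl d, ℂ)) {σ : Eucl d → ℂ} (hσ : σ.HasTemperateGrowth)
    (ξ η ζ : Eucl d) : cutSymbol g σ ξ η ζ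
      = σ ζ * ((𝓕⁻ (conjS g) : 𝓢(Eucl d, ℂ)) (ζ - ξ) * (𝓕 g : 𝓢(Eucl d, ℂ)) (ζ - η)) := by
  rw [cutSymbol, SchwartzMap.smulLeftCLM_apply_apply hσ]
  simp

theorem fourierInv_compSubConst (φ : 𝓢(Eucl d, ℂ)) (x ζ : Eucl d) :
    (𝓕⁻ (compSubConstCLM ℂ x φ) : 𝓢(Eucl d, ℂ)) ζ
      = chr x (-ζ) * (𝓕⁻ φ : 𝓢(Eucl d, ℂ)) ζ := by
  rw [SchwartzMap.fourierInv_coe, SchwartzMap.fourierInv_coe, fourierInv_eq_chr, fourierInv_eq_chr,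
    ← integral_add_right_eq_self _ x, ← integral_const_mul]
  refine integral_congr_ae (ae_of_all _ fun y => ?_)
  simp only [compSubConstCLM_apply, add_sub_cancel_right, chr_add_left]
  ring

theorem fourier_conjShift_conjS (g : 𝓢(Eucl d, ℂ)) (y η ζ : Eucl d) :
    (𝓕 (conjShift (conjS g) y (-η)) : 𝓢(Eucl d, ℂ)) ζ
      = chr y (ζ - η) * (𝓕 g : 𝓢(Eucl d, ℂ)) (ζ - η) := by
  rw [SchwartzMap.fourier_coe, SchwartzMap.fourier_coe, fourier_eq_chr, fourier_eq_chr,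
    ← integral_add_right_eq_self _ y, ← integral_const_mul]
  refine integral_congr_ae (ae_of_all _ fun v => ?_)
  simp only [conjShift_apply', add_sub_cancel_right, conjS_apply, Complex.conj_conj,
    sub_eq_add_neg ζ η, chr_add_left, chr_add_right]
  ring

/-- Up to phases, the kernel of the multiplier between `(y, η)` and `(x, ξ)` is the Fourier
transform, at `y - x`, of the symbol localised near `ξ` and `η`. -/
theorem norm_stft_multiplier (g : 𝓢(Eucl d, ℂ)) {σ : Eucl d → ℂ} (hσ : σ.HasTemperateGrowth)
    (x ξ y η : Eucl d) :
    ‖stft (conjS g) ((𝓕 (smulLeftCLM ℂ σ (𝓕⁻ (conjShift g x ξ) : 𝓢(Eucl d, ℂ)))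
      : 𝓢(Eucl d, ℂ)) : 𝓢'(Eucl d, ℂ)) y (-η)‖
      = ‖(𝓕 (cutSymbol g σ ξ η) : 𝓢(Eucl d, ℂ)) (y - x)‖ := by
  have h1 : stft (conjS g) ((𝓕 (smulLeftCLM ℂ σ (𝓕⁻ (conjShift g x ξ) : 𝓢(Eucl d, ℂ)))
      : 𝓢(Eucl d, ℂ)) : 𝓢'(Eucl d, ℂ)) y (-η)
      = chr x ξ * chr y (-η) * (𝓕 (cutSymbol g σ ξ η) : 𝓢(Eucl d, ℂ)) (y - x) := by
    rw [stft, SchwartzMap.coe_apply]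
    simp_rw [smul_eq_mul, mul_comm ((conjShift _ _ _ : 𝓢(Eucl d, ℂ)) _)]
    rw [SchwartzMap.integral_fourier_mul_eq, SchwartzMap.fourier_coe (cutSymbol g σ ξ η),
      fourier_eq_chr, ← integral_const_mul]
    refine integral_congr_ae (ae_of_all _ fun ζ => ?_)
    simp only [SchwartzMap.smulLeftCLM_apply_apply hσ,
      cutSymbol_apply g hσ, conjShift_eq_fourier g, FourierTransform.fourierInv_fourier_eq,
      compSubConstCLM_apply, fourierInv_compSubConst, smul_eq_mul]
    have e1 : chr ζ (y - x) = chr y ζ * chr x (-ζ) := by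
      rw [sub_eq_add_neg, chr_add_right, chr_comm ζ y, ← conj_chr ζ, chr_comm ζ x, conj_chr]
    rw [e1, fourier_conjShift_conjS, neg_sub, sub_eq_add_neg ξ ζ, sub_eq_add_neg ζ η, chr_add_right, chr_add_right]
    ring
  rw [h1, norm_mul, norm_mul, norm_chr, norm_chr, one_mul, one_mul]

/-- By Leibniz, directional derivatives of the cut symbol are bounded by `⟨ζ⟩^a` times the decay of
both cutoffs. Peetre turns this into `⟨η⟩^a`, decay in `ξ - η`, and an integrable function of `ζ -
η`; smoothness of order `2(d + 1)` then gives the decay in `w`. -/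
theorem exists_norm_fourier_cutSymbol_le (hd : 1 ≤ d) (g : 𝓢(Eucl d, ℂ)) (a : ℝ) {M : ℝ} (hM : 0 ≤ M) :
    ∃ C, 0 ≤ C ∧ ∀ (h : ℂ → ℂ) (B : ℝ), IsSymbol h a B → ∀ ξ η w : Eucl d,
      ‖(𝓕 (cutSymbol g (fun ξ : Eucl d => h ((‖ξ‖ ^ 2 : ℝ) : ℂ)) ξ η) : 𝓢(Eucl d, ℂ)) w‖
        ≤ C * B * (jap η ^ (a / 2) * jap (ξ - η) ^ (-M) * jap w ^ (-((d : ℝ) + 1))) := by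
  set N := 2 * (d + 1) with hN
  -- The decay of the cutoff at `η` must pay `|a / 2|` for moving the symbol weight to `η`, `M` for
  -- moving the cutoff at `ξ` to `ξ - η`, and `d + 1` for integrability in `ζ`.
  set M' := M + |a / 2| + (d + 1) with hM'
  obtain ⟨C₁, hC₁, h₁⟩ := exists_norm_iteratedDeriv_line_le (𝓕⁻ (conjS g) : 𝓢(Eucl d, ℂ)) M' N
  obtain ⟨C₂, hC₂, h₂⟩ := exists_norm_iteratedDeriv_line_le (𝓕 g : 𝓢(Eucl d, ℂ)) M' N
  set I := ∫ ζ : Eucl d, jap ζ ^ (-((d : ℝ) + 1)) with hI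
  have hIint : Integrable fun ζ : Eucl d => jap ζ ^ (-((d : ℝ) + 1)) :=
    integrable_jap_rpow (by linarith)
  have hI0 : 0 ≤ I := integral_nonneg fun ζ => Real.rpow_nonneg (jap_pos ζ).le _
  set K := 2 ^ N * (N.factorial * 10 ^ |a / 2| * (2 ^ N * (C₁ * C₂))) * (2 ^ |a / 2| * 2 ^ M)
    with hK
  have hK0 : 0 ≤ K := by positivity
  refine ⟨(1 + d) ^ (d + 1) * (K * I), by positivity, fun h B hs ξ η w => ?_⟩
  have hB := hs.nonneg
  set σ : Eucl d → ℂ := fun ξ : Eucl d => h ((‖ξ‖ ^ 2 : ℝ) : ℂ) with hσ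
  have hσt : σ.HasTemperateGrowth := hs.hasTemperateGrowth
  set R := jap η ^ (a / 2) * jap (ξ - η) ^ (-M) with hR
  have hR0 : 0 ≤ R := mul_nonneg (Real.rpow_nonneg (jap_pos _).le _)
    (Real.rpow_nonneg (jap_pos _).le _)
  have hweight : ∀ ζ : Eucl d, jap ζ ^ (a / 2) * (jap (ζ - ξ) ^ (-M') * jap (ζ - η) ^ (-M'))
      ≤ 2 ^ |a / 2| * 2 ^ M * (R * jap (ζ - η) ^ (-((d : ℝ) + 1))) := by
    intro ζ
    have w1 := jap_rpow_le (a / 2) ζ η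
    have w2 : jap (ζ - ξ) ^ (-M') ≤ 2 ^ M * (jap (ξ - η) ^ (-M) * jap (ζ - η) ^ M) := by
      refine (jap_rpow_mono (r' := -M) ?_ _).trans ?_
      · have := abs_nonneg (a / 2)
        have : (0 : ℝ) ≤ d := Nat.cast_nonneg d
        linarith
      have h3 := jap_rpow_le (-M) (ξ - ζ) (ξ - η)
      rw [abs_neg, abs_of_nonneg hM, sub_sub_sub_cancel_left, ← jap_neg (ξ - ζ), neg_sub,
        ← jap_neg (η - ζ), neg_sub] at h3
      exact h3
    have p : ∀ (x : Eucl d) (r : ℝ), 0 ≤ jap x ^ r := fun x r => Real.rpow_nonneg (jap_pos x).le r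
    have hadd : jap (ζ - η) ^ |a / 2| * (jap (ζ - η) ^ M * jap (ζ - η) ^ (-M'))
        = jap (ζ - η) ^ (-((d : ℝ) + 1)) := by
      rw [← Real.rpow_add (jap_pos _), ← Real.rpow_add (jap_pos _)]
      congr 1
      rw [hM']; ring
    calc jap ζ ^ (a / 2) * (jap (ζ - ξ) ^ (-M') * jap (ζ - η) ^ (-M'))
        ≤ (2 ^ |a / 2| * (jap η ^ (a / 2) * jap (ζ - η) ^ |a / 2|))
          * ((2 ^ M * (jap (ξ - η) ^ (-M) * jap (ζ - η) ^ M)) * jap (ζ - η) ^ (-M')) := by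
          refine mul_le_mul w1 (mul_le_mul_of_nonneg_right w2 (p _ _))
            (mul_nonneg (p _ _) (p _ _)) ?_
          exact mul_nonneg (by positivity) (mul_nonneg (p _ _) (p _ _))
      _ = 2 ^ |a / 2| * 2 ^ M * (R * (jap (ζ - η) ^ |a / 2|
            * (jap (ζ - η) ^ M * jap (ζ - η) ^ (-M')))) := by rw [hR]; ring
      _ = _ := by rw [hadd]
  have hder : ∀ (j : Fin d) (k : ℕ), k ≤ N → ∀ ζ : Eucl d,
      ‖iteratedDeriv k (fun t : ℝ => cutSymbol g σ ξ η
        (ζ + t • EuclideanSpace.single j (1 : ℝ))) 0‖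
        ≤ K * (B * (R * jap (ζ - η) ^ (-((d : ℝ) + 1)))) := by
    intro j k hk ζ
    have he : ‖EuclideanSpace.single j (1 : ℝ)‖ = 1 := by simp
    set e := EuclideanSpace.single j (1 : ℝ) with he'
    have b1 : ∀ i ≤ N, ‖iteratedDeriv i (fun t : ℝ => σ (ζ + t • e)) 0‖
        ≤ N.factorial * (B * (10 ^ |a / 2| * jap ζ ^ (a / 2))) := fun i hi =>
      (hs.norm_iteratedDeriv_line_le ζ he i).trans (mul_le_mul_of_nonneg_right
        (by exact_mod_cast Nat.factorial_le hi)
        (mul_nonneg hB (mul_nonneg (by positivity) (Real.rpow_nonneg (jap_pos ζ).le _))))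
    have hsm : ContDiff ℝ (⊤ : ℕ∞) fun t : ℝ => σ (ζ + t • e) :=
      hσt.1.comp (contDiff_const.add (contDiff_id.smul contDiff_const))
    have b2 := fun i hi => h₁ j i hi (ζ - ξ)
    have b3 := fun i hi => h₂ j i hi (ζ - η)
    have b4 := norm_iteratedDeriv_mul_le hsm
      ((contDiff_line (𝓕⁻ (conjS g) : 𝓢(Eucl d, ℂ)) (ζ - ξ) e).mul
        (contDiff_line (𝓕 g : 𝓢(Eucl d, ℂ)) (ζ - η) e)) b1
      (fun i hi => norm_iteratedDeriv_mul_le (contDiff_line _ (ζ - ξ) e)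
        (contDiff_line _ (ζ - η) e) b2 b3 hi) hk
    have heq : (fun t : ℝ => cutSymbol g σ ξ η (ζ + t • e)) = fun t : ℝ => σ (ζ + t • e)
        * ((𝓕⁻ (conjS g) : 𝓢(Eucl d, ℂ)) (ζ - ξ + t • e)
          * (𝓕 g : 𝓢(Eucl d, ℂ)) (ζ - η + t • e)) := by
      funext t
      rw [cutSymbol_apply g hσt, add_sub_right_comm, add_sub_right_comm]
    rw [heq]
    refine b4.trans ?_
    calc _ = 2 ^ N * (N.factorial * 10 ^ |a / 2| * (2 ^ N * (C₁ * C₂))) * B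
            * (jap ζ ^ (a / 2) * (jap (ζ - ξ) ^ (-M') * jap (ζ - η) ^ (-M'))) := by ring
      _ ≤ 2 ^ N * (N.factorial * 10 ^ |a / 2| * (2 ^ N * (C₁ * C₂))) * B
            * (2 ^ |a / 2| * 2 ^ M * (R * jap (ζ - η) ^ (-((d : ℝ) + 1)))) :=
          mul_le_mul_of_nonneg_left (hweight ζ) (by positivity)
      _ = _ := by rw [hK]; ring
  -- The value is the derivative of order `0` along any line; a coordinate direction exists because
  -- `1 ≤ d`.
  have hval : ∀ ζ, ‖cutSymbol g σ ξ η ζ‖ ≤ K * (B * (R * jap (ζ - η) ^ (-((d : ℝ) + 1)))) := by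
    intro ζ
    simpa using hder ⟨0, hd⟩ 0 (Nat.zero_le _) ζ
  have hint : ∫ ζ, K * (B * (R * jap (ζ - η) ^ (-((d : ℝ) + 1)))) = K * (B * (R * I)) := by
    rw [integral_const_mul, integral_const_mul, integral_const_mul,
      integral_sub_right_eq_self (fun ζ : Eucl d => jap ζ ^ (-((d : ℝ) + 1)))]
  have hii : Integrable fun ζ => K * (B * (R * jap (ζ - η) ^ (-((d : ℝ) + 1)))) :=
    (((hIint.comp_sub_right η).const_mul _).const_mul _).const_mul _
  have := norm_fourier_le_of_integral_le (cutSymbol g σ ξ η) (Q := K * (B * (R * I)))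
    ((integral_mono_of_nonneg (ae_of_all _ fun ζ => norm_nonneg _) hii
      (ae_of_all _ hval)).trans hint.le)
    (fun j => (integral_mono_of_nonneg (ae_of_all _ fun ζ => norm_nonneg _) hii
      (ae_of_all _ (hder j N le_rfl))).trans hint.le) w
  refine this.trans (le_of_eq ?_)
  ring

end Multipliers

end ModulationNLW
end

noncomputable section

namespace ModulationNLW

open SchwartzMap FourierTransform

variable {d : ℕ}

/-! ### The wave propagators on modulation spaces. -/

section Propagators

/-- A Fourier multiplier with symbol `h(|ξ|²)` of order `a` maps `M^{p,1}_{s+a}` to `M^{p,1}_s`,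
with a norm controlled by the symbol bound. -/
theorem exists_modNorm_multiplier_le (hd : 1 ≤ d) {g : 𝓢(Eucl d, ℂ)} (hg : g ≠ 0) {p : ℝ≥0∞}
    (hp : 1 ≤ p) (s a : ℝ) :
    ∃ C : ℝ≥0∞, C < ∞ ∧ ∀ (h : ℂ → ℂ) (B : ℝ), IsSymbol h a B → ∀ f : 𝓢'(Eucl d, ℂ),
      modNorm g p 1 s (TemperedDistribution.fourierMultiplierCLM ℂ
        (fun ξ : Eucl d => h ((‖ξ‖ ^ 2 : ℝ) : ℂ)) f)
        ≤ C * ENNReal.ofReal B * modNorm g p 1 (s + a) f := by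
  obtain ⟨C, hC, hK⟩ := exists_norm_fourier_cutSymbol_le hd g a (M := |s / 2| + (d + 1))
    (by positivity)
  refine ⟨ENNReal.ofReal (windowNorm g)⁻¹ * ENNReal.ofReal C
    * ((1 + japInt d) * (ENNReal.ofReal (2 ^ |s / 2|) * japInt d)), ?_, fun h B hs f => ?_⟩
  · exact ENNReal.mul_lt_top (ENNReal.mul_lt_top ENNReal.ofReal_lt_top ENNReal.ofReal_lt_top)
      (kernelConst_lt_top s)
  have hB := hs.nonneg
  set σ : Eucl d → ℂ := fun ξ : Eucl d => h ((‖ξ‖ ^ 2 : ℝ) : ℂ) with hσ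
  have hσt : σ.HasTemperateGrowth := hs.hasTemperateGrowth
  have key := modNorm_le_of_stft_le (g := g) (γ := g) hp (Or.inl rfl) s a (f := f)
    (f' := TemperedDistribution.fourierMultiplierCLM ℂ σ f)
    (C := ENNReal.ofReal (windowNorm g)⁻¹ * (ENNReal.ofReal C * ENNReal.ofReal B)) ?_
  · refine key.trans (le_of_eq ?_)
    ring
  intro x ξ
  rw [stft, TemperedDistribution.fourierMultiplierCLM_apply_apply]
  refine (enorm_apply_le hg f _).trans ?_
  rw [mul_assoc]
  refine mul_le_mul_right ?_ _
  have hne : ENNReal.ofReal C * ENNReal.ofReal B ≠ ∞ :=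
    ENNReal.mul_ne_top ENNReal.ofReal_ne_top ENNReal.ofReal_ne_top
  rw [← lintegral_const_mul' _ _ hne]
  refine lintegral_mono fun η => ?_
  have hm : Measurable fun y => ‖stft g f y η‖ₑ * ejap (-((d : ℝ) + 1)) (x - y) :=
    (measurable_enorm_stft_left g f η).fun_mul
      ((measurable_ejap _).fun_comp (measurable_const.sub measurable_id))
  rw [← mul_assoc, ← lintegral_const_mul _ hm]
  refine lintegral_mono fun y => ?_
  have h1 : ‖stft (conjS g) ((𝓕 (smulLeftCLM ℂ σ (𝓕⁻ (conjShift g x ξ) : 𝓢(Eucl d, ℂ)))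
      : 𝓢(Eucl d, ℂ)) : 𝓢'(Eucl d, ℂ)) y (-η)‖ₑ
      ≤ ENNReal.ofReal C * ENNReal.ofReal B * (ejap (a / 2) η
        * ejap (-(|s / 2| + (d + 1))) (ξ - η) * ejap (-((d : ℝ) + 1)) (x - y)) := by
    have p : ∀ (x : Eucl d) (r : ℝ), 0 ≤ jap x ^ r := fun x r => Real.rpow_nonneg (jap_pos x).le r
    rw [← ofReal_norm, norm_stft_multiplier g hσt, ejap, ejap, ejap, ← ENNReal.ofReal_mul (p _ _),
      ← ENNReal.ofReal_mul (mul_nonneg (p _ _) (p _ _)), ← ENNReal.ofReal_mul hC,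
      ← ENNReal.ofReal_mul (mul_nonneg hC hB), ← jap_neg (x - y), neg_sub]
    exact ENNReal.ofReal_le_ofReal (hK h B hs ξ η (y - x))
  calc _ ≤ ‖stft g f y η‖ₑ * (ENNReal.ofReal C * ENNReal.ofReal B * (ejap (a / 2) η
        * ejap (-(|s / 2| + (d + 1))) (ξ - η) * ejap (-((d : ℝ) + 1)) (x - y))) :=
        mul_le_mul_right h1 _
    _ = _ := by ring

theorem norm_exp_I_mul_le (w : ℂ) : ‖Complex.exp (w * Complex.I)‖ ≤ Real.exp |w.im| := by
  rw [Complex.norm_exp]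
  refine Real.exp_le_exp.mpr ?_
  simpa using neg_le_abs w.im

theorem norm_exp_neg_I_mul_le (w : ℂ) : ‖Complex.exp (-w * Complex.I)‖ ≤ Real.exp |w.im| := by
  simpa using norm_exp_I_mul_le (-w)

theorem norm_cos_le (w : ℂ) : ‖Complex.cos w‖ ≤ Real.exp |w.im| := by
  rw [Complex.cos, norm_div, Complex.norm_two, div_le_iff₀ two_pos]
  refine (norm_add_le _ _).trans ?_
  linarith [norm_exp_I_mul_le w, norm_exp_neg_I_mul_le w]

theorem norm_sin_le (w : ℂ) : ‖Complex.sin w‖ ≤ Real.exp |w.im| := by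
  rw [Complex.sin, norm_div, Complex.norm_two, div_le_iff₀ two_pos, norm_mul, Complex.norm_I,
    mul_one]
  refine (norm_sub_le _ _).trans ?_
  linarith [norm_exp_I_mul_le w, norm_exp_neg_I_mul_le w]

/-- The entire function `z ↦ cos (2πtz)`. -/
def entireCos (t : ℝ) (z : ℂ) : ℂ := Complex.cos (2 * Real.pi * t * z)

/-- The entire function `z ↦ sin (2πtz) / (2πz)`. -/
def entireSinc (t : ℝ) (z : ℂ) : ℂ := t * dslope Complex.sin 0 (2 * Real.pi * t * z)

theorem differentiable_entireCos (t : ℝ) : Differentiable ℂ (entireCos t) := by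
  unfold entireCos; fun_prop

theorem differentiable_entireSinc (t : ℝ) : Differentiable ℂ (entireSinc t) := by
  have h1 : Differentiable ℂ (dslope Complex.sin 0) := by
    rw [← differentiableOn_univ, Complex.differentiableOn_dslope univ_mem, differentiableOn_univ]
    exact Complex.differentiable_sin
  exact (h1.comp (differentiable_id.const_mul (2 * Real.pi * t : ℂ))).const_mul _

theorem entireSinc_of_ne (t : ℝ) {z : ℂ} (hz : z ≠ 0) :
    entireSinc t z = Complex.sin (2 * Real.pi * t * z) / (2 * Real.pi * z) := by
  have hpi : (Real.pi : ℂ) ≠ 0 := by exact_mod_cast Real.pi_ne_zero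
  by_cases ht : t = 0
  · simp [entireSinc, ht]
  have ht' : (t : ℂ) ≠ 0 := by exact_mod_cast ht
  have h0 : 2 * Real.pi * t * z ≠ 0 := by simp [hpi, ht', hz]
  rw [entireSinc, dslope_of_ne _ h0, slope_def_field]
  simp only [Complex.sin_zero, sub_zero]
  field_simp

theorem entireSinc_zero (t : ℝ) : entireSinc t 0 = t := by simp [entireSinc]

theorem entireCos_neg (t : ℝ) (z : ℂ) : entireCos t (-z) = entireCos t z := by
  simp [entireCos]

theorem entireSinc_neg (t : ℝ) (z : ℂ) : entireSinc t (-z) = entireSinc t z := by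
  by_cases hz : z = 0
  · simp [hz]
  · rw [entireSinc_of_ne t hz, entireSinc_of_ne t (neg_ne_zero.mpr hz)]
    simp [neg_div_neg_eq]

theorem entireCos_ofReal (t r : ℝ) :
    entireCos t r = ((Real.cos (2 * Real.pi * t * r) : ℝ) : ℂ) := by
  simp [entireCos]

theorem entireSinc_ofReal (t r : ℝ) :
    entireSinc t r = ((t * Real.sinc (2 * Real.pi * t * r) : ℝ) : ℂ) := by
  by_cases hr : r = 0
  · simp [hr, entireSinc_zero]
  by_cases ht : t = 0
  · simp [ht, entireSinc]
  have hpi := Real.pi_ne_zero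
  rw [entireSinc_of_ne t (by exact_mod_cast hr), Real.sinc_of_ne_zero (by positivity)]
  push_cast
  have hr' : (r : ℂ) ≠ 0 := by exact_mod_cast hr
  have ht' : (t : ℂ) ≠ 0 := by exact_mod_cast ht
  have hpi' : (Real.pi : ℂ) ≠ 0 := by exact_mod_cast hpi
  field_simp

/-- With `|t| ≤ 1` and `|Im z| ≤ 2` the argument has imaginary part at most `4π`. Restricting times
to `[-1, 1]` makes all symbol bounds below uniform. -/
theorem exp_im_le {t : ℝ} (ht : |t| ≤ 1) {z : ℂ} (hz : |z.im| ≤ 2) :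
    Real.exp |(2 * Real.pi * t * z : ℂ).im| ≤ Real.exp (4 * Real.pi) := by
  refine Real.exp_le_exp.mpr ?_
  have h : (2 * Real.pi * t * z : ℂ) = ((2 * Real.pi * t : ℝ) : ℂ) * z := by push_cast; ring
  rw [h, Complex.im_ofReal_mul, abs_mul, abs_mul, abs_mul, abs_two, abs_of_pos Real.pi_pos]
  have h2 : |t| * |z.im| ≤ 1 * 2 := mul_le_mul ht hz (abs_nonneg _) zero_le_one
  nlinarith [Real.pi_pos]

theorem norm_entireCos_le {t : ℝ} (ht : |t| ≤ 1) {z : ℂ} (hz : |z.im| ≤ 2) :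
    ‖entireCos t z‖ ≤ Real.exp (4 * Real.pi) :=
  (norm_cos_le _).trans (exp_im_le ht hz)

theorem norm_sub_le_of_hasDerivAt {f f' : ℝ → ℂ} {C : ℝ} (h : ∀ t, HasDerivAt f (f' t) t)
    (hC : ∀ t, |t| ≤ 1 → ‖f' t‖ ≤ C) {t t' : ℝ} (ht : |t| ≤ 1) (ht' : |t'| ≤ 1) :
    ‖f t - f t'‖ ≤ C * |t - t'| := by
  have hmem : ∀ t : ℝ, |t| ≤ 1 → t ∈ Icc (-1 : ℝ) 1 := fun t ht => abs_le.mp ht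
  exact (convex_Icc (-1 : ℝ) 1).norm_image_sub_le_of_norm_hasDerivWithin_le
    (fun t _ => (h t).hasDerivWithinAt) (fun t ht => hC t (abs_le.mpr ht)) (hmem t' ht') (hmem t ht)

theorem hasDerivAt_entireCos (z : ℂ) (t : ℝ) : HasDerivAt (fun t => entireCos t z)
    (-Complex.sin (2 * Real.pi * t * z) * (2 * Real.pi * z)) t := by
  have h1 : HasDerivAt (fun w : ℂ => 2 * Real.pi * w * z) (2 * Real.pi * z) (t : ℂ) := by
    simpa using ((hasDerivAt_id (t : ℂ)).const_mul (2 * Real.pi : ℂ)).mul_const z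
  exact h1.ccos.comp_ofReal

theorem hasDerivAt_entireSinc (z : ℂ) (t : ℝ) :
    HasDerivAt (fun t => entireSinc t z) (entireCos t z) t := by
  by_cases hz : z = 0
  · simp only [hz, entireSinc_zero, entireCos, mul_zero, Complex.cos_zero]
    exact Complex.ofRealCLM.hasDerivAt
  have hpi : (Real.pi : ℂ) ≠ 0 := by exact_mod_cast Real.pi_ne_zero
  simp only [entireSinc_of_ne _ hz]
  have h1 : HasDerivAt (fun w : ℂ => 2 * Real.pi * w * z) (2 * Real.pi * z) (t : ℂ) := by
    simpa using ((hasDerivAt_id (t : ℂ)).const_mul (2 * Real.pi : ℂ)).mul_const z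
  have h2 := (h1.csin.div_const (2 * Real.pi * z)).comp_ofReal
  convert h2 using 1
  rw [entireCos]
  field_simp

/-- The time derivative of the cosine brings out a factor `‖z‖`, so the Lipschitz bound in time
costs one derivative in space. -/
theorem norm_entireCos_sub_le {t t' : ℝ} (ht : |t| ≤ 1) (ht' : |t'| ≤ 1) {z : ℂ}
    (hz : |z.im| ≤ 2) : ‖entireCos t z - entireCos t' z‖
      ≤ Real.exp (4 * Real.pi) * (2 * Real.pi * ‖z‖) * |t - t'| := by
  refine norm_sub_le_of_hasDerivAt (hasDerivAt_entireCos z) (fun r hr => ?_) ht ht'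
  rw [norm_mul, norm_neg]
  refine mul_le_mul ((norm_sin_le _).trans (exp_im_le hr hz)) (le_of_eq ?_) (norm_nonneg _)
    (Real.exp_pos _).le
  simp [abs_of_pos Real.pi_pos]

/-- Here the time derivative is the bounded cosine, so there is no loss; this is why `K(t)` will be
continuous in operator norm. -/
theorem norm_entireSinc_sub_le {t t' : ℝ} (ht : |t| ≤ 1) (ht' : |t'| ≤ 1) {z : ℂ}
    (hz : |z.im| ≤ 2) : ‖entireSinc t z - entireSinc t' z‖ ≤ Real.exp (4 * Real.pi) * |t - t'| :=
  norm_sub_le_of_hasDerivAt (hasDerivAt_entireSinc z) (fun _ hr => norm_entireCos_le hr hz) ht ht'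

/-- The gain of one derivative. For `‖z‖ ≤ 1` the time Lipschitz bound from `t = 0` suffices; for
`‖z‖ ≥ 1` the division by `2πz` gives the decay. -/
theorem norm_entireSinc_le {t : ℝ} (ht : |t| ≤ 1) {z : ℂ} (hz : |z.im| ≤ 2) :
    ‖entireSinc t z‖ ≤ 2 * Real.exp (4 * Real.pi) * (1 + ‖z‖ ^ 2) ^ ((-1 : ℝ) / 2) := by
  have hE := Real.exp_pos (4 * Real.pi)
  have hsq : (1 + ‖z‖ ^ 2) ^ ((-1 : ℝ) / 2) = (√(1 + ‖z‖ ^ 2))⁻¹ := by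
    rw [neg_div, Real.rpow_neg (by positivity), Real.sqrt_eq_rpow]
  have hpos : 0 < √(1 + ‖z‖ ^ 2) := Real.sqrt_pos.mpr (by positivity)
  rw [hsq, ← div_eq_mul_inv, le_div_iff₀ hpos]
  rcases le_total ‖z‖ 1 with h1 | h1
  · have h2 : ‖entireSinc t z‖ ≤ Real.exp (4 * Real.pi) := by
      have := norm_entireSinc_sub_le ht (t' := 0) (by simp) hz
      have h0 : entireSinc 0 z = 0 := by simp [entireSinc]
      rw [h0, sub_zero, sub_zero] at this
      nlinarith
    have h3 : √(1 + ‖z‖ ^ 2) ≤ 2 := by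
      rw [Real.sqrt_le_left (by norm_num)]
      nlinarith [norm_nonneg z]
    nlinarith [norm_nonneg (entireSinc t z)]
  · have hz0 : z ≠ 0 := by
      rintro rfl
      simp at h1
      linarith
    have h3 : √(1 + ‖z‖ ^ 2) ≤ 2 * ‖z‖ := by
      rw [Real.sqrt_le_left (by positivity)]
      nlinarith
    have h4 : ‖entireSinc t z‖ * (2 * Real.pi * ‖z‖) ≤ Real.exp (4 * Real.pi) := by
      rw [entireSinc_of_ne t hz0, norm_div]
      have : ‖(2 * Real.pi * z : ℂ)‖ = 2 * Real.pi * ‖z‖ := by simp [abs_of_pos Real.pi_pos]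
      rw [this, div_mul_cancel₀ _ (by have := Real.pi_pos; positivity)]
      exact (norm_sin_le _).trans (exp_im_le ht hz)
    have h5 := mul_le_mul_of_nonneg_left h3 (norm_nonneg (entireSinc t z))
    have h6 : 0 ≤ ‖entireSinc t z‖ * ‖z‖ := by positivity
    nlinarith [Real.pi_gt_three]

/-- `cos (2πt|ξ|)` as an entire function of `|ξ|²`. -/
def cosSymbol (t : ℝ) : ℂ → ℂ :=
  (exists_entire_comp_sq (differentiable_entireCos t) (entireCos_neg t)).choose

/-- `sin (2πt|ξ|) / (2π|ξ|)` as an entire function of `|ξ|²`. -/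
def sincSymbol (t : ℝ) : ℂ → ℂ :=
  (exists_entire_comp_sq (differentiable_entireSinc t) (entireSinc_neg t)).choose

theorem cosSymbol_spec (t : ℝ) :
    Differentiable ℂ (cosSymbol t) ∧ ∀ z, cosSymbol t (z ^ 2) = entireCos t z :=
  (exists_entire_comp_sq (differentiable_entireCos t) (entireCos_neg t)).choose_spec

theorem sincSymbol_spec (t : ℝ) :
    Differentiable ℂ (sincSymbol t) ∧ ∀ z, sincSymbol t (z ^ 2) = entireSinc t z :=
  (exists_entire_comp_sq (differentiable_entireSinc t) (entireSinc_neg t)).choose_spec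

theorem isSymbol_cosSymbol {t : ℝ} (ht : |t| ≤ 1) :
    IsSymbol (cosSymbol t) 0 (Real.exp (4 * Real.pi)) where
  differentiable := (cosSymbol_spec t).1
  bound z hz := by simpa [(cosSymbol_spec t).2] using norm_entireCos_le ht hz

theorem isSymbol_sincSymbol {t : ℝ} (ht : |t| ≤ 1) :
    IsSymbol (sincSymbol t) (-1) (2 * Real.exp (4 * Real.pi)) where
  differentiable := (sincSymbol_spec t).1
  bound z hz := by simpa [(sincSymbol_spec t).2] using norm_entireSinc_le ht hz

theorem isSymbol_cosSymbol_sub {t t' : ℝ} (ht : |t| ≤ 1) (ht' : |t'| ≤ 1) :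
    IsSymbol (fun w => cosSymbol t w - cosSymbol t' w) 1
      (Real.exp (4 * Real.pi) * (2 * Real.pi) * |t - t'|) where
  differentiable := (cosSymbol_spec t).1.sub (cosSymbol_spec t').1
  bound z hz := by
    rw [(cosSymbol_spec t).2, (cosSymbol_spec t').2]
    refine (norm_entireCos_sub_le ht ht' hz).trans ?_
    have h1 : ‖z‖ ≤ (1 + ‖z‖ ^ 2) ^ ((1 : ℝ) / 2) := by
      rw [← Real.sqrt_eq_rpow]
      exact Real.le_sqrt_of_sq_le (by linarith)
    have h2 : 0 ≤ Real.exp (4 * Real.pi) * (2 * Real.pi) * |t - t'| := by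
      have := Real.pi_pos
      positivity
    calc _ = Real.exp (4 * Real.pi) * (2 * Real.pi) * |t - t'| * ‖z‖ := by ring
      _ ≤ _ := mul_le_mul_of_nonneg_left h1 h2

theorem isSymbol_sincSymbol_sub {t t' : ℝ} (ht : |t| ≤ 1) (ht' : |t'| ≤ 1) :
    IsSymbol (fun w => sincSymbol t w - sincSymbol t' w) 0
      (Real.exp (4 * Real.pi) * |t - t'|) where
  differentiable := (sincSymbol_spec t).1.sub (sincSymbol_spec t').1
  bound z hz := by
    rw [(sincSymbol_spec t).2, (sincSymbol_spec t').2]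
    simpa using norm_entireSinc_sub_le ht ht' hz

theorem cosProp_eq (t : ℝ) : (cosProp t : 𝓢'(Eucl d, ℂ) →L[ℂ] 𝓢'(Eucl d, ℂ))
    = TemperedDistribution.fourierMultiplierCLM ℂ
      (fun ξ : Eucl d => cosSymbol t ((‖ξ‖ ^ 2 : ℝ) : ℂ)) := by
  rw [cosProp]
  congr 1
  funext ξ
  rw [← entireCos_ofReal, ← (cosSymbol_spec t).2, Complex.ofReal_pow]

theorem sinProp_eq (t : ℝ) : (sinProp t : 𝓢'(Eucl d, ℂ) →L[ℂ] 𝓢'(Eucl d, ℂ))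
    = TemperedDistribution.fourierMultiplierCLM ℂ
      (fun ξ : Eucl d => sincSymbol t ((‖ξ‖ ^ 2 : ℝ) : ℂ)) := by
  rw [sinProp]
  congr 1
  funext ξ
  rw [← entireSinc_ofReal, ← (sincSymbol_spec t).2, Complex.ofReal_pow]

theorem fourierMultiplierCLM_sub_apply {σ σ' : Eucl d → ℂ} (hσ : σ.HasTemperateGrowth)
    (hσ' : σ'.HasTemperateGrowth) (f : 𝓢'(Eucl d, ℂ)) :
    TemperedDistribution.fourierMultiplierCLM ℂ σ f - TemperedDistribution.fourierMultiplierCLM ℂ σ' f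
      = TemperedDistribution.fourierMultiplierCLM ℂ (fun ξ => σ ξ - σ' ξ) f := by
  ext u
  rw [sub_apply]
  simp only [TemperedDistribution.fourierMultiplierCLM_apply_apply]
  have h : ∀ a b : 𝓢(Eucl d, ℂ), 𝓕 a - 𝓕 b = 𝓕 (a - b) := fun a b =>
    (map_sub (fourierCLM ℂ 𝓢(Eucl d, ℂ)) a b).symm
  rw [← map_sub, h]
  congr 2
  ext ξ
  rw [sub_apply, SchwartzMap.smulLeftCLM_apply_apply hσ,
    SchwartzMap.smulLeftCLM_apply_apply hσ',
    SchwartzMap.smulLeftCLM_apply_apply (g := fun ξ => σ ξ - σ' ξ) (hσ.sub hσ'), sub_smul]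

/-- Preservation of the Schwartz class is what keeps the propagator inside the closure of Schwartz
functions, beyond mere finiteness of the norm. -/
theorem exists_cosProp_coe (t : ℝ) (ht : |t| ≤ 1) (φ : 𝓢(Eucl d, ℂ)) :
    ∃ ψ : 𝓢(Eucl d, ℂ), cosProp t (φ : 𝓢'(Eucl d, ℂ)) = (ψ : 𝓢'(Eucl d, ℂ)) := by
  rw [cosProp_eq]
  exact ⟨_, TemperedDistribution.fourierMultiplierCLM_toTemperedDistributionCLM_eq
    (isSymbol_cosSymbol ht).hasTemperateGrowth φ⟩

theorem exists_sinProp_coe (t : ℝ) (ht : |t| ≤ 1) (φ : 𝓢(Eucl d, ℂ)) :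
    ∃ ψ : 𝓢(Eucl d, ℂ), sinProp t (φ : 𝓢'(Eucl d, ℂ)) = (ψ : 𝓢'(Eucl d, ℂ)) := by
  rw [sinProp_eq]
  exact ⟨_, TemperedDistribution.fourierMultiplierCLM_toTemperedDistributionCLM_eq
    (isSymbol_sincSymbol ht).hasTemperateGrowth φ⟩

/-- Bounds for the wave propagators on modulation spaces, uniform for times in `[-1, 1]`. -/
theorem exists_modNorm_propagator_le (hd : 1 ≤ d) {g : 𝓢(Eucl d, ℂ)} (hg : g ≠ 0) {p : ℝ≥0∞}
    (hp : 1 ≤ p) (s : ℝ) :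
    ∃ C : ℝ≥0∞, C < ∞ ∧ ∀ t t' : ℝ, |t| ≤ 1 → |t'| ≤ 1 → ∀ f : 𝓢'(Eucl d, ℂ),
      modNorm g p 1 s (cosProp t f) ≤ C * modNorm g p 1 s f ∧
      modNorm g p 1 s (sinProp t f) ≤ C * modNorm g p 1 (s - 1) f ∧
      modNorm g p 1 s (cosProp t f - cosProp t' f)
        ≤ C * ENNReal.ofReal |t - t'| * modNorm g p 1 (s + 1) f ∧
      modNorm g p 1 s (sinProp t f - sinProp t' f)
        ≤ C * ENNReal.ofReal |t - t'| * modNorm g p 1 s f := by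
  obtain ⟨C₁, hC₁, h₁⟩ := exists_modNorm_multiplier_le hd hg hp s 0
  obtain ⟨C₂, hC₂, h₂⟩ := exists_modNorm_multiplier_le hd hg hp s (-1)
  obtain ⟨C₃, hC₃, h₃⟩ := exists_modNorm_multiplier_le hd hg hp s 1
  set E := Real.exp (4 * Real.pi) with hE
  have hE0 : 0 < E := Real.exp_pos _
  have hpi := Real.pi_pos
  set D : ℝ≥0∞ := ENNReal.ofReal (E * (2 * Real.pi)) with hD
  have hD1 : ENNReal.ofReal E ≤ D := ENNReal.ofReal_le_ofReal (by nlinarith [Real.pi_gt_three])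
  have hD2 : ENNReal.ofReal (2 * E) ≤ D :=
    ENNReal.ofReal_le_ofReal (by nlinarith [Real.pi_gt_three])
  have hle : ∀ {A A' B : ℝ≥0∞} , A ≤ C₁ + C₂ + C₃ → A' ≤ D → A * A' * B ≤ (C₁ + C₂ + C₃) * D * B :=
    fun hA hA' => mul_le_mul_left (mul_le_mul' hA hA') _
  refine ⟨(C₁ + C₂ + C₃) * D, ENNReal.mul_lt_top (ENNReal.add_lt_top.mpr
    ⟨ENNReal.add_lt_top.mpr ⟨hC₁, hC₂⟩, hC₃⟩) ENNReal.ofReal_lt_top, fun t t' ht ht' f => ?_⟩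
  have i1 : C₁ ≤ C₁ + C₂ + C₃ := by rw [add_assoc]; exact le_self_add
  have i2 : C₂ ≤ C₁ + C₂ + C₃ := le_add_right le_add_self
  have i3 : C₃ ≤ C₁ + C₂ + C₃ := le_add_self
  refine ⟨?_, ?_, ?_, ?_⟩
  · rw [cosProp_eq]
    refine (h₁ _ _ (isSymbol_cosSymbol ht) f).trans ?_
    rw [add_zero]
    exact hle i1 hD1
  · rw [sinProp_eq]
    exact (h₂ _ _ (isSymbol_sincSymbol ht) f).trans (hle i2 hD2)
  · rw [cosProp_eq, cosProp_eq, fourierMultiplierCLM_sub_apply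
      (isSymbol_cosSymbol ht).hasTemperateGrowth (isSymbol_cosSymbol ht').hasTemperateGrowth]
    refine (h₃ _ _ (isSymbol_cosSymbol_sub ht ht') f).trans ?_
    rw [ENNReal.ofReal_mul (by positivity), ← mul_assoc]
    exact mul_le_mul_left (hle i3 le_rfl) _
  · rw [sinProp_eq, sinProp_eq, fourierMultiplierCLM_sub_apply
      (isSymbol_sincSymbol ht).hasTemperateGrowth (isSymbol_sincSymbol ht').hasTemperateGrowth]
    refine (h₁ _ _ (isSymbol_sincSymbol_sub ht ht') f).trans ?_
    rw [ENNReal.ofReal_mul hE0.le, ← mul_assoc, add_zero]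
    exact mul_le_mul_left (hle i1 hD1) _

end Propagators

end ModulationNLW
end

noncomputable section

namespace ModulationNLW

open SchwartzMap FourierTransform BoundedContinuousFunction

variable {d : ℕ}

/-! ### Linear structure of the modulation space. -/

section ModSpace

variable {g : 𝓢(Eucl d, ℂ)} {p : ℝ≥0∞} {s : ℝ}

theorem modNorm_sub_le_add (hp : 1 ≤ p) (f h k : 𝓢'(Eucl d, ℂ)) :
    modNorm g p 1 s (f - k) ≤ modNorm g p 1 s (f - h) + modNorm g p 1 s (h - k) := by
  rw [← sub_add_sub_cancel f h k]
  exact modNorm_add_le g hp s _ _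

theorem modNorm_le_add_modNorm_sub (hp : 1 ≤ p) (f h : 𝓢'(Eucl d, ℂ)) :
    modNorm g p 1 s f ≤ modNorm g p 1 s (f - h) + modNorm g p 1 s h := by
  simpa using modNorm_add_le g hp s (f - h) h

/-- The modulation space is closed under limits in the modulation norm. -/
theorem mem_modSpace_of_approx (hp : 1 ≤ p) {f : 𝓢'(Eucl d, ℂ)}
    (h : ∀ ε : ℝ≥0∞, 0 < ε → ∃ k ∈ modSpace g p 1 s, modNorm g p 1 s (f - k) < ε) :
    f ∈ modSpace g p 1 s := by
  constructor
  · obtain ⟨k, hk, hfk⟩ := h 1 one_pos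
    exact (modNorm_le_add_modNorm_sub hp f k).trans_lt
      (ENNReal.add_lt_top.mpr ⟨hfk.trans ENNReal.one_lt_top, hk.1⟩)
  · intro ε hε
    have hε2 : 0 < ε / 2 := ENNReal.half_pos hε.ne'
    obtain ⟨k, hk, hfk⟩ := h _ hε2
    obtain ⟨φ, hφ⟩ := hk.2 _ hε2
    refine ⟨φ, (modNorm_sub_le_add hp f k _).trans_lt ?_⟩
    calc _ < ε / 2 + ε / 2 := ENNReal.add_lt_add hfk hφ
      _ = ε := ENNReal.add_halves ε

theorem coe_mem_modSpace (g : 𝓢(Eucl d, ℂ)) (hp : 1 ≤ p) (s : ℝ) (φ : 𝓢(Eucl d, ℂ)) :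
    (φ : 𝓢'(Eucl d, ℂ)) ∈ modSpace g p 1 s :=
  ⟨modNorm_schwartz_lt_top g hp s φ, fun ε hε => ⟨φ, by rwa [sub_self, modNorm_zero]⟩⟩

theorem zero_mem_modSpace (hp : 1 ≤ p) : (0 : 𝓢'(Eucl d, ℂ)) ∈ modSpace g p 1 s := by
  have h := coe_mem_modSpace g hp s 0
  rwa [map_zero] at h

theorem add_mem_modSpace (hp : 1 ≤ p) {f h : 𝓢'(Eucl d, ℂ)} (hf : f ∈ modSpace g p 1 s)
    (hh : h ∈ modSpace g p 1 s) : f + h ∈ modSpace g p 1 s := by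
  refine ⟨(modNorm_add_le g hp s f h).trans_lt (ENNReal.add_lt_top.mpr ⟨hf.1, hh.1⟩),
    fun ε hε => ?_⟩
  have hε2 : 0 < ε / 2 := ENNReal.half_pos hε.ne'
  obtain ⟨φ, hφ⟩ := hf.2 _ hε2
  obtain ⟨ψ, hψ⟩ := hh.2 _ hε2
  refine ⟨φ + ψ, ?_⟩
  rw [map_add, add_sub_add_comm]
  calc _ ≤ _ := modNorm_add_le g hp s _ _
    _ < ε / 2 + ε / 2 := ENNReal.add_lt_add hφ hψ
    _ = ε := ENNReal.add_halves ε

theorem smul_mem_modSpace (hp : 1 ≤ p) (c : ℂ) {f : 𝓢'(Eucl d, ℂ)}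
    (hf : f ∈ modSpace g p 1 s) : c • f ∈ modSpace g p 1 s := by
  refine mem_modSpace_of_approx hp fun ε hε => ?_
  by_cases hc : c = 0
  · refine ⟨0, zero_mem_modSpace hp, ?_⟩
    rw [sub_zero, modNorm_smul, hc, enorm_zero, zero_mul]
    exact hε
  have hc' : ‖c‖ₑ ≠ 0 := by simpa using hc
  obtain ⟨φ, hφ⟩ := hf.2 (ε / ‖c‖ₑ) (ENNReal.div_pos hε.ne' enorm_ne_top)
  refine ⟨(c • φ : 𝓢(Eucl d, ℂ)), coe_mem_modSpace g hp s _, ?_⟩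
  have : (c • f - ((c • φ : 𝓢(Eucl d, ℂ)) : 𝓢'(Eucl d, ℂ))) = c • (f - (φ : 𝓢'(Eucl d, ℂ))) := by
    rw [map_smul, smul_sub]
  rw [this, modNorm_smul, mul_comm]
  exact (ENNReal.lt_div_iff_mul_lt (Or.inl hc') (Or.inl enorm_ne_top)).mp hφ

theorem neg_mem_modSpace (hp : 1 ≤ p) {f : 𝓢'(Eucl d, ℂ)} (hf : f ∈ modSpace g p 1 s) :
    -f ∈ modSpace g p 1 s := by
  have h0 : (-1 : ℂ) • f = -f := neg_one_smul ℂ f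
  exact h0 ▸ smul_mem_modSpace hp (-1) hf

theorem sub_mem_modSpace (hp : 1 ≤ p) {f h : 𝓢'(Eucl d, ℂ)} (hf : f ∈ modSpace g p 1 s)
    (hh : h ∈ modSpace g p 1 s) : f - h ∈ modSpace g p 1 s :=
  sub_eq_add_neg f h ▸ add_mem_modSpace hp hf (neg_mem_modSpace hp hh)

theorem exists_seq_of_mem_modSpace {f : 𝓢'(Eucl d, ℂ)} (hf : f ∈ modSpace g p 1 s) :
    ∃ φ : ℕ → 𝓢(Eucl d, ℂ),
      Tendsto (fun n => modNorm g p 1 s (f - (φ n : 𝓢'(Eucl d, ℂ)))) atTop (𝓝 0) := by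
  have hpos : ∀ n : ℕ, (0 : ℝ≥0∞) < ((n : ℝ≥0∞))⁻¹ := fun n => by simp
  choose φ hφ using fun n : ℕ => hf.2 _ (hpos n)
  exact ⟨φ, tendsto_of_tendsto_of_tendsto_of_le_of_le tendsto_const_nhds
    ENNReal.tendsto_inv_nat_nhds_zero (fun _ => zero_le) fun n => (hφ n).le⟩

end ModSpace

/-! ### Bounded continuous functions as tempered distributions. -/

section Distr

theorem memLp_top_bcf (f : Eucl d →ᵇ ℂ) : MemLp f ∞ (volume : Measure (Eucl d)) :=
  memLp_top_of_bound f.continuous.aestronglyMeasurable ‖f‖ (ae_of_all _ f.norm_coe_le_norm)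

/-- The tempered distribution given by a bounded continuous function. -/
def distr : (Eucl d →ᵇ ℂ) →ₗ[ℂ] 𝓢'(Eucl d, ℂ) where
  toFun f := Lp.toTemperedDistribution ((memLp_top_bcf f).toLp f)
  map_add' f h := by
    have := map_add (Lp.toTemperedDistributionCLM ℂ (volume : Measure (Eucl d)) ∞)
      ((memLp_top_bcf f).toLp f) ((memLp_top_bcf h).toLp h)
    exact this
  map_smul' c f := by
    have := map_smul (Lp.toTemperedDistributionCLM ℂ (volume : Measure (Eucl d)) ∞) c
      ((memLp_top_bcf f).toLp f)
    exact this

theorem distr_eq (f : Eucl d →ᵇ ℂ) :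
    distr f = Lp.toTemperedDistribution ((memLp_top_bcf f).toLp f) := rfl

theorem distr_apply (f : Eucl d →ᵇ ℂ) (φ : 𝓢(Eucl d, ℂ)) : distr f φ = ∫ x, φ x * f x := by
  rw [distr_eq, Lp.toTemperedDistribution_apply]
  refine integral_congr_ae ?_
  filter_upwards [(memLp_top_bcf f).coeFn_toLp] with x hx
  rw [hx, smul_eq_mul]

theorem distr_toBoundedContinuousFunction (φ : 𝓢(Eucl d, ℂ)) :
    distr φ.toBoundedContinuousFunction = (φ : 𝓢'(Eucl d, ℂ)) := by
  ext ψ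
  rw [distr_apply, SchwartzMap.coe_apply]
  rfl

theorem distr_injective : Function.Injective (distr : (Eucl d →ᵇ ℂ) → 𝓢'(Eucl d, ℂ)) := by
  intro f h hfh
  have hinj := LinearMap.ker_eq_bot.mp
    (Lp.ker_toTemperedDistributionCLM_eq_bot (F := ℂ) (μ := (volume : Measure (Eucl d)))
      (p := ∞))
  have h1 : (memLp_top_bcf f).toLp f = (memLp_top_bcf h).toLp h := hinj hfh
  rw [MemLp.toLp_eq_toLp_iff] at h1
  exact DFunLike.coe_injective ((Continuous.ae_eq_iff_eq _ f.continuous h.continuous).mp h1)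

theorem tendsto_distr_apply {f : ℕ → Eucl d →ᵇ ℂ} {f₀ : Eucl d →ᵇ ℂ}
    (h : Tendsto f atTop (𝓝 f₀)) (φ : 𝓢(Eucl d, ℂ)) :
    Tendsto (fun n => distr (f n) φ) atTop (𝓝 (distr f₀ φ)) := by
  have hle : ∀ k : Eucl d →ᵇ ℂ, ‖distr k φ‖ ≤ ‖k‖ * ∫ x, ‖φ x‖ := by
    intro k
    rw [distr_apply, ← integral_const_mul]
    refine norm_integral_le_of_norm_le (φ.integrable.norm.const_mul _) (ae_of_all _ fun x => ?_)
    rw [norm_mul, mul_comm]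
    exact mul_le_mul_of_nonneg_right (k.norm_coe_le_norm x) (norm_nonneg _)
  rw [tendsto_iff_norm_sub_tendsto_zero] at h ⊢
  refine squeeze_zero (fun _ => norm_nonneg _) (fun n => ?_)
    (by simpa using h.mul_const (∫ x, ‖φ x‖))
  have := hle (f n - f₀)
  rwa [map_sub] at this

theorem tendsto_apply_of_modNorm {g : 𝓢(Eucl d, ℂ)} (hg : g ≠ 0) {p : ℝ≥0∞} (hp : 1 ≤ p) {s : ℝ}
    {f : ℕ → 𝓢'(Eucl d, ℂ)} {f₀ : 𝓢'(Eucl d, ℂ)}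
    (h : Tendsto (fun n => modNorm g p 1 s (f₀ - f n)) atTop (𝓝 0)) (φ : 𝓢(Eucl d, ℂ)) :
    Tendsto (fun n => f n φ) atTop (𝓝 (f₀ φ)) := by
  obtain ⟨C, hC, hle⟩ := exists_enorm_apply_le_modNorm hg hp s φ
  rw [tendsto_iff_edist_tendsto_0]
  have h1 : Tendsto (fun n => C * modNorm g p 1 s (f₀ - f n)) atTop (𝓝 0) := by
    simpa using ENNReal.Tendsto.const_mul h (Or.inr hC.ne)
  refine tendsto_of_tendsto_of_tendsto_of_le_of_le tendsto_const_nhds h1 (fun _ => zero_le)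
    fun n => ?_
  rw [edist_comm, edist_eq_enorm_sub]
  exact hle (f₀ - f n)

/-- Bounds of Schwartz functions by the modulation norm, in terms of the supremum norm. -/
theorem exists_norm_toBCF_le {g : 𝓢(Eucl d, ℂ)} (hg : g ≠ 0) {p : ℝ≥0∞} (hp : 1 ≤ p) {s : ℝ}
    (hs : 0 ≤ s) : ∃ C : ℝ, 0 ≤ C ∧ ∀ φ : 𝓢(Eucl d, ℂ),
      ‖φ.toBoundedContinuousFunction‖ ≤ C * (modNorm g p 1 s (φ : 𝓢'(Eucl d, ℂ))).toReal := by
  obtain ⟨C, hC, h⟩ := exists_enorm_schwartz_apply_le_modNorm hg hp hs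
  refine ⟨C.toReal, ENNReal.toReal_nonneg, fun φ => ?_⟩
  rw [BoundedContinuousFunction.norm_le (by positivity)]
  intro x
  rw [← ENNReal.toReal_mul, ← toReal_enorm]
  exact ENNReal.toReal_mono (ENNReal.mul_lt_top hC (modNorm_schwartz_lt_top g hp s φ)).ne (h φ x)

/-- The embedding estimate makes the Schwartz approximants uniformly Cauchy. Their uniform limit and
`u` agree because both are the limit of the same pairings. -/
theorem exists_bcf_limit {g : 𝓢(Eucl d, ℂ)} (hg : g ≠ 0) {p : ℝ≥0∞} (hp : 1 ≤ p) {s : ℝ}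
    (hs : 0 ≤ s) {u : 𝓢'(Eucl d, ℂ)} (hu : u ∈ modSpace g p 1 s) {φ : ℕ → 𝓢(Eucl d, ℂ)}
    (hφ : Tendsto (fun n => modNorm g p 1 s (u - (φ n : 𝓢'(Eucl d, ℂ)))) atTop (𝓝 0)) :
    ∃ f : Eucl d →ᵇ ℂ, distr f = u ∧
      Tendsto (fun n => (φ n).toBoundedContinuousFunction) atTop (𝓝 f) := by
  obtain ⟨C, hC, h⟩ := exists_norm_toBCF_le hg hp hs
  have hlt : ∀ n, modNorm g p 1 s (u - (φ n : 𝓢'(Eucl d, ℂ))) ≠ ∞ := fun n =>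
    (sub_mem_modSpace hp hu (coe_mem_modSpace g hp s (φ n))).1.ne
  have hφr : Tendsto (fun n => (modNorm g p 1 s (u - (φ n : 𝓢'(Eucl d, ℂ)))).toReal) atTop
      (𝓝 0) := by
    have h1 := (ENNReal.tendsto_toReal ENNReal.zero_ne_top).comp hφ
    rw [ENNReal.toReal_zero] at h1
    exact h1
  have hcau : CauchySeq fun n => (φ n).toBoundedContinuousFunction := by
    rw [Metric.cauchySeq_iff]
    intro ε hε
    have hε' : 0 < ε / (2 * (C + 1)) := by positivity
    obtain ⟨N, hN⟩ := eventually_atTop.mp (hφr.eventually_lt_const hε')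
    refine ⟨N, fun m hm n hn => ?_⟩
    have h1 := h (φ m - φ n)
    have h2 : (φ m - φ n).toBoundedContinuousFunction
        = (φ m).toBoundedContinuousFunction - (φ n).toBoundedContinuousFunction := rfl
    have h3 : (modNorm g p 1 s ((φ m - φ n : 𝓢(Eucl d, ℂ)) : 𝓢'(Eucl d, ℂ))).toReal
        ≤ (modNorm g p 1 s (u - (φ m : 𝓢'(Eucl d, ℂ)))).toReal
          + (modNorm g p 1 s (u - (φ n : 𝓢'(Eucl d, ℂ)))).toReal := by
      rw [← ENNReal.toReal_add (hlt m) (hlt n), map_sub]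
      refine ENNReal.toReal_mono (ENNReal.add_ne_top.mpr ⟨hlt m, hlt n⟩) ?_
      rw [modNorm_sub_comm g p s u (φ m)]
      exact modNorm_sub_le_add hp _ _ _
    rw [h2] at h1
    rw [dist_eq_norm]
    refine h1.trans_lt ?_
    have h4 := hN m hm
    have h5 := hN n hn
    have h6 : ε / (2 * (C + 1)) * (2 * (C + 1)) = ε := div_mul_cancel₀ _ (by positivity)
    nlinarith
  obtain ⟨f, hf⟩ := cauchySeq_tendsto_of_complete hcau
  refine ⟨f, ?_, hf⟩
  ext ψ
  refine tendsto_nhds_unique (tendsto_distr_apply hf ψ) ?_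
  simp_rw [distr_toBoundedContinuousFunction]
  exact tendsto_apply_of_modNorm hg hp hφ ψ

end Distr

/-! ### The modulation space as a Banach space of functions. -/

section ModFun

set_option linter.unusedSectionVars false

variable (g : 𝓢(Eucl d, ℂ)) (p : ℝ≥0∞) (s : ℝ)

/-- The bounded continuous functions in the modulation space, as a subspace. -/
def modSubmodule [hp : Fact (1 ≤ p)] : Submodule ℂ (Eucl d →ᵇ ℂ) where
  carrier := {f | distr f ∈ modSpace g p 1 s}
  add_mem' {f h} hf hh := by
    simp only [mem_ofPred_eq] at hf hh ⊢
    rw [map_add]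
    exact add_mem_modSpace hp.out hf hh
  zero_mem' := by
    simp only [mem_ofPred_eq, map_zero]
    exact zero_mem_modSpace hp.out
  smul_mem' c f hf := by
    simp only [mem_ofPred_eq] at hf ⊢
    rw [map_smul]
    exact smul_mem_modSpace hp.out c hf

/-- For `s ≥ 0` the modulation space `M^{p,1}_s`, realised as a space of bounded continuous functions
with the modulation norm. -/
def ModFun [Fact (1 ≤ p)] : Type := modSubmodule g p s

variable [hp : Fact (1 ≤ p)]

instance : AddCommGroup (ModFun g p s) := inferInstanceAs (AddCommGroup (modSubmodule g p s))

instance : Module ℂ (ModFun g p s) := inferInstanceAs (Module ℂ (modSubmodule g p s))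

variable {g p s}

/-- The underlying bounded continuous function. -/
def ModFun.toBCF : ModFun g p s →ₗ[ℂ] (Eucl d →ᵇ ℂ) := (modSubmodule g p s).subtype

/-- The underlying tempered distribution. -/
def ModFun.toDistr : ModFun g p s →ₗ[ℂ] 𝓢'(Eucl d, ℂ) := distr ∘ₗ ModFun.toBCF

theorem ModFun.toBCF_injective : Function.Injective (ModFun.toBCF : ModFun g p s → Eucl d →ᵇ ℂ) :=
  Subtype.val_injective

theorem ModFun.toDistr_injective :
    Function.Injective (ModFun.toDistr : ModFun g p s → 𝓢'(Eucl d, ℂ)) :=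
  distr_injective.comp ModFun.toBCF_injective

theorem ModFun.toDistr_mem (f : ModFun g p s) : f.toDistr ∈ modSpace g p 1 s := f.2

/-- The element of `ModFun` given by a function whose distribution lies in the modulation space. -/
def ModFun.mk (f : Eucl d →ᵇ ℂ) (hf : distr f ∈ modSpace g p 1 s) : ModFun g p s := ⟨f, hf⟩

@[simp]
theorem ModFun.toBCF_mk (f : Eucl d →ᵇ ℂ) (hf : distr f ∈ modSpace g p 1 s) :
    (ModFun.mk f hf).toBCF = f := rfl

instance : Norm (ModFun g p s) := ⟨fun f => (modNorm g p 1 s f.toDistr).toReal⟩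

theorem ModFun.norm_def (f : ModFun g p s) : ‖f‖ = (modNorm g p 1 s f.toDistr).toReal := rfl

theorem ModFun.ofReal_norm (f : ModFun g p s) :
    ENNReal.ofReal ‖f‖ = modNorm g p 1 s f.toDistr :=
  ENNReal.ofReal_toReal f.toDistr_mem.1.ne

variable [hg : Fact (g ≠ 0)]

/-- Definiteness comes from the fact that the modulation norm controls every pairing with a Schwartz
function. -/
theorem ModFun.core : NormedSpace.Core ℂ (ModFun g p s) where
  norm_nonneg f := ENNReal.toReal_nonneg
  norm_smul c f := by
    rw [ModFun.norm_def, map_smul, modNorm_smul, ENNReal.toReal_mul, toReal_enorm,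
      ModFun.norm_def]
  norm_triangle f h := by
    rw [ModFun.norm_def, ModFun.norm_def, ModFun.norm_def,
      ← ENNReal.toReal_add f.toDistr_mem.1.ne h.toDistr_mem.1.ne, map_add]
    exact ENNReal.toReal_mono (ENNReal.add_ne_top.mpr ⟨f.toDistr_mem.1.ne, h.toDistr_mem.1.ne⟩)
      (modNorm_add_le g hp.out s _ _)
  norm_eq_zero_iff f := by
    constructor
    · intro h
      have h0 : modNorm g p 1 s f.toDistr = 0 := by
        rw [← ModFun.ofReal_norm, h, ENNReal.ofReal_zero]
      refine ModFun.toDistr_injective ?_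
      rw [map_zero]
      ext φ
      obtain ⟨C, hC, hle⟩ := exists_enorm_apply_le_modNorm hg.out hp.out s φ
      have := hle f.toDistr
      rw [h0, mul_zero, nonpos_iff_eq_zero, enorm_eq_zero] at this
      exact this
    · rintro rfl
      rw [ModFun.norm_def, map_zero, modNorm_zero, ENNReal.toReal_zero]

instance : NormedAddCommGroup (ModFun g p s) := NormedAddCommGroup.ofCore ModFun.core

instance : NormedSpace ℂ (ModFun g p s) := NormedSpace.ofCore ModFun.core

theorem ModFun.norm_le_of_modNorm_le {f : ModFun g p s} {B : ℝ≥0∞} (hB : B ≠ ∞)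
    (h : modNorm g p 1 s f.toDistr ≤ B) : ‖f‖ ≤ B.toReal := ENNReal.toReal_mono hB h

/-- Schwartz functions as elements of `ModFun`. -/
def ModFun.ofSchwartz (φ : 𝓢(Eucl d, ℂ)) : ModFun g p s :=
  ModFun.mk φ.toBoundedContinuousFunction
    (distr_toBoundedContinuousFunction φ ▸ coe_mem_modSpace g hp.out s φ)

theorem ModFun.toDistr_ofSchwartz (φ : 𝓢(Eucl d, ℂ)) :
    (ModFun.ofSchwartz φ : ModFun g p s).toDistr = (φ : 𝓢'(Eucl d, ℂ)) :=
  distr_toBoundedContinuousFunction φ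

theorem ModFun.toBCF_ofSchwartz (φ : 𝓢(Eucl d, ℂ)) :
    (ModFun.ofSchwartz φ : ModFun g p s).toBCF = φ.toBoundedContinuousFunction := rfl

theorem ModFun.exists_seq (f : ModFun g p s) :
    ∃ φ : ℕ → 𝓢(Eucl d, ℂ),
      Tendsto (fun n => (ModFun.ofSchwartz (φ n) : ModFun g p s)) atTop (𝓝 f) := by
  obtain ⟨φ, hφ⟩ := exists_seq_of_mem_modSpace f.toDistr_mem
  refine ⟨φ, ?_⟩
  rw [tendsto_iff_norm_sub_tendsto_zero]
  have h := (ENNReal.tendsto_toReal ENNReal.zero_ne_top).comp hφ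
  rw [ENNReal.toReal_zero] at h
  refine h.congr fun n => ?_
  rw [norm_sub_rev, ModFun.norm_def, map_sub, ModFun.toDistr_ofSchwartz]
  rfl

variable [hs : Fact (0 ≤ s)]

theorem ModFun.exists_toDistr_eq {u : 𝓢'(Eucl d, ℂ)} (hu : u ∈ modSpace g p 1 s) :
    ∃ f : ModFun g p s, f.toDistr = u := by
  obtain ⟨φ, hφ⟩ := exists_seq_of_mem_modSpace hu
  obtain ⟨f, hf, -⟩ := exists_bcf_limit hg.out hp.out hs.out hu hφ
  exact ⟨ModFun.mk f (hf ▸ hu), hf⟩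

variable (g p s) in
theorem ModFun.exists_norm_toBCF_le : ∃ C : ℝ, 0 ≤ C ∧ ∀ f : ModFun g p s, ‖f.toBCF‖ ≤ C * ‖f‖ := by
  obtain ⟨C, hC, h⟩ := ModulationNLW.exists_norm_toBCF_le hg.out hp.out hs.out (g := g) (p := p)
  refine ⟨C, hC, fun f => ?_⟩
  obtain ⟨φ, hφ⟩ := exists_seq_of_mem_modSpace f.toDistr_mem
  obtain ⟨f', hf', hlim⟩ := exists_bcf_limit hg.out hp.out hs.out f.toDistr_mem hφ
  have hff : f' = f.toBCF := distr_injective hf'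
  have hn : Tendsto (fun n => C * ‖(ModFun.ofSchwartz (φ n) : ModFun g p s)‖) atTop
      (𝓝 (C * ‖f‖)) := by
    refine Tendsto.const_mul C (Tendsto.norm ?_)
    rw [tendsto_iff_norm_sub_tendsto_zero]
    have h := (ENNReal.tendsto_toReal ENNReal.zero_ne_top).comp hφ
    rw [ENNReal.toReal_zero] at h
    refine h.congr fun n => ?_
    rw [norm_sub_rev, ModFun.norm_def, map_sub, ModFun.toDistr_ofSchwartz]
    rfl
  rw [← hff]
  refine le_of_tendsto_of_tendsto' hlim.norm hn fun n => ?_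
  rw [ModFun.norm_def, ModFun.toDistr_ofSchwartz]
  exact h (φ n)

/-- The inclusion of the modulation space into the bounded continuous functions. -/
def ModFun.toBCFL : ModFun g p s →L[ℂ] (Eucl d →ᵇ ℂ) :=
  LinearMap.mkContinuousOfExistsBound
    { toFun := fun f => f.toBCF
      map_add' := fun f h => map_add _ f h
      map_smul' := fun c f => map_smul _ c f }
    ((ModFun.exists_norm_toBCF_le g p s).imp fun _ h => h.2)

/-- The evaluation at a point. -/
def ModFun.evalL (x : Eucl d) : ModFun g p s →L[ℂ] ℂ :=
  (BoundedContinuousFunction.evalCLM ℂ x).comp ModFun.toBCFL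

@[simp]
theorem ModFun.evalL_apply (x : Eucl d) (f : ModFun g p s) : ModFun.evalL x f = f.toBCF x := rfl

/-- The pairing with a Schwartz function. -/
def ModFun.pairL (φ : 𝓢(Eucl d, ℂ)) : ModFun g p s →L[ℂ] ℂ :=
  LinearMap.mkContinuousOfExistsBound
    { toFun := fun f => f.toDistr φ
      map_add' := fun f h => by rw [map_add]; rfl
      map_smul' := fun c f => by rw [map_smul]; rfl } (by
    obtain ⟨C, hC, hle⟩ := exists_enorm_apply_le_modNorm hg.out hp.out s φ
    refine ⟨C.toReal, fun f => ?_⟩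
    rw [ModFun.norm_def, ← ENNReal.toReal_mul, ← toReal_enorm]
    exact ENNReal.toReal_mono (ENNReal.mul_lt_top hC f.toDistr_mem.1).ne (hle _))

@[simp]
theorem ModFun.pairL_apply (φ : 𝓢(Eucl d, ℂ)) (f : ModFun g p s) :
    ModFun.pairL φ f = f.toDistr φ := rfl

theorem ModFun.eq_of_pairL_eq {f h : ModFun g p s}
    (H : ∀ φ : 𝓢(Eucl d, ℂ), ModFun.pairL φ f = ModFun.pairL φ h) : f = h := by
  refine ModFun.toDistr_injective ?_
  ext φ
  exact H φ

/-- A Cauchy sequence converges uniformly, and lower semicontinuity of the modulation norm under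
weak convergence upgrades this to convergence in norm; the limit is in the space because the latter
is closed. -/
instance : CompleteSpace (ModFun g p s) := by
  refine Metric.complete_of_cauchySeq_tendsto fun f hf => ?_
  have hb : CauchySeq fun n => (f n).toBCF :=
    (ModFun.toBCFL (g := g) (p := p) (s := s)).uniformContinuous.comp_cauchySeq hf
  obtain ⟨f₀, hf₀⟩ := cauchySeq_tendsto_of_complete hb
  have key : ∀ ε : ℝ≥0∞, 0 < ε → ∃ N, ∀ n ≥ N, modNorm g p 1 s (distr f₀ - (f n).toDistr) ≤ ε := by
    intro ε hε
    obtain ⟨δ, hδ0, hδ⟩ : ∃ δ : ℝ, 0 < δ ∧ ENNReal.ofReal δ ≤ ε := by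
      rcases eq_or_ne ε ∞ with rfl | h
      · exact ⟨1, one_pos, le_top⟩
      · exact ⟨ε.toReal, ENNReal.toReal_pos hε.ne' h, ENNReal.ofReal_toReal_le⟩
    obtain ⟨N, hN⟩ := Metric.cauchySeq_iff.mp hf δ hδ0
    refine ⟨N, fun n hn => ?_⟩
    -- The index `n` is fixed while `m` tends to infinity.
    refine modNorm_le_of_tendsto (f := fun m => (f m).toDistr - (f n).toDistr) g p s
      (fun ψ => ?_) (eventually_atTop.mpr ⟨N, fun m hm => ?_⟩)
    · have := tendsto_distr_apply hf₀ ψ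
      exact this.sub_const _
    · rw [← map_sub, ← ModFun.ofReal_norm]
      refine (ENNReal.ofReal_le_ofReal ?_).trans hδ
      rw [← dist_eq_norm]
      exact (hN m hm n hn).le
  have hmem : distr f₀ ∈ modSpace g p 1 s := by
    refine mem_modSpace_of_approx hp.out fun ε hε => ?_
    rcases eq_or_ne ε ∞ with rfl | h
    · obtain ⟨N, hN⟩ := key 1 one_pos
      exact ⟨_, (f N).toDistr_mem, (hN N le_rfl).trans_lt ENNReal.one_lt_top⟩
    · obtain ⟨N, hN⟩ := key (ε / 2) (ENNReal.half_pos hε.ne')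
      exact ⟨_, (f N).toDistr_mem, (hN N le_rfl).trans_lt (ENNReal.half_lt_self hε.ne' h)⟩
  refine ⟨ModFun.mk f₀ hmem, Metric.tendsto_atTop.mpr fun ε hε => ?_⟩
  obtain ⟨N, hN⟩ := key (ENNReal.ofReal (ε / 2)) (by simpa using hε)
  refine ⟨N, fun n hn => ?_⟩
  rw [dist_comm, dist_eq_norm]
  refine lt_of_le_of_lt (ModFun.norm_le_of_modNorm_le ENNReal.ofReal_ne_top
    (B := ENNReal.ofReal (ε / 2)) ?_) ?_
  · rw [map_sub]
    exact hN n hn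
  · rw [ENNReal.toReal_ofReal (by linarith)]
    linarith

end ModFun

end ModulationNLW
end

noncomputable section

namespace ModulationNLW

open SchwartzMap FourierTransform BoundedContinuousFunction

variable {d : ℕ}

set_option linter.unusedSectionVars false

/-! ### Multiplication and conjugation on the modulation space. -/

section Algebra

theorem stft_conjS_coe (g φ : 𝓢(Eucl d, ℂ)) (x ξ : Eucl d) :
    stft g (conjS φ : 𝓢'(Eucl d, ℂ)) x ξ
      = conj (stft (conjS g) (φ : 𝓢'(Eucl d, ℂ)) x (-ξ)) := by
  rw [stft_coe, stft_coe, ← integral_conj]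
  refine integral_congr_ae (ae_of_all _ fun y => ?_)
  simp only [map_mul, conj_chr, neg_neg, conjS_apply, Complex.conj_conj]

/-- Conjugation reflects the frequency and conjugates the window; the weight is even. -/
theorem modNorm_conjS (g φ : 𝓢(Eucl d, ℂ)) (p : ℝ≥0∞) (s : ℝ) :
    modNorm g p 1 s (conjS φ : 𝓢'(Eucl d, ℂ))
      = modNorm (conjS g) p 1 s (φ : 𝓢'(Eucl d, ℂ)) := by
  rw [modNorm_eq_lintegral, modNorm_eq_lintegral, ← lintegral_neg_eq_self]
  refine lintegral_congr fun ξ => ?_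
  rw [ejap_neg, freqNorm, freqNorm]
  congr 2
  funext x
  rw [stft_conjS_coe, neg_neg, RCLike.enorm_conj]

variable {g : 𝓢(Eucl d, ℂ)} {p : ℝ≥0∞} {s : ℝ} [hp : Fact (1 ≤ p)] [hg : Fact (g ≠ 0)]
  [hs : Fact (0 ≤ s)]

theorem ModFun.ofSchwartz_sub (φ ψ : 𝓢(Eucl d, ℂ)) :
    (ModFun.ofSchwartz (φ - ψ) : ModFun g p s) = ModFun.ofSchwartz φ - ModFun.ofSchwartz ψ := rfl

theorem ModFun.norm_ofSchwartz (φ : 𝓢(Eucl d, ℂ)) :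
    ‖(ModFun.ofSchwartz φ : ModFun g p s)‖
      = (modNorm g p 1 s (φ : 𝓢'(Eucl d, ℂ))).toReal := by
  rw [ModFun.norm_def, ModFun.toDistr_ofSchwartz]

theorem ModFun.tendsto_eval {f : ℕ → ModFun g p s} {f₀ : ModFun g p s}
    (h : Tendsto f atTop (𝓝 f₀)) (x : Eucl d) :
    Tendsto (fun n => (f n).toBCF x) atTop (𝓝 (f₀.toBCF x)) :=
  ((ModFun.evalL (g := g) (p := p) (s := s) x).continuous.tendsto f₀).comp h

variable (g p s) in
-- Extension of the Schwartz product estimate by density: products of approximants are Cauchy by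
-- bilinearity, and the limit is the pointwise product because point evaluations are continuous.
theorem ModFun.exists_mul : ∃ C : ℝ, 0 ≤ C ∧ ∀ f h : ModFun g p s,
    ∃ k : ModFun g p s, k.toBCF = f.toBCF * h.toBCF ∧ ‖k‖ ≤ C * ‖f‖ * ‖h‖ := by
  obtain ⟨C, hC, hle⟩ := exists_modNorm_mulS_le hg.out hp.out hs.out
  have hS : ∀ φ ψ : 𝓢(Eucl d, ℂ), ‖(ModFun.ofSchwartz (mulS φ ψ) : ModFun g p s)‖
      ≤ C.toReal * ‖(ModFun.ofSchwartz φ : ModFun g p s)‖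
        * ‖(ModFun.ofSchwartz ψ : ModFun g p s)‖ := by
    intro φ ψ
    rw [ModFun.norm_ofSchwartz, ModFun.norm_ofSchwartz, ModFun.norm_ofSchwartz, mul_assoc,
      ← ENNReal.toReal_mul, ← ENNReal.toReal_mul]
    exact ENNReal.toReal_mono (ENNReal.mul_lt_top hC (ENNReal.mul_lt_top
      (modNorm_schwartz_lt_top g hp.out s φ) (modNorm_schwartz_lt_top g hp.out s ψ))).ne (hle φ ψ)
  have hC0 : 0 ≤ C.toReal := ENNReal.toReal_nonneg
  refine ⟨C.toReal, hC0, fun f h => ?_⟩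
  obtain ⟨φ, hφ⟩ := f.exists_seq
  obtain ⟨ψ, hψ⟩ := h.exists_seq
  set a : ℕ → ModFun g p s := fun n => ModFun.ofSchwartz (φ n) with ha
  set b : ℕ → ModFun g p s := fun n => ModFun.ofSchwartz (ψ n) with hb
  set x : ℕ → ModFun g p s := fun n => ModFun.ofSchwartz (mulS (φ n) (ψ n)) with hx
  have hdiff : ∀ n m, ‖x n - x m‖ ≤ C.toReal * ‖a n - a m‖ * ‖b n‖
      + C.toReal * ‖a m‖ * ‖b n - b m‖ := by
    intro n m
    have h1 : mulS (φ n) (ψ n) - mulS (φ m) (ψ m)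
        = mulS (φ n - φ m) (ψ n) + mulS (φ m) (ψ n - ψ m) := by
      ext y
      simp
      ring
    have h2 : x n - x m = ModFun.ofSchwartz (mulS (φ n - φ m) (ψ n))
        + ModFun.ofSchwartz (mulS (φ m) (ψ n - ψ m)) := by
      rw [hx]
      simp only
      rw [← ModFun.ofSchwartz_sub, h1]
      rfl
    rw [h2]
    exact (norm_add_le _ _).trans (add_le_add (hS _ _) (hS _ _))
  obtain ⟨A, hA⟩ := hφ.norm.bddAbove_range
  obtain ⟨B, hB⟩ := hψ.norm.bddAbove_range
  have hA' : ∀ n, ‖a n‖ ≤ A := fun n => hA ⟨n, rfl⟩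
  have hB' : ∀ n, ‖b n‖ ≤ B := fun n => hB ⟨n, rfl⟩
  have hA0 : 0 ≤ A := (norm_nonneg _).trans (hA' 0)
  have hB0 : 0 ≤ B := (norm_nonneg _).trans (hB' 0)
  have hcau : CauchySeq x := by
    have hab : CauchySeq fun n => (a n, b n) := (hφ.prodMk_nhds hψ).cauchySeq
    rw [Metric.cauchySeq_iff] at hab ⊢
    intro ε hε
    obtain ⟨N, hN⟩ := hab (ε / (C.toReal * (A + B) + 1)) (by positivity)
    refine ⟨N, fun n hn m hm => ?_⟩
    have h1 := hN n hn m hm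
    rw [Prod.dist_eq, max_lt_iff, dist_eq_norm, dist_eq_norm] at h1
    simp only at h1
    rw [dist_eq_norm]
    have hD := div_mul_cancel₀ ε (b := C.toReal * (A + B) + 1) (by positivity)
    set δ := ε / (C.toReal * (A + B) + 1)
    have hδ : 0 < δ := by positivity
    calc ‖x n - x m‖ ≤ C.toReal * ‖a n - a m‖ * ‖b n‖ + C.toReal * ‖a m‖ * ‖b n - b m‖ :=
          hdiff n m
      _ ≤ C.toReal * δ * B + C.toReal * A * δ :=
          add_le_add (mul_le_mul (mul_le_mul_of_nonneg_left h1.1.le hC0) (hB' n) (norm_nonneg _)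
            (by positivity)) (mul_le_mul (mul_le_mul_of_nonneg_left (hA' m) hC0) h1.2.le
            (norm_nonneg _) (by positivity))
      _ < ε := by nlinarith
  obtain ⟨k, hk⟩ := cauchySeq_tendsto_of_complete hcau
  refine ⟨k, ?_, ?_⟩
  · ext y
    refine tendsto_nhds_unique (ModFun.tendsto_eval hk y) ?_
    have := (ModFun.tendsto_eval hφ y).mul (ModFun.tendsto_eval hψ y)
    refine this.congr fun n => ?_
    rw [hx, ModFun.toBCF_ofSchwartz, ModFun.toBCF_ofSchwartz, ModFun.toBCF_ofSchwartz]
    simp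
  · exact le_of_tendsto_of_tendsto' hk.norm ((hφ.norm.const_mul _).mul hψ.norm)
      fun n => hS _ _

theorem ModFun.mul_mem (f h : ModFun g p s) : distr (f.toBCF * h.toBCF) ∈ modSpace g p 1 s := by
  obtain ⟨C, -, H⟩ := ModFun.exists_mul g p s
  obtain ⟨k, hk, -⟩ := H f h
  exact hk ▸ k.toDistr_mem

theorem ModFun.exists_norm_mul_le : ∃ C : ℝ, ∀ f h : ModFun g p s,
    ‖ModFun.mk (f.toBCF * h.toBCF) (ModFun.mul_mem f h)‖ ≤ C * ‖f‖ * ‖h‖ := by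
  obtain ⟨C, -, H⟩ := ModFun.exists_mul g p s
  refine ⟨C, fun f h => ?_⟩
  obtain ⟨k, hk, hle⟩ := H f h
  have : ModFun.mk (f.toBCF * h.toBCF) (ModFun.mul_mem f h) = k := ModFun.toBCF_injective hk.symm
  rwa [this]

/-- The pointwise multiplication of the modulation space. -/
def ModFun.mulL : ModFun g p s →L[ℂ] ModFun g p s →L[ℂ] ModFun g p s :=
  LinearMap.mkContinuous₂
    (LinearMap.mk₂ ℂ (fun f h : ModFun g p s => ModFun.mk (f.toBCF * h.toBCF) (ModFun.mul_mem f h))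
      (fun f f' h => ModFun.toBCF_injective (by simp [add_mul]))
      (fun c f h => ModFun.toBCF_injective (by simp))
      (fun f h h' => ModFun.toBCF_injective (by simp [mul_add]))
      (fun c f h => ModFun.toBCF_injective (by simp)))
    ModFun.exists_norm_mul_le.choose ModFun.exists_norm_mul_le.choose_spec

theorem ModFun.evalL_mulL (x : Eucl d) (f h : ModFun g p s) :
    ModFun.evalL x (ModFun.mulL f h) = ModFun.evalL x f * ModFun.evalL x h := rfl

variable (g p s) in
theorem ModFun.exists_star : ∃ C : ℝ, 0 ≤ C ∧ ∀ f : ModFun g p s,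
    ∃ k : ModFun g p s, k.toBCF = star f.toBCF ∧ ‖k‖ ≤ C * ‖f‖ := by
  obtain ⟨C, hC, hle⟩ := exists_modNorm_window_le hg.out (conjS g) hp.out (Or.inl rfl) s
  have hS : ∀ φ : 𝓢(Eucl d, ℂ), ‖(ModFun.ofSchwartz (conjS φ) : ModFun g p s)‖
      ≤ C.toReal * ‖(ModFun.ofSchwartz φ : ModFun g p s)‖ := by
    intro φ
    rw [ModFun.norm_ofSchwartz, ModFun.norm_ofSchwartz, ← ENNReal.toReal_mul, modNorm_conjS]
    exact ENNReal.toReal_mono (ENNReal.mul_lt_top hC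
      (modNorm_schwartz_lt_top g hp.out s φ)).ne (hle φ)
  have hC0 : 0 ≤ C.toReal := ENNReal.toReal_nonneg
  refine ⟨C.toReal, hC0, fun f => ?_⟩
  obtain ⟨φ, hφ⟩ := f.exists_seq
  set x : ℕ → ModFun g p s := fun n => ModFun.ofSchwartz (conjS (φ n)) with hx
  have hcau : CauchySeq x := by
    have ha := hφ.cauchySeq
    rw [Metric.cauchySeq_iff] at ha ⊢
    intro ε hε
    obtain ⟨N, hN⟩ := ha (ε / (C.toReal + 1)) (by positivity)
    refine ⟨N, fun n hn m hm => ?_⟩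
    have h1 := hN n hn m hm
    rw [dist_eq_norm, ← ModFun.ofSchwartz_sub] at h1 ⊢
    have h2 : conjS (φ n) - conjS (φ m) = conjS (φ n - φ m) := by ext y; simp
    rw [h2]
    have hD := div_mul_cancel₀ ε (b := C.toReal + 1) (by positivity)
    have h3 := mul_le_mul_of_nonneg_left h1.le hC0
    have h4 : 0 < ε / (C.toReal + 1) := by positivity
    refine (hS _).trans_lt ?_
    nlinarith
  obtain ⟨k, hk⟩ := cauchySeq_tendsto_of_complete hcau
  refine ⟨k, ?_, ?_⟩
  · ext y
    refine tendsto_nhds_unique (ModFun.tendsto_eval hk y) ?_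
    have := (Complex.continuous_conj.tendsto _).comp (ModFun.tendsto_eval hφ y)
    refine this.congr fun n => ?_
    simp only [hx, ModFun.toBCF_ofSchwartz, Function.comp_apply, toBoundedContinuousFunction_apply,
      conjS_apply]
  · exact le_of_tendsto_of_tendsto' hk.norm (hφ.norm.const_mul _) fun n => hS _

/-- Conjugation is antilinear, so it is kept as a plain map; the power series needs only its
Lipschitz bound, its value at `0` and its point values. -/
theorem ModFun.exists_conj : ∃ σ : ModFun g p s → ModFun g p s,
    (∃ A : ℝ, 0 ≤ A ∧ ∀ f h, ‖σ f - σ h‖ ≤ A * ‖f - h‖) ∧ σ 0 = 0 ∧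
      ∀ x f, ModFun.evalL x (σ f) = conj (ModFun.evalL x f) := by
  obtain ⟨C, hC, H⟩ := ModFun.exists_star g p s
  choose σ hσ hle using H
  refine ⟨σ, ⟨C, hC, fun f h => ?_⟩, ?_, fun x f => ?_⟩
  · have : σ f - σ h = σ (f - h) := ModFun.toBCF_injective (by
      rw [map_sub, hσ, hσ, hσ, map_sub, star_sub])
    rw [this]
    exact hle _
  · exact ModFun.toBCF_injective (by rw [hσ, map_zero, star_zero])
  · rw [ModFun.evalL_apply, hσ]
    rfl

end Algebra

/-! ### Power series in an element and its conjugate. -/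

section Series

variable {X : Type*} [NormedAddCommGroup X] [NormedSpace ℂ X] (m : X →L[ℂ] X →L[ℂ] X) (σ : X → X)

/-- The monomial `f^j (σ f)^k` in an algebra without unit, with multiplication `m`; it is `0` by
convention if `j = k = 0`. -/
def mono : ℕ × ℕ → X → X
  | (0, 0), _ => 0
  | (0, k + 1), f => (m (σ f) ^ k) (σ f)
  | (j + 1, k), f => (m f ^ j) ((m (σ f) ^ k) f)

theorem norm_pow_apply_le {a : X →L[ℂ] X} {ρ : ℝ} (ha : ‖a‖ ≤ ρ) (k : ℕ) (x : X) :
    ‖(a ^ k) x‖ ≤ ρ ^ k * ‖x‖ := by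
  have hρ : 0 ≤ ρ := (norm_nonneg _).trans ha
  induction k with
  | zero => simp
  | succ k ih =>
    rw [pow_succ', mul_apply_eq_comp]
    calc ‖a ((a ^ k) x)‖ ≤ ρ * (ρ ^ k * ‖x‖) :=
          (a.le_of_opNorm_le ha _).trans (mul_le_mul_of_nonneg_left ih hρ)
      _ = _ := by ring

/-- Telescoping: `a^(k+1) x - b^(k+1) y = a (a^k x - b^k y) + (a - b) b^k y`. -/
theorem norm_pow_apply_sub_le {a b : X →L[ℂ] X} {ρ : ℝ} (hρ : 1 ≤ ρ) (ha : ‖a‖ ≤ ρ) (hb : ‖b‖ ≤ ρ)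
    (k : ℕ) (x y : X) :
    ‖(a ^ k) x - (b ^ k) y‖ ≤ ρ ^ k * (‖x - y‖ + k * (‖a - b‖ * ‖y‖)) := by
  induction k with
  | zero => simp
  | succ k ih =>
    rw [pow_succ', pow_succ', mul_apply_eq_comp, mul_apply_eq_comp]
    have h1 : a ((a ^ k) x) - b ((b ^ k) y)
        = a ((a ^ k) x - (b ^ k) y) + (a - b) ((b ^ k) y) := by
      rw [map_sub, _root_.sub_apply]; abel
    rw [h1]
    have hk : 0 ≤ ρ ^ k := by positivity
    have h2 : ‖a ((a ^ k) x - (b ^ k) y)‖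
        ≤ ρ * (ρ ^ k * (‖x - y‖ + k * (‖a - b‖ * ‖y‖))) :=
      (a.le_of_opNorm_le ha _).trans (mul_le_mul_of_nonneg_left ih (by linarith))
    have h3 : ‖(a - b) ((b ^ k) y)‖ ≤ ‖a - b‖ * (ρ ^ k * ‖y‖) :=
      ((a - b).le_opNorm _).trans
        (mul_le_mul_of_nonneg_left (norm_pow_apply_le hb k y) (norm_nonneg _))
    have h4 : ‖a - b‖ * (ρ ^ k * ‖y‖) ≤ ρ * (‖a - b‖ * (ρ ^ k * ‖y‖)) :=
      le_mul_of_one_le_left (by positivity) hρ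
    calc _ ≤ _ := norm_add_le _ _
      _ ≤ ρ * (ρ ^ k * (‖x - y‖ + k * (‖a - b‖ * ‖y‖))) + ρ * (‖a - b‖ * (ρ ^ k * ‖y‖)) :=
          add_le_add h2 (h3.trans h4)
      _ = _ := by push_cast; ring

variable {m σ}

/-- The telescoped difference has a factor linear in the degree; it is absorbed by `2^(j+k)`,
leaving a geometric bound that the coefficients of an everywhere convergent series can sum. -/
theorem norm_mono_sub_le {A : ℝ} (hA : 0 ≤ A) (hσ : ∀ f h, ‖σ f - σ h‖ ≤ A * ‖f - h‖)
    (hσ0 : σ 0 = 0) {ρ : ℝ} (hρ : 1 ≤ ρ) {f h : X} (hf : (‖m‖ + 1) * (A + 1) * ‖f‖ ≤ ρ)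
    (hh : (‖m‖ + 1) * (A + 1) * ‖h‖ ≤ ρ) (n : ℕ × ℕ) :
    ‖mono m σ n f - mono m σ n h‖
      ≤ (‖m‖ + 1) * (A + 1) * ρ * ‖f - h‖ * (2 * ρ) ^ (n.1 + n.2) := by
  -- This single constant dominates `1`, `A`, `‖m‖` and `‖m‖ * A`.
  set κ := (‖m‖ + 1) * (A + 1) with hκ
  have hm0 := norm_nonneg m
  have hκ1 : 1 ≤ κ := by nlinarith
  have hσn : ∀ f, ‖σ f‖ ≤ A * ‖f‖ := fun f => by simpa [hσ0] using hσ f 0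
  have hmA : ‖m‖ * A ≤ κ := by nlinarith
  have hmκ : ‖m‖ ≤ κ := by nlinarith
  have hAκ : A ≤ κ := by nlinarith
  have e1 : ∀ f, κ * ‖f‖ ≤ ρ → ‖m f‖ ≤ ρ := fun f hf =>
    (m.le_opNorm f).trans ((mul_le_mul_of_nonneg_right hmκ (norm_nonneg _)).trans hf)
  have e2 : ∀ f, κ * ‖f‖ ≤ ρ → ‖m (σ f)‖ ≤ ρ := fun f hf =>
    (m.le_opNorm _).trans (by nlinarith [hσn f, norm_nonneg f])
  have e3 : ∀ f : X, κ * ‖f‖ ≤ ρ → ‖f‖ ≤ ρ := fun f hf => by nlinarith [norm_nonneg f]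
  have e4 : ∀ f : X, κ * ‖f‖ ≤ ρ → ‖σ f‖ ≤ ρ := fun f hf => by nlinarith [hσn f, norm_nonneg f]
  set δ := ‖f - h‖ with hδ
  have hδ0 : 0 ≤ δ := norm_nonneg _
  have e5 : ‖m f - m h‖ ≤ κ * δ := by
    rw [← map_sub]
    exact (m.le_opNorm _).trans (mul_le_mul_of_nonneg_right hmκ hδ0)
  have e6 : ‖m (σ f) - m (σ h)‖ ≤ κ * δ := by
    rw [← map_sub]
    refine (m.le_opNorm _).trans ?_
    have := mul_le_mul_of_nonneg_left (hσ f h) hm0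
    nlinarith
  have hpow : ∀ k : ℕ, ρ ^ k * (κ * δ + k * (κ * δ * ρ)) ≤ κ * ρ * δ * (2 * ρ) ^ k := by
    intro k
    have h1 : (k : ℝ) + 1 ≤ 2 ^ k := by exact_mod_cast Nat.lt_two_pow_self (n := k)
    have h2 : κ * δ + k * (κ * δ * ρ) ≤ κ * ρ * δ * (k + 1) := by
      have : κ * δ ≤ κ * δ * ρ := le_mul_of_one_le_right (by positivity) hρ
      nlinarith
    calc ρ ^ k * (κ * δ + k * (κ * δ * ρ)) ≤ ρ ^ k * (κ * ρ * δ * 2 ^ k) :=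
          mul_le_mul_of_nonneg_left (h2.trans (mul_le_mul_of_nonneg_left h1 (by positivity)))
            (by positivity)
      _ = _ := by rw [mul_pow]; ring
  have hup : ∀ k : ℕ, κ * ρ * δ * (2 * ρ) ^ k ≤ κ * ρ * δ * (2 * ρ) ^ (k + 1) := fun k =>
    mul_le_mul_of_nonneg_left (pow_le_pow_right₀ (by linarith) (Nat.le_succ k)) (by positivity)
  rcases n with ⟨j, k⟩
  rcases j with _ | j
  · rcases k with _ | k
    · simp only [mono, sub_self, norm_zero]
      positivity
    · simp only [mono, zero_add]
      refine le_trans ?_ ((hpow k).trans (hup k))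
      refine (norm_pow_apply_sub_le hρ (e2 f hf) (e2 h hh) k _ _).trans ?_
      refine mul_le_mul_of_nonneg_left (add_le_add ((hσ f h).trans ?_)
        (mul_le_mul_of_nonneg_left ?_ (Nat.cast_nonneg k))) (by positivity)
      · exact mul_le_mul_of_nonneg_right hAκ hδ0
      · exact mul_le_mul e6 (e4 h hh) (norm_nonneg _) (by positivity)
  · simp only [mono]
    have hjk : j + 1 + k = j + k + 1 := by ring
    rw [hjk]
    refine le_trans ?_ ((hpow (j + k)).trans (hup (j + k)))
    refine (norm_pow_apply_sub_le hρ (e1 f hf) (e1 h hh) j _ _).trans ?_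
    have h1 : ‖(m (σ f) ^ k) f - (m (σ h) ^ k) h‖ ≤ ρ ^ k * (κ * δ + k * (κ * δ * ρ)) := by
      refine (norm_pow_apply_sub_le hρ (e2 f hf) (e2 h hh) k _ _).trans ?_
      refine mul_le_mul_of_nonneg_left (add_le_add (le_mul_of_one_le_left hδ0 hκ1)
        (mul_le_mul_of_nonneg_left ?_ (Nat.cast_nonneg k))) (by positivity)
      exact mul_le_mul e6 (e3 h hh) (norm_nonneg _) (by positivity)
    have h2 : ‖m f - m h‖ * ‖(m (σ h) ^ k) h‖ ≤ κ * δ * (ρ ^ k * ρ) :=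
      mul_le_mul e5 ((norm_pow_apply_le (e2 h hh) k h).trans
        (mul_le_mul_of_nonneg_left (e3 h hh) (by positivity))) (norm_nonneg _) (by positivity)
    calc _ ≤ ρ ^ j * (ρ ^ k * (κ * δ + k * (κ * δ * ρ)) + j * (κ * δ * (ρ ^ k * ρ))) :=
          mul_le_mul_of_nonneg_left (add_le_add h1
            (mul_le_mul_of_nonneg_left h2 (Nat.cast_nonneg j))) (by positivity)
      _ = _ := by push_cast; ring

theorem mono_zero (hσ0 : σ 0 = 0) (n : ℕ × ℕ) : mono m σ n 0 = 0 := by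
  rcases n with ⟨j, k⟩
  rcases j with _ | j
  · rcases k with _ | k
    · rfl
    · simp only [mono, hσ0, map_zero]
  · simp only [mono, map_zero]

/-- A power series in `f` and `σ f` that converges everywhere and has no constant term defines a
locally Lipschitz map. -/
theorem exists_series_lipschitz [CompleteSpace X] {A : ℝ} (hA : 0 ≤ A)
    (hσ : ∀ f h, ‖σ f - σ h‖ ≤ A * ‖f - h‖) (hσ0 : σ 0 = 0) {c : ℕ × ℕ → ℂ}
    (hc : ∀ ρ : ℝ, Summable fun n => ‖c n‖ * ρ ^ (n.1 + n.2)) :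
    ∃ N : X → X, (∀ f, HasSum (fun n => c n • mono m σ n f) (N f)) ∧
      ∀ r : ℝ, ∃ L : ℝ, 0 ≤ L ∧ ∀ f h, ‖f‖ ≤ r → ‖h‖ ≤ r → ‖N f - N h‖ ≤ L * ‖f - h‖ := by
  set κ := (‖m‖ + 1) * (A + 1) with hκ
  have hκ0 : 0 ≤ κ := by positivity
  have key : ∀ (r : ℝ) (f h : X), ‖f‖ ≤ r → ‖h‖ ≤ r → ∀ n,
      ‖c n • mono m σ n f - c n • mono m σ n h‖
        ≤ κ * (1 + κ * r) * ‖f - h‖ * (‖c n‖ * (2 * (1 + κ * r)) ^ (n.1 + n.2)) := by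
    intro r f h hf hh n
    have hr : 0 ≤ r := (norm_nonneg _).trans hf
    have hle : ∀ f : X, ‖f‖ ≤ r → κ * ‖f‖ ≤ 1 + κ * r := fun f hf => by
      nlinarith [mul_le_mul_of_nonneg_left hf hκ0]
    have := norm_mono_sub_le (m := m) hA hσ hσ0 (ρ := 1 + κ * r) (by nlinarith [mul_nonneg hκ0 hr])
      (hle f hf) (hle h hh) n
    rw [← smul_sub, norm_smul]
    calc _ ≤ ‖c n‖ * _ := mul_le_mul_of_nonneg_left this (norm_nonneg _)
      _ = _ := by ring
  have hsum : ∀ f, Summable fun n => c n • mono m σ n f := by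
    intro f
    refine Summable.of_norm_bounded ((hc (2 * (1 + κ * ‖f‖))).mul_left
      (κ * (1 + κ * ‖f‖) * ‖f - 0‖)) fun n => ?_
    have := key ‖f‖ f 0 le_rfl (by simp) n
    rwa [mono_zero hσ0, smul_zero, sub_zero] at this
  refine ⟨fun f => ∑' n, c n • mono m σ n f, fun f => (hsum f).hasSum, fun r => ?_⟩
  rcases lt_or_ge r 0 with hr | hr
  · exact ⟨0, le_rfl, fun f h hf => absurd ((norm_nonneg f).trans hf) (not_le.mpr hr)⟩
  refine ⟨κ * (1 + κ * r) * ∑' n, ‖c n‖ * (2 * (1 + κ * r)) ^ (n.1 + n.2), ?_,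
    fun f h hf hh => ?_⟩
  · exact mul_nonneg (by positivity) (tsum_nonneg fun n => by positivity)
  · have h1 := ((hc (2 * (1 + κ * r))).mul_left (κ * (1 + κ * r) * ‖f - h‖)).hasSum
    rw [tsum_mul_left] at h1
    have h2 := tsum_of_norm_bounded h1 (key r f h hf hh)
    rw [(hsum f).tsum_sub (hsum h)] at h2
    refine h2.trans (le_of_eq ?_)
    ring

end Series

/-! ### The nonlinearity as a locally Lipschitz map. -/

section Nonlinearity

variable {g : 𝓢(Eucl d, ℂ)} {p : ℝ≥0∞} {s : ℝ} [hp : Fact (1 ≤ p)] [hg : Fact (g ≠ 0)]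
  [hs : Fact (0 ≤ s)]

theorem ModFun.evalL_mulL_pow (x : Eucl d) (f h : ModFun g p s) (k : ℕ) :
    ModFun.evalL x ((ModFun.mulL f ^ k) h) = ModFun.evalL x f ^ k * ModFun.evalL x h := by
  induction k with
  | zero => simp
  | succ k ih =>
    rw [pow_succ', mul_apply_eq_comp, ModFun.evalL_mulL, ih, pow_succ']
    ring

/-- The function in the definition of `nonlin` is determined only almost everywhere; a continuous
representative turns the question into a pointwise identity. -/
theorem nonlin_toDistr {F : ℂ → ℂ} {f k : ModFun g p s}
    (h : ∀ x, k.toBCF x = F (f.toBCF x)) : nonlin F f.toDistr = k.toDistr := by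
  set fl := (memLp_top_bcf f.toBCF).toLp f.toBCF with hfl
  have hae : (fun x => F (fl x)) =ᵐ[volume] k.toBCF := by
    filter_upwards [(memLp_top_bcf f.toBCF).coeFn_toLp] with x hx
    rw [hfl, hx, h]
  have hmem : MemLp (fun x => F (fl x)) ∞ volume := (memLp_top_bcf k.toBCF).ae_eq hae.symm
  have h1 := nonlin_eq F fl hmem
  have h2 : hmem.toLp _ = (memLp_top_bcf k.toBCF).toLp k.toBCF :=
    (MemLp.toLp_eq_toLp_iff _ _).mpr hae
  rw [h2] at h1
  exact h1

/-- An entire real-analytic function vanishing at `0` acts on the modulation space as a locally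
Lipschitz map. -/
theorem exists_nonlin_lipschitz {F : ℂ → ℂ} (hF : IsEntireRealAnalytic F) (hF0 : F 0 = 0) :
    ∃ N : ModFun g p s → ModFun g p s, (∀ f, nonlin F f.toDistr = (N f).toDistr) ∧ N 0 = 0 ∧
      ∀ r : ℝ, ∃ L : ℝ, 0 ≤ L ∧ ∀ f h, ‖f‖ ≤ r → ‖h‖ ≤ r → ‖N f - N h‖ ≤ L * ‖f - h‖ := by
  obtain ⟨c, hc⟩ := hF
  obtain ⟨σ, ⟨A, hA, hσ⟩, hσ0, hσe⟩ := ModFun.exists_conj (g := g) (p := p) (s := s)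
  -- Evaluating the series at `z = |ρ|` gives absolute summability with that radius.
  have hcs : ∀ ρ : ℝ, Summable fun n : ℕ × ℕ => ‖c n‖ * ρ ^ (n.1 + n.2) := by
    intro ρ
    have h1 := (hc (|ρ| : ℝ)).summable.norm
    refine Summable.of_norm (h1.congr fun n => ?_)
    simp only [norm_mul, norm_pow, Complex.norm_real, RCLike.norm_conj, Real.norm_eq_abs, abs_abs,
      abs_norm, pow_add]
    ring
  -- The constant term is `F 0 = 0`, so the conventional value `0` of the monomial of degree `0` in
  -- an algebra without unit does no harm.
  have hc0 : c (0, 0) = 0 := by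
    have h1 := hc 0
    have h2 := hasSum_single (f := fun n : ℕ × ℕ => c n * 0 ^ n.1 * conj (0 : ℂ) ^ n.2) (0, 0)
      (fun n hn => by
        rcases n with ⟨j, k⟩
        rcases j with _ | j
        · rcases k with _ | k
          · exact absurd rfl hn
          · simp
        · simp)
    have h3 := h1.unique h2
    rw [hF0] at h3
    simpa using h3.symm
  obtain ⟨N, hN, hL⟩ := exists_series_lipschitz (m := ModFun.mulL) hA hσ hσ0 hcs
  refine ⟨N, fun f => nonlin_toDistr fun x => ?_, ?_, hL⟩
  -- Evaluation at `x` is continuous and multiplicative, so it carries the sum in the algebra to the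
  -- scalar series of `F` at the point value.
  · have h1 := (ModFun.evalL (g := g) (p := p) (s := s) x).hasSum (hN f)
    refine h1.unique ?_
    change HasSum _ (F (ModFun.evalL x f))
    convert hc (ModFun.evalL x f) using 1
    funext n
    rcases n with ⟨j, k⟩
    rcases j with _ | j
    · rcases k with _ | k
      · simp [mono, hc0]
      · simp only [mono, map_smul, ModFun.evalL_mulL_pow, hσe, smul_eq_mul, pow_zero, mul_one,
          pow_succ]
    · simp only [mono, map_smul, ModFun.evalL_mulL_pow, hσe, smul_eq_mul, pow_succ]
      ring
  · refine (hN 0).unique ?_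
    simp only [mono_zero hσ0, smul_zero]
    exact hasSum_zero

end Nonlinearity

end ModulationNLW
end

noncomputable section

namespace ModulationNLW

open SchwartzMap FourierTransform BoundedContinuousFunction

variable {d : ℕ}

set_option linter.unusedSectionVars false

/-! ### Operator families on the closure of the Schwartz class. -/

section StrongContinuity

variable {g : 𝓢(Eucl d, ℂ)} {p : ℝ≥0∞} {s s₁ s₂ : ℝ} {C : ℝ≥0∞}
  {P : ℝ → 𝓢'(Eucl d, ℂ) →L[ℂ] 𝓢'(Eucl d, ℂ)}

/-- Images of Schwartz approximants are Schwartz functions and converge by boundedness. -/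
theorem map_mem_modSpace (hp : 1 ≤ p) (hC : C < ∞) {Q : 𝓢'(Eucl d, ℂ) →L[ℂ] 𝓢'(Eucl d, ℂ)}
    (hQ : ∀ f, modNorm g p 1 s (Q f) ≤ C * modNorm g p 1 s₁ f)
    (hS : ∀ φ : 𝓢(Eucl d, ℂ), ∃ ψ : 𝓢(Eucl d, ℂ), Q (φ : 𝓢'(Eucl d, ℂ)) = (ψ : 𝓢'(Eucl d, ℂ)))
    {u : 𝓢'(Eucl d, ℂ)} (hu : u ∈ modSpace g p 1 s₁) : Q u ∈ modSpace g p 1 s := by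
  refine mem_modSpace_of_approx hp fun ε hε => ?_
  obtain ⟨φ, hφ⟩ := exists_seq_of_mem_modSpace hu
  have h1 : Tendsto (fun n => C * modNorm g p 1 s₁ (u - (φ n : 𝓢'(Eucl d, ℂ)))) atTop (𝓝 0) := by
    simpa using ENNReal.Tendsto.const_mul hφ (Or.inr hC.ne)
  obtain ⟨n, hn⟩ := (h1.eventually_lt_const hε).exists
  obtain ⟨ψ, hψ⟩ := hS (φ n)
  refine ⟨_, coe_mem_modSpace g hp s ψ, ?_⟩
  rw [← hψ, ← map_sub]
  exact (hQ _).trans_lt hn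

/-- The Lipschitz bound in time may cost derivatives, so it is applied only to a Schwartz
approximant; the remainder is small uniformly in time by boundedness. Hence strong continuity, which
rests on density. -/
theorem tendsto_modNorm_map_sub (hp : 1 ≤ p) (hC : C < ∞)
    (hP : ∀ t, |t| ≤ 1 → ∀ f, modNorm g p 1 s (P t f) ≤ C * modNorm g p 1 s₁ f)
    (hL : ∀ t t', |t| ≤ 1 → |t'| ≤ 1 → ∀ f, modNorm g p 1 s (P t f - P t' f)
      ≤ C * ENNReal.ofReal |t - t'| * modNorm g p 1 s₂ f)
    {u : 𝓢'(Eucl d, ℂ)} (hu : u ∈ modSpace g p 1 s₁) {t : ℝ} (ht : |t| ≤ 1) :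
    Tendsto (fun t' => modNorm g p 1 s (P t' u - P t u)) (𝓝[Icc (-1) 1] t) (𝓝 0) := by
  rw [ENNReal.tendsto_nhds_zero]
  intro ε hε
  have hε2 : 0 < ε / 2 := ENNReal.half_pos hε.ne'
  obtain ⟨φ, hφ⟩ := exists_seq_of_mem_modSpace hu
  have h1 : Tendsto (fun n => (C + C) * modNorm g p 1 s₁ (u - (φ n : 𝓢'(Eucl d, ℂ)))) atTop
      (𝓝 0) := by
    simpa using ENNReal.Tendsto.const_mul hφ
      (Or.inr (ENNReal.add_lt_top.mpr ⟨hC, hC⟩).ne)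
  obtain ⟨n, hn⟩ := (h1.eventually_lt_const hε2).exists
  set D := modNorm g p 1 s₂ (φ n : 𝓢'(Eucl d, ℂ)) with hD
  have hDt : D < ∞ := modNorm_schwartz_lt_top g hp s₂ (φ n)
  have h2 : Tendsto (fun t' : ℝ => C * ENNReal.ofReal |t' - t| * D) (𝓝[Icc (-1) 1] t) (𝓝 0) := by
    have h3 : Tendsto (fun t' : ℝ => ENNReal.ofReal |t' - t|) (𝓝[Icc (-1) 1] t) (𝓝 0) := by
      have : Continuous fun t' : ℝ => ENNReal.ofReal |t' - t| :=
        ENNReal.continuous_ofReal.comp (by fun_prop)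
      have h4 := (this.tendsto t).mono_left (nhdsWithin_le_nhds (s := Icc (-1) 1))
      simpa using h4
    have h5 := ENNReal.Tendsto.mul_const (ENNReal.Tendsto.const_mul h3 (Or.inr hC.ne))
      (Or.inr hDt.ne)
    simpa using h5
  filter_upwards [h2.eventually_lt_const hε2, self_mem_nhdsWithin] with t' ht' hmem
  have hat' : |t'| ≤ 1 := abs_le.mpr hmem
  set k := u - (φ n : 𝓢'(Eucl d, ℂ)) with hk
  have hsplit : P t' u - P t u = (P t' k - P t k)
      + (P t' (φ n : 𝓢'(Eucl d, ℂ)) - P t (φ n : 𝓢'(Eucl d, ℂ))) := by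
    rw [hk, map_sub, map_sub]; abel
  rw [hsplit]
  calc _ ≤ _ := modNorm_add_le g hp s _ _
    _ ≤ (C + C) * modNorm g p 1 s₁ k + C * ENNReal.ofReal |t' - t| * D := by
        refine add_le_add ?_ (hL t' t hat' ht _)
        rw [sub_eq_add_neg, add_mul]
        refine (modNorm_add_le g hp s _ _).trans (add_le_add (hP t' hat' k) ?_)
        rw [modNorm_neg]
        exact hP t ht k
    _ ≤ ε / 2 + ε / 2 := add_le_add hn.le ht'.le
    _ = ε := ENNReal.add_halves ε

end StrongContinuity

/-! ### Propagators and free evolution in the Banach space. -/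

section PropagatorsOnModFun

variable {g : 𝓢(Eucl d, ℂ)} {p : ℝ≥0∞} {s : ℝ} [hp : Fact (1 ≤ p)] [hg : Fact (g ≠ 0)]
  [hs : Fact (0 ≤ s)]

theorem ModFun.tendsto_of_modNorm {α : Type*} {l : Filter α} {f : α → ModFun g p s}
    {f₀ : ModFun g p s} (h : Tendsto (fun a => modNorm g p 1 s ((f a).toDistr - f₀.toDistr)) l (𝓝 0)) :
    Tendsto f l (𝓝 f₀) := by
  rw [tendsto_iff_norm_sub_tendsto_zero]
  have h1 := (ENNReal.tendsto_toReal ENNReal.zero_ne_top).comp h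
  rw [ENNReal.toReal_zero] at h1
  refine h1.congr fun n => ?_
  rw [ModFun.norm_def, map_sub]
  rfl

theorem ModFun.tendsto_modNorm {α : Type*} {l : Filter α} {f : α → ModFun g p s}
    {f₀ : ModFun g p s} (h : Tendsto f l (𝓝 f₀)) :
    Tendsto (fun a => modNorm g p 1 s ((f a).toDistr - f₀.toDistr)) l (𝓝 0) := by
  rw [tendsto_iff_norm_sub_tendsto_zero] at h
  have h1 := ENNReal.tendsto_ofReal h
  rw [ENNReal.ofReal_zero] at h1
  refine h1.congr fun n => ?_
  rw [ModFun.ofReal_norm, map_sub]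

/-- `sin (t √(-Δ)) / √(-Δ)` as a norm continuous family of operators on the modulation space. -/
theorem exists_sinProp_operator (hd : 1 ≤ d) : ∃ S : ℝ → ModFun g p s →L[ℂ] ModFun g p s,
    Continuous S ∧ (∃ K : ℝ, 0 ≤ K ∧ ∀ t, ‖S t‖ ≤ K) ∧
      ∀ t : ℝ, |t| ≤ 1 → ∀ f, (S t f).toDistr = sinProp t f.toDistr := by
  obtain ⟨C, hC, H⟩ := exists_modNorm_propagator_le hd hg.out hp.out s
  have hb : ∀ t : ℝ, |t| ≤ 1 → ∀ f : 𝓢'(Eucl d, ℂ),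
      modNorm g p 1 s (sinProp t f) ≤ C * modNorm g p 1 s f := fun t ht f =>
    ((H t t ht ht f).2.1).trans (mul_le_mul_right (modNorm_mono_weight g p (by linarith) f) _)
  have hmem : ∀ (t : Icc (-1 : ℝ) 1) (f : ModFun g p s),
      ∃ k : ModFun g p s, k.toDistr = sinProp (t : ℝ) f.toDistr := fun t f =>
    ModFun.exists_toDistr_eq (map_mem_modSpace hp.out hC (hb t (abs_le.mpr t.2))
      (exists_sinProp_coe t (abs_le.mpr t.2)) f.toDistr_mem)
  choose k hk using hmem
  have hC0 : 0 ≤ C.toReal := ENNReal.toReal_nonneg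
  have hnorm : ∀ t f, ‖k t f‖ ≤ C.toReal * ‖f‖ := fun t f => by
    rw [ModFun.norm_def, hk, ModFun.norm_def, ← ENNReal.toReal_mul]
    exact ENNReal.toReal_mono (ENNReal.mul_lt_top hC f.toDistr_mem.1).ne
      (hb t (abs_le.mpr t.2) _)
  set S₀ : Icc (-1 : ℝ) 1 → ModFun g p s →L[ℂ] ModFun g p s := fun t =>
    LinearMap.mkContinuous
      { toFun := k t
        map_add' := fun f h => ModFun.toDistr_injective (by
          rw [map_add, hk, hk, hk, map_add, map_add])
        map_smul' := fun c f => ModFun.toDistr_injective (by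
          rw [map_smul, hk, hk, map_smul, map_smul]; rfl) } C.toReal (hnorm t) with hS₀
  have hS₀k : ∀ t f, S₀ t f = k t f := fun t f => rfl
  -- Operator norm continuity is available because the time Lipschitz bound for `K(t)` loses no
  -- derivative.
  have hlip : LipschitzWith C.toNNReal S₀ := by
    refine LipschitzWith.of_dist_le_mul fun t t' => ?_
    rw [dist_eq_norm]
    refine ContinuousLinearMap.opNorm_le_bound _ (by positivity) fun f => ?_
    rw [_root_.sub_apply, hS₀k, hS₀k, ModFun.norm_def, map_sub, hk, hk, ModFun.norm_def]
    have h1 := (H t t' (abs_le.mpr t.2) (abs_le.mpr t'.2) f.toDistr).2.2.2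
    have h2 := ENNReal.toReal_mono (ENNReal.mul_lt_top (ENNReal.mul_lt_top hC
      ENNReal.ofReal_lt_top) f.toDistr_mem.1).ne h1
    rw [ENNReal.toReal_mul, ENNReal.toReal_mul, ENNReal.toReal_ofReal (abs_nonneg _)] at h2
    exact h2
  -- Times are clamped to `[-1, 1]`, which gives a family continuous and bounded on the whole line;
  -- it is the propagator only for `|t| ≤ 1`.
  refine ⟨IccExtend (by norm_num : (-1 : ℝ) ≤ 1) S₀, hlip.continuous.Icc_extend',
    ⟨C.toReal, hC0, fun t => ?_⟩, fun t ht f => ?_⟩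
  · exact LinearMap.mkContinuous_norm_le _ hC0 (hnorm _)
  · rw [IccExtend_of_mem _ _ (abs_le.mp ht), hS₀k, hk]

/-- The solution of the free wave equation as a continuous curve in the modulation space. -/
theorem exists_free_evolution (hd : 1 ≤ d) {u₀ u₁ : 𝓢'(Eucl d, ℂ)} (h₀ : u₀ ∈ modSpace g p 1 s)
    (h₁ : u₁ ∈ modSpace g p 1 (s - 1)) : ∃ A : ℝ → ModFun g p s, Continuous A ∧
      ∀ t : ℝ, |t| ≤ 1 → (A t).toDistr = cosProp t u₀ + sinProp t u₁ := by
  obtain ⟨C, hC, H⟩ := exists_modNorm_propagator_le hd hg.out hp.out s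
  have hc := fun (t : ℝ) (ht : |t| ≤ 1) (f : 𝓢'(Eucl d, ℂ)) => (H t t ht ht f).1
  have hsn := fun (t : ℝ) (ht : |t| ≤ 1) (f : 𝓢'(Eucl d, ℂ)) => (H t t ht ht f).2.1
  have hmem : ∀ t : Icc (-1 : ℝ) 1,
      ∃ k : ModFun g p s, k.toDistr = cosProp (t : ℝ) u₀ + sinProp (t : ℝ) u₁ := fun t =>
    ModFun.exists_toDistr_eq (add_mem_modSpace hp.out
      (map_mem_modSpace hp.out hC (hc t (abs_le.mpr t.2))
        (exists_cosProp_coe t (abs_le.mpr t.2)) h₀)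
      (map_mem_modSpace hp.out hC (hsn t (abs_le.mpr t.2))
        (exists_sinProp_coe t (abs_le.mpr t.2)) h₁))
  choose k hk using hmem
  have hcont : Continuous k := by
    rw [continuous_iff_continuousAt]
    intro t
    refine ModFun.tendsto_of_modNorm ?_
    have hte : Tendsto (fun t' : Icc (-1 : ℝ) 1 => (t' : ℝ)) (𝓝 t) (𝓝[Icc (-1) 1] (t : ℝ)) :=
      tendsto_nhdsWithin_iff.mpr ⟨continuous_subtype_val.tendsto t,
        Eventually.of_forall fun t' => t'.2⟩
    have l1 := (tendsto_modNorm_map_sub (P := cosProp) hp.out hC hc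
      (fun t t' ht ht' f => (H t t' ht ht' f).2.2.1) h₀ (abs_le.mpr t.2)).comp hte
    have l2 := (tendsto_modNorm_map_sub (P := sinProp) hp.out hC hsn
      (fun t t' ht ht' f => (H t t' ht ht' f).2.2.2) h₁ (abs_le.mpr t.2)).comp hte
    have l3 := l1.add l2
    rw [add_zero] at l3
    refine tendsto_of_tendsto_of_tendsto_of_le_of_le tendsto_const_nhds l3 (fun _ => zero_le)
      fun t' => ?_
    simp only [hk]
    rw [add_sub_add_comm]
    exact modNorm_add_le g hp.out s _ _
  refine ⟨IccExtend (by norm_num : (-1 : ℝ) ≤ 1) k, hcont.Icc_extend', fun t ht => ?_⟩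
  rw [IccExtend_of_mem _ _ (abs_le.mp ht), hk]

end PropagatorsOnModFun

/-! ### The Duhamel equation in a Banach space. -/

section Duhamel

variable {X : Type*} [NormedAddCommGroup X] [NormedSpace ℂ X]

theorem continuous_of_locally_lipschitz {N : X → X}
    (hN : ∀ r : ℝ, ∃ L : ℝ, 0 ≤ L ∧ ∀ f h, ‖f‖ ≤ r → ‖h‖ ≤ r → ‖N f - N h‖ ≤ L * ‖f - h‖) :
    Continuous N := by
  rw [continuous_iff_continuousAt]
  intro f
  obtain ⟨L, hL, h⟩ := hN (‖f‖ + 1)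
  rw [ContinuousAt, tendsto_iff_norm_sub_tendsto_zero]
  have h1 : Tendsto (fun h : X => L * ‖h - f‖) (𝓝 f) (𝓝 0) := by
    have : Continuous fun h : X => L * ‖h - f‖ := by fun_prop
    simpa using this.tendsto f
  refine squeeze_zero' (Eventually.of_forall fun _ => norm_nonneg _) ?_ h1
  filter_upwards [Metric.ball_mem_nhds f one_pos] with k hk
  refine h k f ?_ (by linarith)
  have := norm_le_norm_add_norm_sub' k f
  rw [mem_ball_iff_norm] at hk
  linarith

theorem continuous_duhamel {S : ℝ → X →L[ℂ] X} (hS : Continuous S) {v : ℝ → X}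
    (hv : Continuous v) : Continuous fun t : ℝ => ∫ τ in (0 : ℝ)..t, S (t - τ) (v τ) := by
  refine intervalIntegral.continuous_parametric_intervalIntegral_of_continuous
    (f := fun t τ => S (t - τ) (v τ)) ?_ continuous_id
  exact (hS.comp (continuous_fst.sub continuous_snd)).clm_apply (hv.comp continuous_snd)

theorem continuous_duhamel_integrand {S : ℝ → X →L[ℂ] X} (hS : Continuous S) {v : ℝ → X}
    (hv : Continuous v) (t : ℝ) : Continuous fun τ : ℝ => S (t - τ) (v τ) :=
  (hS.comp (continuous_const.sub continuous_id)).clm_apply hv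

/-- Local existence for the Duhamel equation, with an existence time depending only on the size of
the free evolution. -/
theorem exists_duhamel_solution [CompleteSpace X] {S : ℝ → X →L[ℂ] X} (hS : Continuous S) {K : ℝ}
    (hK : 0 ≤ K) (hSK : ∀ t, ‖S t‖ ≤ K) {N : X → X} (hN0 : N 0 = 0)
    (hN : ∀ r : ℝ, ∃ L : ℝ, 0 ≤ L ∧ ∀ f h, ‖f‖ ≤ r → ‖h‖ ≤ r → ‖N f - N h‖ ≤ L * ‖f - h‖)
    {M : ℝ} (hM : 0 ≤ M) :
    ∃ T : ℝ, 0 < T ∧ T ≤ 1 ∧ ∀ a : ℝ → X, Continuous a → (∀ t ∈ Icc (0 : ℝ) 1, ‖a t‖ ≤ M) →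
      ∃ u : ℝ → X, Continuous u ∧ (∀ t, ‖u t‖ ≤ M + 1) ∧
        ∀ t ∈ Icc (0 : ℝ) T, u t = a t + ∫ τ in (0 : ℝ)..t, S (t - τ) (N (u τ)) := by
  have hNc := continuous_of_locally_lipschitz hN
  obtain ⟨L, hL, hNL⟩ := hN (M + 1)
  -- Chosen so that both `K L (M + 1) T` and `K L T` are at most `1/2`. The first, with `N 0 = 0`,
  -- keeps the ball of radius `M + 1` invariant; the second makes the map a contraction there.
  set T := 1 / (2 * (K * L * (M + 1) + 1)) with hT
  have hQ : 0 ≤ K * L * (M + 1) := by positivity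
  have hT0 : 0 < T := by positivity
  have hT1 : T ≤ 1 := by
    rw [hT, div_le_one (by positivity)]
    linarith
  have hTQ : T * (2 * (K * L * (M + 1) + 1)) = 1 := by
    rw [hT]; field_simp
  have hTKLM : K * L * (M + 1) * T ≤ 1 / 2 := by nlinarith
  have hTKL : K * L * T ≤ 1 / 2 := by
    have : 0 ≤ K * L * M * T := by positivity
    nlinarith
  refine ⟨T, hT0, hT1, fun a ha haM => ?_⟩
  have ext_cont : ∀ v : C(Icc (0 : ℝ) T, X), Continuous (IccExtend hT0.le v) := fun v =>
    v.continuous.Icc_extend'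
  set Φ : C(Icc (0 : ℝ) T, X) → C(Icc (0 : ℝ) T, X) := fun v =>
    { toFun := fun t => a t + ∫ τ in (0 : ℝ)..t, S (t - τ) (N (IccExtend hT0.le v τ))
      continuous_toFun := (ha.comp continuous_subtype_val).add
        ((continuous_duhamel hS (hNc.comp (ext_cont v))).comp continuous_subtype_val) } with hΦ
  have hint : ∀ {t : Icc (0 : ℝ) T} {w : ℝ → X} {B : ℝ}, 0 ≤ B → (∀ τ, ‖w τ‖ ≤ B) →
      ‖∫ τ in (0 : ℝ)..t, S (t - τ) (w τ)‖ ≤ K * B * T := by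
    intro t w B hB hw
    refine (intervalIntegral.norm_integral_le_of_norm_le_const (C := K * B) fun τ _ =>
      ((S (t - τ)).le_of_opNorm_le (hSK _) _).trans
        (mul_le_mul_of_nonneg_left (hw τ) hK)).trans ?_
    rw [sub_zero, abs_of_nonneg t.2.1]
    exact mul_le_mul_of_nonneg_left t.2.2 (by positivity)
  set B : Set C(Icc (0 : ℝ) T, X) := Metric.closedBall 0 (M + 1) with hB
  have hBe : ∀ v ∈ B, ∀ τ, ‖IccExtend hT0.le v τ‖ ≤ M + 1 := fun v hv τ =>
    (v.norm_coe_le_norm _).trans (mem_closedBall_zero_iff.mp hv)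
  have hmaps : MapsTo Φ B B := by
    intro v hv
    rw [hB, mem_closedBall_zero_iff, ContinuousMap.norm_le _ (by linarith)]
    intro t
    have h1 : ∀ τ, ‖N (IccExtend hT0.le v τ)‖ ≤ L * (M + 1) := fun τ => by
      have := hNL _ 0 (hBe v hv τ) (by simpa using by linarith)
      rw [hN0, sub_zero, sub_zero] at this
      exact this.trans (mul_le_mul_of_nonneg_left (hBe v hv τ) hL)
    have h2 := hint (t := t) (by positivity) h1
    refine (norm_add_le _ _).trans ?_
    have h3 := haM t ⟨t.2.1, t.2.2.trans hT1⟩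
    have h4 : K * (L * (M + 1)) * T = K * L * (M + 1) * T := by ring
    linarith
  have hcontr : ∀ v ∈ B, ∀ v' ∈ B, dist (Φ v) (Φ v') ≤ (1 / 2 : ℝ) * dist v v' := by
    intro v hv v' hv'
    rw [ContinuousMap.dist_le (by positivity)]
    intro t
    have h1 : ∀ τ, ‖N (IccExtend hT0.le v τ) - N (IccExtend hT0.le v' τ)‖ ≤ L * dist v v' :=
      fun τ => (hNL _ _ (hBe v hv τ) (hBe v' hv' τ)).trans
        (mul_le_mul_of_nonneg_left (by
          rw [← dist_eq_norm]; exact ContinuousMap.dist_apply_le_dist _) hL)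
    have h2 := hint (t := t) (by positivity) h1
    have h3 : Φ v t - Φ v' t = ∫ τ in (0 : ℝ)..t,
        S (t - τ) (N (IccExtend hT0.le v τ) - N (IccExtend hT0.le v' τ)) := by
      simp only [map_sub]
      have hi : ∀ v : C(Icc (0 : ℝ) T, X), IntervalIntegrable (fun τ => S (t - τ) (N (IccExtend hT0.le v τ))) volume
          0 t := fun v => (continuous_duhamel_integrand hS
            (hNc.comp (ext_cont v)) t).intervalIntegrable _ _
      rw [intervalIntegral.integral_sub (hi v) (hi v')]
      exact add_sub_add_left_eq_sub _ _ _
    rw [dist_eq_norm, h3]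
    refine h2.trans ?_
    have h4 : K * (L * dist v v') * T = K * L * T * dist v v' := by ring
    rw [h4]
    exact mul_le_mul_of_nonneg_right hTKL dist_nonneg
  have hcw : ContractingWith (1 / 2 : ℝ≥0) (hmaps.restrict Φ B B) := by
    refine ⟨by rw [div_lt_one (by norm_num)]; norm_num, LipschitzWith.of_dist_le_mul fun v v' => ?_⟩
    rw [Subtype.dist_eq, Subtype.dist_eq]
    exact (hcontr v v.2 v' v'.2).trans_eq (by norm_num)
  obtain ⟨v, hvB, hv, -⟩ := ContractingWith.exists_fixedPoint' (s := B)
    (Metric.isClosed_closedBall.isComplete) hmaps hcw (x := 0)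
    (Metric.mem_closedBall_self (by linarith)) (edist_ne_top _ _)
  refine ⟨IccExtend hT0.le v, ext_cont v, hBe v hvB, fun t ht => ?_⟩
  rw [IccExtend_of_mem _ _ ht]
  have h1 : Φ v ⟨t, ht⟩ = v ⟨t, ht⟩ := by rw [hv.eq]
  rw [← h1]
  rfl

/-- Continuous dependence for the Duhamel equation, by Gronwall's inequality. -/
theorem norm_duhamel_sub_le [CompleteSpace X] {S : ℝ → X →L[ℂ] X} (hS : Continuous S) {K : ℝ}
    (hK : 0 ≤ K) (hSK : ∀ t, ‖S t‖ ≤ K) {N : X → X} (hNc : Continuous N) {r L : ℝ} (hL : 0 ≤ L)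
    (hNL : ∀ f h, ‖f‖ ≤ r → ‖h‖ ≤ r → ‖N f - N h‖ ≤ L * ‖f - h‖) {T δ : ℝ} (hδ : 0 ≤ δ)
    {a a' u u' : ℝ → X} (hu : Continuous u) (hu' : Continuous u')
    (hur : ∀ t ∈ Icc (0 : ℝ) T, ‖u t‖ ≤ r) (hur' : ∀ t ∈ Icc (0 : ℝ) T, ‖u' t‖ ≤ r)
    (ha : ∀ t ∈ Icc (0 : ℝ) T, ‖a t - a' t‖ ≤ δ)
    (he : ∀ t ∈ Icc (0 : ℝ) T, u t = a t + ∫ τ in (0 : ℝ)..t, S (t - τ) (N (u τ)))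
    (he' : ∀ t ∈ Icc (0 : ℝ) T, u' t = a' t + ∫ τ in (0 : ℝ)..t, S (t - τ) (N (u' τ)))
    {t : ℝ} (ht : t ∈ Icc (0 : ℝ) T) : ‖u t - u' t‖ ≤ δ * Real.exp (K * L * t) := by
  set w : ℝ → ℝ := fun t => ‖u t - u' t‖ with hw
  have hwc : Continuous w := (hu.sub hu').norm
  have hw0 : ∀ t, 0 ≤ w t := fun t => norm_nonneg _
  -- The difference `w` need not be differentiable, so Gronwall is applied to its integral majorant,
  -- whose derivative `K L w` is at most `K L W`.
  set W : ℝ → ℝ := fun t => δ + K * L * ∫ τ in (0 : ℝ)..t, w τ with hW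
  have hwW : ∀ t ∈ Icc (0 : ℝ) T, w t ≤ W t := by
    intro t ht
    have h1 : u t - u' t = (a t - a' t)
        + ∫ τ in (0 : ℝ)..t, S (t - τ) (N (u τ) - N (u' τ)) := by
      simp only [map_sub]
      have hi : ∀ {v : ℝ → X}, Continuous v →
          IntervalIntegrable (fun τ => S (t - τ) (N (v τ))) volume 0 t := fun hv =>
        (continuous_duhamel_integrand hS (hNc.comp hv) t).intervalIntegrable _ _
      rw [he t ht, he' t ht, intervalIntegral.integral_sub (hi hu) (hi hu')]
      abel
    have h2 : ‖∫ τ in (0 : ℝ)..t, S (t - τ) (N (u τ) - N (u' τ))‖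
        ≤ ∫ τ in (0 : ℝ)..t, K * L * w τ := by
      refine intervalIntegral.norm_integral_le_of_norm_le ht.1 (ae_of_all _ fun τ hτ => ?_)
        ((continuous_const.mul hwc).intervalIntegrable _ _)
      have hτ' : τ ∈ Icc (0 : ℝ) T := ⟨hτ.1.le, hτ.2.trans ht.2⟩
      refine ((S (t - τ)).le_of_opNorm_le (hSK _) _).trans ?_
      rw [mul_assoc]
      exact mul_le_mul_of_nonneg_left (hNL _ _ (hur τ hτ') (hur' τ hτ')) hK
    rw [intervalIntegral.integral_const_mul] at h2
    calc w t ≤ ‖a t - a' t‖ + ‖∫ τ in (0 : ℝ)..t, S (t - τ) (N (u τ) - N (u' τ))‖ := by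
          rw [hw]
          simp only
          rw [h1]
          exact norm_add_le _ _
      _ ≤ W t := add_le_add (ha t ht) h2
  have hderiv : ∀ t, HasDerivAt W (K * L * w t) t := fun t =>
    ((hwc.integral_hasStrictDerivAt 0 t).hasDerivAt.const_mul (K * L)).const_add δ
  have hWn : ∀ t ∈ Icc (0 : ℝ) T, 0 ≤ W t := fun t ht => (hw0 t).trans (hwW t ht)
  have hgr := norm_le_gronwallBound_of_norm_deriv_right_le (f := W) (f' := fun t => K * L * w t)
    (δ := δ) (K := K * L) (ε := 0) (a := 0) (b := T)
    (fun t _ => (hderiv t).continuousAt.continuousWithinAt)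
    (fun t _ => (hderiv t).hasDerivWithinAt)
    (by simp [hW, abs_of_nonneg hδ])
    (fun t ht => by
      have ht' : t ∈ Icc (0 : ℝ) T := ⟨ht.1, ht.2.le⟩
      rw [add_zero, Real.norm_of_nonneg (mul_nonneg (mul_nonneg hK hL) (hw0 t)),
        Real.norm_of_nonneg (hWn t ht')]
      exact mul_le_mul_of_nonneg_left (hwW t ht') (mul_nonneg hK hL)) t ht
  rw [gronwallBound_ε0, sub_zero, Real.norm_of_nonneg (hWn t ht)] at hgr
  exact (hwW t ht).trans hgr

end Duhamel

end ModulationNLW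
end

noncomputable section

namespace ModulationNLW

open SchwartzMap FourierTransform BoundedContinuousFunction

variable {d : ℕ}

/-- Uniqueness for the Duhamel equation. -/
theorem eqOn_of_duhamel {X : Type*} [NormedAddCommGroup X] [NormedSpace ℂ X] [CompleteSpace X]
    {S : ℝ → X →L[ℂ] X} (hS : Continuous S) {K : ℝ} (hK : 0 ≤ K) (hSK : ∀ t, ‖S t‖ ≤ K)
    {N : X → X}
    (hN : ∀ r : ℝ, ∃ L : ℝ, 0 ≤ L ∧ ∀ f h, ‖f‖ ≤ r → ‖h‖ ≤ r → ‖N f - N h‖ ≤ L * ‖f - h‖)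
    {T : ℝ} {a u u' : ℝ → X} (hu : Continuous u) (hu' : Continuous u')
    (he : ∀ t ∈ Icc (0 : ℝ) T, u t = a t + ∫ τ in (0 : ℝ)..t, S (t - τ) (N (u τ)))
    (he' : ∀ t ∈ Icc (0 : ℝ) T, u' t = a t + ∫ τ in (0 : ℝ)..t, S (t - τ) (N (u' τ))) :
    EqOn u u' (Icc 0 T) := by
  -- Each solution is bounded on the compact interval, and a Lipschitz constant is taken on a ball
  -- containing both. No a priori size is assumed, so uniqueness is unconditional.
  obtain ⟨r, hr⟩ := isCompact_Icc.exists_bound_of_continuousOn hu.continuousOn (s := Icc 0 T)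
  obtain ⟨r', hr'⟩ := isCompact_Icc.exists_bound_of_continuousOn hu'.continuousOn (s := Icc 0 T)
  obtain ⟨L, hL, hNL⟩ := hN (max r r')
  intro t ht
  have h := norm_duhamel_sub_le hS hK hSK (continuous_of_locally_lipschitz hN) hL hNL
    (le_refl (0 : ℝ)) hu hu' (fun t ht => (hr t ht).trans (le_max_left _ _))
    (fun t ht => (hr' t ht).trans (le_max_right _ _)) (a := a) (a' := a) (by simp) he he' ht
  rw [zero_mul] at h
  exact sub_eq_zero.mp (norm_le_zero_iff.mp h)

/-! ### Distributional solutions and Banach-valued solutions. -/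

section Solutions

variable {g : 𝓢(Eucl d, ℂ)} {p : ℝ≥0∞} {s : ℝ} [hp : Fact (1 ≤ p)] [hg : Fact (g ≠ 0)]
  [hs : Fact (0 ≤ s)] {F : ℂ → ℂ} {S : ℝ → ModFun g p s →L[ℂ] ModFun g p s}
  {N : ModFun g p s → ModFun g p s} {T : ℝ} {A : ℝ → ModFun g p s} {u₀ u₁ : 𝓢'(Eucl d, ℂ)}

/-- Values on `[0, T]` are lifted through the identification with functions, and the curve is
continued by constants so that it is continuous on the line. -/
theorem IsContinuousCurve.exists_lift (hT : 0 ≤ T) {u : ℝ → 𝓢'(Eucl d, ℂ)}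
    (hu : IsContinuousCurve g p 1 s T u) :
    ∃ U : ℝ → ModFun g p s, Continuous U ∧ ∀ t ∈ Icc (0 : ℝ) T, (U t).toDistr = u t := by
  have hmem : ∀ t : Icc (0 : ℝ) T, ∃ k : ModFun g p s, k.toDistr = u t := fun t =>
    ModFun.exists_toDistr_eq (hu t t.2).1
  choose k hk using hmem
  have hcont : Continuous k := by
    rw [continuous_iff_continuousAt]
    intro t
    refine ModFun.tendsto_of_modNorm ?_
    have hte : Tendsto (fun t' : Icc (0 : ℝ) T => (t' : ℝ)) (𝓝 t) (𝓝[Icc 0 T] (t : ℝ)) :=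
      tendsto_nhdsWithin_iff.mpr ⟨continuous_subtype_val.tendsto t,
        Eventually.of_forall fun t' => t'.2⟩
    simp only [hk]
    exact ((hu t t.2).2).comp hte
  refine ⟨IccExtend hT k, hcont.Icc_extend', fun t ht => ?_⟩
  rw [IccExtend_of_mem _ _ ht, hk]

theorem isContinuousCurve_toDistr {U : ℝ → ModFun g p s} (hU : Continuous U) :
    IsContinuousCurve g p 1 s T fun t => (U t).toDistr := fun t _ =>
  ⟨(U t).toDistr_mem, ModFun.tendsto_modNorm ((hU.tendsto t).mono_left nhdsWithin_le_nhds)⟩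

/-- For continuous curves, the integral equation tested with Schwartz functions is the integral
equation in the Banach space. -/
theorem solvesDuhamel_iff (hS : Continuous S)
    (hSd : ∀ t : ℝ, |t| ≤ 1 → ∀ f, (S t f).toDistr = sinProp t f.toDistr) (hNc : Continuous N)
    (hNd : ∀ f : ModFun g p s, nonlin F f.toDistr = (N f).toDistr) (hT : T ≤ 1)
    (hA : ∀ t : ℝ, |t| ≤ 1 → (A t).toDistr = cosProp t u₀ + sinProp t u₁)
    {U : ℝ → ModFun g p s} (hU : Continuous U) {u : ℝ → 𝓢'(Eucl d, ℂ)}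
    (hUu : ∀ t ∈ Icc (0 : ℝ) T, (U t).toDistr = u t) :
    SolvesDuhamel F T u₀ u₁ u ↔
      ∀ t ∈ Icc (0 : ℝ) T, U t = A t + ∫ τ in (0 : ℝ)..t, S (t - τ) (N (U τ)) := by
  have hcont : ∀ t : ℝ, Continuous fun τ : ℝ => S (t - τ) (N (U τ)) := fun t =>
    continuous_duhamel_integrand hS (hNc.comp hU) t
  have heq : ∀ t ∈ Icc (0 : ℝ) T, ∀ τ ∈ uIcc 0 t, ∀ φ : 𝓢(Eucl d, ℂ),
      sinProp (t - τ) (nonlin F (u τ)) φ = ModFun.pairL φ (S (t - τ) (N (U τ))) := by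
    intro t ht τ hτ φ
    rw [uIcc_of_le ht.1] at hτ
    have h1 : |t - τ| ≤ 1 := by
      rw [abs_of_nonneg (by linarith [hτ.2])]
      linarith [hτ.1, ht.2]
    rw [ModFun.pairL_apply, hSd _ h1, ← hNd, hUu τ ⟨hτ.1, hτ.2.trans ht.2⟩]
  have hAt : ∀ t ∈ Icc (0 : ℝ) T, ∀ φ : 𝓢(Eucl d, ℂ),
      ModFun.pairL φ (A t) = cosProp t u₀ φ + sinProp t u₁ φ := by
    intro t ht φ
    rw [ModFun.pairL_apply, hA t (abs_le.mpr ⟨by linarith [ht.1], ht.2.trans hT⟩)]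
    rfl
  have hii : ∀ t ∈ Icc (0 : ℝ) T, ∀ φ : 𝓢(Eucl d, ℂ),
      ∫ τ in (0 : ℝ)..t, sinProp (t - τ) (nonlin F (u τ)) φ
        = ModFun.pairL φ (∫ τ in (0 : ℝ)..t, S (t - τ) (N (U τ))) := by
    intro t ht φ
    rw [← ContinuousLinearMap.intervalIntegral_comp_comm _ ((hcont t).intervalIntegrable _ _)]
    exact intervalIntegral.integral_congr fun τ hτ => heq t ht τ hτ φ
  constructor
  · intro h t ht
    refine ModFun.eq_of_pairL_eq fun φ => ?_
    rw [map_add, hAt t ht, ← hii t ht, ← (h t ht φ).2, ← hUu t ht, ModFun.pairL_apply]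
  · intro h t ht φ
    refine ⟨?_, ?_⟩
    · refine IntervalIntegrable.congr (fun τ hτ => (heq t ht τ (uIoc_subset_uIcc hτ) φ).symm)
        (((ModFun.pairL φ).continuous.comp (hcont t)).intervalIntegrable _ _)
    · rw [hii t ht, ← hAt t ht, ← map_add, ← h t ht, ModFun.pairL_apply, hUu t ht]

end Solutions

end ModulationNLW
end

/-! ### Local well-posedness. -/

theorem theorem1 (d : ℕ) (hd : 1 ≤ d) (g : 𝓢(ModulationNLW.Eucl d, ℂ)) (hg : g ≠ 0)
    (s : ℝ) (hs : 0 ≤ s) (p : ℝ≥0∞) (hp : 1 ≤ p)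
    (F : ℂ → ℂ) (hF : ModulationNLW.IsEntireRealAnalytic F) (hF0 : F 0 = 0)
    (R : ℝ) (hR : 0 < R) :
    ∃ T : ℝ, 0 < T ∧
      (∀ w ∈ ModulationNLW.dataBall g p s R,
        ∃ u : ℝ → 𝓢'(ModulationNLW.Eucl d, ℂ),
          ModulationNLW.IsSolution g p s T F w.1 w.2 u ∧
          ∀ v : ℝ → 𝓢'(ModulationNLW.Eucl d, ℂ),
            ModulationNLW.IsSolution g p s T F w.1 w.2 v → EqOn v u (Icc 0 T)) ∧
      ∃ L : ℝ≥0, ∀ w ∈ ModulationNLW.dataBall g p s R, ∀ w' ∈ ModulationNLW.dataBall g p s R,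
        ∀ u u' : ℝ → 𝓢'(ModulationNLW.Eucl d, ℂ),
          ModulationNLW.IsSolution g p s T F w.1 w.2 u →
          ModulationNLW.IsSolution g p s T F w'.1 w'.2 u' →
          ∀ t ∈ Icc (0 : ℝ) T,
            ModulationNLW.modNorm g p 1 s (u t - u' t) ≤
              L * max (ModulationNLW.modNorm g p 1 s (w.1 - w'.1))
                (ModulationNLW.modNorm g p 1 (s - 1) (w.2 - w'.2)) := by
  have : Fact (1 ≤ p) := ⟨hp⟩
  have : Fact (g ≠ 0) := ⟨hg⟩
  have : Fact (0 ≤ s) := ⟨hs⟩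
  obtain ⟨C, hC, H⟩ := ModulationNLW.exists_modNorm_propagator_le hd hg hp s
  obtain ⟨S, hS, ⟨K, hK, hSK⟩, hSd⟩ :=
    ModulationNLW.exists_sinProp_operator (g := g) (p := p) (s := s) hd
  obtain ⟨N, hNd, hN0, hN⟩ :=
    ModulationNLW.exists_nonlin_lipschitz (g := g) (p := p) (s := s) hF hF0
  have hNc := ModulationNLW.continuous_of_locally_lipschitz hN
  -- The factor `2` turns the sum of the two contributions into the maximum norm on the data.
  have hfree : ∀ (t : ℝ), |t| ≤ 1 → ∀ v₀ v₁ : 𝓢'(ModulationNLW.Eucl d, ℂ),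
      ModulationNLW.modNorm g p 1 s
        (ModulationNLW.cosProp t v₀ + ModulationNLW.sinProp t v₁) ≤
        2 * C * max (ModulationNLW.modNorm g p 1 s v₀)
          (ModulationNLW.modNorm g p 1 (s - 1) v₁) := by
    intro t ht v₀ v₁
    refine (ModulationNLW.modNorm_add_le g hp s _ _).trans ?_
    rw [mul_assoc, two_mul]
    exact add_le_add ((H t t ht ht v₀).1.trans (by gcongr; exact le_max_left _ _))
      ((H t t ht ht v₁).2.1.trans (by gcongr; exact le_max_right _ _))
  have hM : 0 ≤ (2 * C * ENNReal.ofReal R).toReal := ENNReal.toReal_nonneg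
  have h2C : 2 * C < ∞ := ENNReal.mul_lt_top (by simp) hC
  -- A bound for the free evolution of all data in the ball; since the existence time depends on the
  -- data only through `M`, it is common to the whole ball.
  set M := (2 * C * ENNReal.ofReal R).toReal with hMdef
  obtain ⟨T, hT0, hT1, hex⟩ := ModulationNLW.exists_duhamel_solution hS hK hSK hN0 hN hM
  have habs : ∀ t ∈ Icc (0 : ℝ) 1, |t| ≤ 1 := fun t ht => by rw [abs_of_nonneg ht.1]; exact ht.2
  have hdata : ∀ w ∈ ModulationNLW.dataBall g p s R,
      ∃ A U : ℝ → ModulationNLW.ModFun g p s, Continuous U ∧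
        (∀ t : ℝ, |t| ≤ 1 → (A t).toDistr =
          ModulationNLW.cosProp t w.1 + ModulationNLW.sinProp t w.2) ∧
        (∀ t, ‖U t‖ ≤ M + 1) ∧
        ∀ t ∈ Icc (0 : ℝ) T, U t = A t + ∫ τ in (0 : ℝ)..t, S (t - τ) (N (U τ)) := by
    intro w hw
    obtain ⟨A, hAc, hA⟩ := ModulationNLW.exists_free_evolution hd hw.1 hw.2.1
    obtain ⟨U, hU, hUM, hUe⟩ := hex A hAc fun t ht => by
      rw [ModulationNLW.ModFun.norm_def, hA t (habs t ht), hMdef]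
      refine ENNReal.toReal_mono (ENNReal.mul_lt_top h2C ENNReal.ofReal_lt_top).ne
        ((hfree t (habs t ht) _ _).trans ?_)
      gcongr
      exact hw.2.2
    exact ⟨A, U, hU, hA, hUM, hUe⟩
  -- Every solution equals the constructed one. This also gives it the bound `M + 1`, so the
  -- Lipschitz estimate can be stated for arbitrary solutions.
  have huniq : ∀ w ∈ ModulationNLW.dataBall g p s R, ∀ {A U : ℝ → ModulationNLW.ModFun g p s},
      Continuous U → (∀ t : ℝ, |t| ≤ 1 → (A t).toDistr =
          ModulationNLW.cosProp t w.1 + ModulationNLW.sinProp t w.2) →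
        (∀ t ∈ Icc (0 : ℝ) T, U t = A t + ∫ τ in (0 : ℝ)..t, S (t - τ) (N (U τ))) →
      ∀ v, ModulationNLW.IsSolution g p s T F w.1 w.2 v →
        ∀ t ∈ Icc (0 : ℝ) T, (U t).toDistr = v t := by
    intro w _ A U hU hA hUe v hv t ht
    obtain ⟨V, hV, hVv⟩ := hv.1.exists_lift hT0.le
    have hVe := (ModulationNLW.solvesDuhamel_iff hS hSd hNc hNd hT1 hA hV hVv).mp hv.2
    rw [← hVv t ht, ModulationNLW.eqOn_of_duhamel hS hK hSK hN hU hV hUe hVe ht]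
  refine ⟨T, hT0, fun w hw => ?_, ?_⟩
  · obtain ⟨A, U, hU, hA, -, hUe⟩ := hdata w hw
    refine ⟨fun t => (U t).toDistr, ⟨ModulationNLW.isContinuousCurve_toDistr hU,
      (ModulationNLW.solvesDuhamel_iff hS hSd hNc hNd hT1 hA hU fun _ _ => rfl).mpr hUe⟩,
      fun v hv t ht => (huniq w hw hU hA hUe v hv t ht).symm⟩
  · obtain ⟨L, hL, hNL⟩ := hN (M + 1)
    -- The factor `2 * C` bounds the difference of the free evolutions by that of the data, and the
    -- exponential is the Gronwall factor at the final time.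
    refine ⟨(2 * C).toNNReal * (Real.exp (K * L * T)).toNNReal,
      fun w hw w' hw' u u' hu hu' t ht => ?_⟩
    obtain ⟨A, U, hU, hA, hUM, hUe⟩ := hdata w hw
    obtain ⟨A', U', hU', hA', hUM', hUe'⟩ := hdata w' hw'
    set m := max (ModulationNLW.modNorm g p 1 s (w.1 - w'.1))
      (ModulationNLW.modNorm g p 1 (s - 1) (w.2 - w'.2)) with hm
    have hm_top : m < ∞ := max_lt (ModulationNLW.sub_mem_modSpace hp hw.1 hw'.1).1
      (ModulationNLW.sub_mem_modSpace hp hw.2.1 hw'.2.1).1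
    have hle := ModulationNLW.norm_duhamel_sub_le hS hK hSK hNc hL hNL
      (δ := (2 * C * m).toReal) ENNReal.toReal_nonneg hU hU' (fun t _ => hUM t)
      (fun t _ => hUM' t) (fun t ht => by
        have ht1 := habs t ⟨ht.1, ht.2.trans hT1⟩
        rw [ModulationNLW.ModFun.norm_def, map_sub, hA t ht1, hA' t ht1, add_sub_add_comm,
          ← map_sub, ← map_sub]
        exact ENNReal.toReal_mono (ENNReal.mul_lt_top h2C hm_top).ne (hfree t ht1 _ _))
      hUe hUe' ht
    rw [← huniq w hw hU hA hUe u hu t ht, ← huniq w' hw' hU' hA' hUe' u' hu' t ht, ← map_sub,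
      ← ModulationNLW.ModFun.ofReal_norm]
    have hexp : Real.exp (K * L * t) ≤ Real.exp (K * L * T) :=
      Real.exp_le_exp.mpr (mul_le_mul_of_nonneg_left ht.2 (mul_nonneg hK hL))
    calc ENNReal.ofReal ‖U t - U' t‖
        ≤ ENNReal.ofReal ((2 * C * m).toReal * Real.exp (K * L * T)) :=
          ENNReal.ofReal_le_ofReal
            (hle.trans (mul_le_mul_of_nonneg_left hexp ENNReal.toReal_nonneg))
      _ = 2 * C * m * ENNReal.ofReal (Real.exp (K * L * T)) := by
          rw [ENNReal.ofReal_mul ENNReal.toReal_nonneg,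
            ENNReal.ofReal_toReal (ENNReal.mul_lt_top h2C hm_top).ne]
      _ = _ := by
          rw [ENNReal.coe_mul, ENNReal.coe_toNNReal h2C.ne, mul_right_comm]
          rfl
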